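/- Let $n\ge 1$ and $0<\beta\le 1$. Write points of $\mathbb R^{1+2n}$ as $(t,x,v)$ with $t\in\mathbb R$ and $x,v\in\mathbb R^n$, and let $\|\cdot\|$ be the norm of $L^2=L^2(\mathbb R^{1+2n};\mathbb C)$. For $s>0$ let $|D_v|^s$ and $|D_x|^s$ be the Fourier multipliers with symbols $|\xi|^s$ and $|k|^s$, where $(\tau,k,\xi)$ are the Fourier variables dual to $(t,x,v)$. Let $f,g\in L^2$; the equations below are understood in the sense of tempered distributions (in particular, smooth $f,g\in L^2$ that solve them in this sense are allowed). (1) There is a constant $C$, depending only on $n$ and $\beta$, such that whenever $\partial_t f+v\cdot\nabla_x f+|D_v|^{2\beta}f=g$, one has $|D_v|^{2\beta}f\in L^2$, $|D_x|^{\frac{2\beta}{1+2\beta}}f\in L^2$ and $$\big\||D_v|^{2\beta}f\big\|+\big\||D_x|^{\frac{2\beta}{1+2\beta}}f\big\|\le C\,\|g\|.$$ (2) Let $a=b^2\chi+a_-$, where $a_->0$ is a constant, $b=b(t,x,v)\ge 0$ is smooth, and $\chi=\chi(t,x,v)\ge 0$ is smooth with compact support. There is a constant $C_a$, depending only on $n$,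 $\beta$ and $a$, such that whenever $\partial_t f+v\cdot\nabla_x f+a\,|D_v|^{2\beta}f=g$, one has $|D_v|^{2\beta}f\in L^2$, $|D_x|^{\frac{2\beta}{1+2\beta}}f\in L^2$ and $$\big\||D_v|^{2\beta}f\big\|+\big\||D_x|^{\frac{2\beta}{1+2\beta}}f\big\|\le C_a\,\big(\|g\|+\|f\|\big).$$ -/

import Mathlib

open MeasureTheory SchwartzMap
open scoped FourierTransform ContDiff

/-- The space `ℝ^{1+n+n}` of points `z = (t, x, v)`, with its Euclidean structure and Lebesgue
measure.  The same space carries the dual variables `ζ = (τ, k, ξ)`. -/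
abbrev PhaseSpace (n : ℕ) : Type := EuclideanSpace ℝ (Unit ⊕ (Fin n ⊕ Fin n))

/-- The Hilbert space `L²(ℝ^{1+2n})` of complex-valued functions, for Lebesgue measure. -/
abbrev PhaseL2 (n : ℕ) : Type := Lp (α := PhaseSpace n) ℂ 2 volume

namespace PhaseSpace

/-- The position component `x` of `(t, x, v)` (or `k` of `(τ, k, ξ)`). -/
noncomputable def xPart {n : ℕ} (z : PhaseSpace n) : EuclideanSpace ℝ (Fin n) :=
  WithLp.toLp 2 fun i => z (Sum.inr (Sum.inl i))

/-- The velocity component `v` of `(t, x, v)` (or `ξ` of `(τ, k, ξ)`). -/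
noncomputable def vPart {n : ℕ} (z : PhaseSpace n) : EuclideanSpace ℝ (Fin n) :=
  WithLp.toLp 2 fun i => z (Sum.inr (Sum.inr i))

/-- The unit vector of the `t`-axis. -/
noncomputable def tDir (n : ℕ) : PhaseSpace n := EuclideanSpace.single (Sum.inl ()) 1

/-- The unit vector of the `x_i`-axis. -/
noncomputable def xDir {n : ℕ} (i : Fin n) : PhaseSpace n :=
  EuclideanSpace.single (Sum.inr (Sum.inl i)) 1

end PhaseSpace

/-- The free transport operator `∂_t φ + v · ∇_x φ`. -/
noncomputable def transport {n : ℕ} (φ : PhaseSpace n → ℂ) (z : PhaseSpace n) : ℂ :=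
  fderiv ℝ φ z (PhaseSpace.tDir n)
    + ∑ i : Fin n, (PhaseSpace.vPart z i : ℂ) * fderiv ℝ φ z (PhaseSpace.xDir i)

/-- The Fourier symbol of `|D_v|^s`.  Mathlib's Fourier transform is
`𝓕 φ ζ = ∫ exp (-2πi ⟨z, ζ⟩) φ z dz`, so that `D = -i ∂` has the symbol `2π ζ`. -/
noncomputable def symbolDv {n : ℕ} (s : ℝ) (ζ : PhaseSpace n) : ℝ :=
  (2 * Real.pi * ‖PhaseSpace.vPart ζ‖) ^ s

/-- The Fourier symbol of `|D_x|^s`. -/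
noncomputable def symbolDx {n : ℕ} (s : ℝ) (ζ : PhaseSpace n) : ℝ :=
  (2 * Real.pi * ‖PhaseSpace.xPart ζ‖) ^ s

/-- The operator `m(D)` with symbol `m` (of polynomial growth) on rapidly decreasing smooth
functions: `m(D) ψ = 𝓕⁻¹ (m · 𝓕 ψ)`. -/
noncomputable def fourierMult {n : ℕ} (m : PhaseSpace n → ℝ) (ψ : PhaseSpace n → ℂ) :
    PhaseSpace n → ℂ :=
  𝓕⁻ (fun ζ => (m ζ : ℂ) * 𝓕 ψ ζ)

/-- For `f, h ∈ L²`: `m(D) f = h`, that is `𝓕 h = m · 𝓕 f` almost everywhere, where `𝓕` is the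
Fourier-Plancherel transform of `L²`.  There is at most one such `h`, and there is one exactly if
`m · 𝓕 f ∈ L²`, that is, if the tempered distribution `m(D) f` belongs to `L²`. -/
def IsFourierMult {n : ℕ} (m : PhaseSpace n → ℝ) (f h : PhaseL2 n) : Prop :=
  (𝓕 h : PhaseL2 n) =ᵐ[volume]
    fun ζ => (m ζ : ℂ) * (𝓕 f : PhaseL2 n) ζ

/-- For `f, g ∈ L²`: the equation `∂_t f + v · ∇_x f + a |D_v|^{2β} f = g` holds in the sense of
tempered distributions.  Here `a` is a smooth real coefficient, bounded with all its derivatives.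
Against a test function `φ`, the operator `∂_t + v · ∇_x` is skew-symmetric and `|D_v|^{2β}` is
symmetric for the pairing `∫ f φ`, since its symbol is even. -/
def IsKineticSolution {n : ℕ} (β : ℝ) (a : PhaseSpace n → ℝ)
    (f g : PhaseL2 n) : Prop :=
  ∀ φ : 𝓢(PhaseSpace n, ℂ),
    ∫ z, f z * (-transport (fun w => φ w) z
        + fourierMult (symbolDv (2 * β)) (fun w => (a w : ℂ) * φ w) z)
      = ∫ z, g z * φ z

/-! Put p = 2β and let w be the symbol of |D_v|^p, which is |ξ|^p up to powers of 2π. On the Fourier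
side the transport is the derivative along the field (τ, k, ξ) ↦ (0, 0, k), so for a constant
coefficient A the equation is an ordinary differential equation along the lines ξ + sk. Solving it
back from s = ∞ bounds the transform U of f pointwise by the integral over s > 0 of exp(-A ∫_0^s w(ξ
+ ρk) dρ) |Q(τ, k, ξ + sk)|, where Q is the transform of the right side
(`ae_enorm_le_lintegral_comp_linearFlow`). The boundary term disappears because the flow preserves
volume and U is square integrable. Up to constants, the cost in the exponent dominates both s|ξ|^p
and s^(1+p)|k|^p (`mul_symbol_le_runningCost`, `mul_displacement_le_runningCost`): the segment
cannot stay near the origin. Hence the kernels |ξ|^p e^(-cost) and |k|^(p/(1+p)) e^(-cost) are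
integrable in s, uniformly in (ξ, k), and so are their transposes. Schur's test
(`lintegral_sq_lintegral_comp_le`) then gives part (1).

For part (2) the coefficient is frozen where it is almost constant. Let χ be a cutoff to the set
where a is close to a constant A. Then χf solves the equation with coefficient A, and the new right
side consists of χg, f times the transport derivative of χ, |D_v|^p((A - a)χf), and the commutator
of |D_v|^p with aχ applied to f. The third term is absorbed because A - a is small on the support of
χ and the constant of the frozen estimate is proportional to 1/A. Commutators are small relative to
|D_v|^p f, up to a multiple of ‖f‖, by the elementary inequality |x^p - y^p| ≤ ε y^p + C|x - y|^p
(`exists_abs_rpow_sub_rpow_le`) and Young's inequality.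

Absorption needs finite quantities, and |D_v|^p f is not known to be in L². It is therefore replaced
by v_r = |D_v|^p (1 + r|D_v|^p)⁻¹ f with r > 0. The frozen estimate survives for sources (1 +
r|D_v|^p)P with a constant independent of r (`IsFrozenSolution.lintegral_symbolDv_le`), so all
bounds are uniform in r, and Fatou's lemma lets r tend to 0. The cutoffs are bump functions of the
value of a; finitely many suffice since a is bounded. Once |D_v|^p f is in L², the term (1 -
a)|D_v|^p f may be moved to the right side, and the x-regularity is that of part (1). -/

section RunningCostBounds

open Set Filter Topology ENNReal

/-! ### Lower bounds for the cost of a segment, and the kernel integrals they imply. -/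

section RunningCost

variable {V : Type*} [NormedAddCommGroup V] [NormedSpace ℝ V]

/-- The integral of `(2π|·|)^p` along the segment from `ξ` to `ξ + s k`. -/
noncomputable def runningCost (p : ℝ) (ξ k : V) (s : ℝ) : ℝ :=
  ∫ ρ in (0 : ℝ)..s, (2 * Real.pi * ‖ξ + ρ • k‖) ^ p

theorem continuous_pathSymbol {p : ℝ} (hp : 0 < p) (ξ k : V) :
    Continuous fun ρ : ℝ => (2 * Real.pi * ‖ξ + ρ • k‖) ^ p :=
  Continuous.rpow_const (by fun_prop) fun _ => Or.inr hp.le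

theorem pathSymbol_nonneg (p : ℝ) (ξ k : V) (ρ : ℝ) :
    0 ≤ (2 * Real.pi * ‖ξ + ρ • k‖) ^ p := by positivity

theorem hasDerivAt_runningCost {p : ℝ} (hp : 0 < p) (ξ k : V) (s : ℝ) :
    HasDerivAt (runningCost p ξ k) ((2 * Real.pi * ‖ξ + s • k‖) ^ p) s :=
  (continuous_pathSymbol hp ξ k).integral_hasStrictDerivAt 0 s |>.hasDerivAt

/-- Passing through the maximum treats all p > 0 alike, with no convexity constant. -/
theorem rpow_le_rpow_add_rpow {p : ℝ} (hp : 0 < p) {x a b : ℝ} (c : ℝ) (hc : 0 < c) (hx : 0 ≤ x)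
    (ha : 0 ≤ a) (hb : 0 ≤ b) (h : x ≤ c * max a b) : (x / c) ^ p ≤ a ^ p + b ^ p := by
  have h1 : x / c ≤ max a b := by rw [div_le_iff₀ hc]; linarith
  have h2 : (x / c) ^ p ≤ max a b ^ p := Real.rpow_le_rpow (by positivity) h1 hp.le
  rcases le_total a b with hab | hab
  · rw [max_eq_right hab] at h2
    linarith [Real.rpow_nonneg ha p]
  · rw [max_eq_left hab] at h2
    linarith [Real.rpow_nonneg hb p]

theorem runningCost_mono {p : ℝ} (hp : 0 < p) (ξ k : V) {s t : ℝ} (hst : s ≤ t) :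
    runningCost p ξ k s ≤ runningCost p ξ k t := by
  have := intervalIntegral.integral_add_adjacent_intervals
    ((continuous_pathSymbol hp ξ k).intervalIntegrable (μ := volume) 0 s)
    ((continuous_pathSymbol hp ξ k).intervalIntegrable (μ := volume) s t)
  have h2 : 0 ≤ ∫ ρ in s..t, (2 * Real.pi * ‖ξ + ρ • k‖) ^ p :=
    intervalIntegral.integral_nonneg hst fun ρ _ => pathSymbol_nonneg p ξ k ρ
  simp only [runningCost]
  linarith

/-- Along a line the average of `|·|^p` from a point on dominates its value there. -/
theorem mul_symbol_le_runningCost {p : ℝ} (hp : 0 < p) (ξ k : V) {s : ℝ} (hs : 0 ≤ s) :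
    s * (2 * Real.pi * ‖ξ‖) ^ p ≤ 3 ^ (p + 1) * runningCost p ξ k s := by
  have hc := continuous_pathSymbol hp ξ k
  have hc2 : Continuous fun ρ : ℝ => (2 * Real.pi * ‖ξ + (2 * ρ) • k‖) ^ p :=
    hc.comp (continuous_const.mul continuous_id)
  have key : ∀ ρ : ℝ, (2 * Real.pi * ‖ξ‖ / 3) ^ p
      ≤ (2 * Real.pi * ‖ξ + ρ • k‖) ^ p + (2 * Real.pi * ‖ξ + (2 * ρ) • k‖) ^ p := by
    intro ρ
    refine rpow_le_rpow_add_rpow hp 3 (by norm_num) (by positivity) (by positivity)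
      (by positivity) ?_
    -- Extrapolating back to the starting point from the points at ρ and 2ρ: one of the two has norm
    -- at least ‖ξ‖ / 3.
    have h1 : ξ = (2 : ℝ) • (ξ + ρ • k) - (ξ + (2 * ρ) • k) := by module
    have h2 : ‖ξ‖ ≤ 2 * ‖ξ + ρ • k‖ + ‖ξ + (2 * ρ) • k‖ := by
      conv_lhs => rw [h1]
      refine (norm_sub_le _ _).trans ?_
      rw [norm_smul]; simp
    have h3 := mul_le_mul_of_nonneg_left h2 (by positivity : 0 ≤ 2 * Real.pi)
    have h4 := le_max_left (2 * Real.pi * ‖ξ + ρ • k‖) (2 * Real.pi * ‖ξ + (2 * ρ) • k‖)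
    have h5 := le_max_right (2 * Real.pi * ‖ξ + ρ • k‖) (2 * Real.pi * ‖ξ + (2 * ρ) • k‖)
    linarith
  -- On [0, s/2] the point 2ρ stays in [0, s]. The substitution ρ ↦ 2ρ halves the second integral,
  -- so the total is at most 3/2 of the cost.
  have hint := intervalIntegral.integral_mono_on (a := 0) (b := s / 2) (μ := volume) (by linarith)
    (continuous_const.intervalIntegrable 0 (s / 2))
    ((hc.add hc2).intervalIntegrable 0 (s / 2)) fun ρ _ => key ρ
  simp only [Pi.add_apply] at hint
  rw [intervalIntegral.integral_add (hc.intervalIntegrable _ _) (hc2.intervalIntegrable _ _),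
    intervalIntegral.integral_const,
    intervalIntegral.integral_comp_mul_left (fun ρ => (2 * Real.pi * ‖ξ + ρ • k‖) ^ p)
      (two_ne_zero)] at hint
  have h6 : 2 * (s / 2) = s := by ring
  rw [mul_zero, h6, Real.div_rpow (by positivity) (by norm_num)] at hint
  have hm : ∫ ρ in (0 : ℝ)..s / 2, (2 * Real.pi * ‖ξ + ρ • k‖) ^ p ≤ runningCost p ξ k s :=
    runningCost_mono hp ξ k (by linarith)
  change _ ≤ _ + (2 : ℝ)⁻¹ • runningCost p ξ k s at hint
  rw [Real.rpow_add (by norm_num), Real.rpow_one]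
  have h3 : (0 : ℝ) < 3 ^ p := by positivity
  simp only [smul_eq_mul, sub_zero] at hint
  have h7 : s / 2 * ((2 * Real.pi * ‖ξ‖) ^ p / 3 ^ p) ≤ 3 / 2 * runningCost p ξ k s := by linarith
  have h8 := mul_le_mul_of_nonneg_left h7 (by positivity : 0 ≤ 2 * (3 : ℝ) ^ p)
  have h9 : 2 * (3 : ℝ) ^ p * (s / 2 * ((2 * Real.pi * ‖ξ‖) ^ p / 3 ^ p))
      = s * (2 * Real.pi * ‖ξ‖) ^ p := by field_simp
  rw [h9] at h8
  linarith

/-- A segment of length `s|k|` cannot stay near the origin. -/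
theorem mul_displacement_le_runningCost {p : ℝ} (hp : 0 < p) (ξ k : V) {s : ℝ} (hs : 0 ≤ s) :
    s / 2 * (2 * Real.pi * (s * ‖k‖) / 4) ^ p ≤ runningCost p ξ k s := by
  have hc := continuous_pathSymbol hp ξ k
  have hc2 : Continuous fun ρ : ℝ => (2 * Real.pi * ‖ξ + (ρ + s / 2) • k‖) ^ p :=
    hc.comp (continuous_id.add continuous_const)
  have key : ∀ ρ : ℝ, (2 * Real.pi * (s * ‖k‖) / 4) ^ p
      ≤ (2 * Real.pi * ‖ξ + ρ • k‖) ^ p + (2 * Real.pi * ‖ξ + (ρ + s / 2) • k‖) ^ p := by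
    intro ρ
    refine rpow_le_rpow_add_rpow hp 4 (by norm_num) (by positivity) (by positivity)
      (by positivity) ?_
    -- Two points half a segment apart are at distance s‖k‖ / 2, so one of them has norm at least
    -- s‖k‖ / 4.
    have h1 : (s / 2) • k = (ξ + (ρ + s / 2) • k) - (ξ + ρ • k) := by module
    have h2 : s / 2 * ‖k‖ ≤ ‖ξ + (ρ + s / 2) • k‖ + ‖ξ + ρ • k‖ := by
      calc s / 2 * ‖k‖ = ‖(s / 2) • k‖ := by
            rw [norm_smul, Real.norm_of_nonneg (by linarith)]
        _ ≤ _ := by rw [h1]; exact norm_sub_le _ _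
    have h3 := mul_le_mul_of_nonneg_left h2 (by positivity : 0 ≤ 2 * Real.pi)
    have h4 := le_max_left (2 * Real.pi * ‖ξ + ρ • k‖) (2 * Real.pi * ‖ξ + (ρ + s / 2) • k‖)
    have h5 := le_max_right (2 * Real.pi * ‖ξ + ρ • k‖) (2 * Real.pi * ‖ξ + (ρ + s / 2) • k‖)
    linarith
  have hint := intervalIntegral.integral_mono_on (a := 0) (b := s / 2) (μ := volume) (by linarith)
    (continuous_const.intervalIntegrable 0 (s / 2))
    ((hc.add hc2).intervalIntegrable 0 (s / 2)) fun ρ _ => key ρ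
  simp only [Pi.add_apply] at hint
  rw [intervalIntegral.integral_add (hc.intervalIntegrable _ _) (hc2.intervalIntegrable _ _),
    intervalIntegral.integral_const,
    intervalIntegral.integral_comp_add_right (fun ρ => (2 * Real.pi * ‖ξ + ρ • k‖) ^ p),
    zero_add, add_halves, intervalIntegral.integral_add_adjacent_intervals
      (hc.intervalIntegrable _ _) (hc.intervalIntegrable _ _)] at hint
  simpa [runningCost] using hint

/-- The fundamental theorem of calculus on [0, m] and exhaustion by m → ∞. A bound on the increments
of the primitive is enough; its limit is not needed. -/
theorem lintegral_Ioi_le_of_hasDerivAt {F f : ℝ → ℝ} {M : ℝ} (hF : ∀ s, HasDerivAt F (f s) s)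
    (hf : Continuous f) (h0 : ∀ s, 0 ≤ f s) (hM : ∀ s, 0 ≤ s → F s - F 0 ≤ M) :
    ∫⁻ s in Ioi (0 : ℝ), ENNReal.ofReal (f s) ≤ ENNReal.ofReal M := by
  have hcov : AECover (volume.restrict (Ioi (0 : ℝ))) atTop fun m : ℕ => Iic (m : ℝ) :=
    aecover_Iic tendsto_natCast_atTop_atTop
  refine le_of_tendsto' (hcov.lintegral_tendsto_of_nat
    (hf.measurable.ennreal_ofReal.aemeasurable)) fun m => ?_
  rw [Measure.restrict_restrict measurableSet_Iic, Iic_inter_Ioi,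
    ← ofReal_integral_eq_lintegral_ofReal]
  · refine ENNReal.ofReal_le_ofReal ?_
    rw [← intervalIntegral.integral_of_le m.cast_nonneg,
      intervalIntegral.integral_eq_sub_of_hasDerivAt (fun s _ => hF s) (hf.intervalIntegrable _ _)]
    exact hM _ m.cast_nonneg
  · exact (hf.intervalIntegrable 0 (m : ℝ)).1
  · exact ae_of_all _ h0

theorem lintegral_Ioi_mul_exp_neg_le {l : ℝ} (hl : 0 ≤ l) :
    ∫⁻ s in Ioi (0 : ℝ), ENNReal.ofReal (l * Real.exp (-(l * s))) ≤ 1 := by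
  have := lintegral_Ioi_le_of_hasDerivAt (F := fun s => -Real.exp (-(l * s)))
    (f := fun s => l * Real.exp (-(l * s))) (M := 1) ?_ (by fun_prop) (fun s => by positivity) ?_
  · simpa using this
  · intro s
    have h := ((hasDerivAt_id s).const_mul l).neg.exp.neg
    exact h.congr_deriv (by simp; ring)
  · intro s _
    have := Real.exp_pos (-(l * s))
    simp; linarith

/-- The cost is at least w s / 3^(p+1), so the integrand is at most 3^(p+1)/A times the exponential
density of rate A w / 3^(p+1). Nothing is divided by w, which may vanish. -/
theorem lintegral_symbol_mul_exp_neg_runningCost_le {p A : ℝ} (hp : 0 < p) (hA : 0 < A)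
    (ξ k : V) :
    ∫⁻ s in Ioi (0 : ℝ), ENNReal.ofReal
        ((2 * Real.pi * ‖ξ‖) ^ p * Real.exp (-(A * runningCost p ξ k s)))
      ≤ ENNReal.ofReal (3 ^ (p + 1) / A) := by
  set w := (2 * Real.pi * ‖ξ‖) ^ p with hw
  have hw0 : 0 ≤ w := by positivity
  have h3 : (0 : ℝ) < 3 ^ (p + 1) := by positivity
  set l := A * w / 3 ^ (p + 1) with hl
  have hl0 : 0 ≤ l := by positivity
  calc _ ≤ ∫⁻ s in Ioi (0 : ℝ), ENNReal.ofReal (3 ^ (p + 1) / A) *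
        ENNReal.ofReal (l * Real.exp (-(l * s))) := by
        refine setLIntegral_mono' measurableSet_Ioi fun s hs => ?_
        rw [← ENNReal.ofReal_mul (by positivity)]
        refine ENNReal.ofReal_le_ofReal ?_
        have h1 := mul_symbol_le_runningCost hp ξ k (le_of_lt hs)
        have h2 : l * s ≤ A * runningCost p ξ k s := by
          rw [hl, div_mul_eq_mul_div, div_le_iff₀ h3]
          nlinarith
        have h4 : Real.exp (-(A * runningCost p ξ k s)) ≤ Real.exp (-(l * s)) :=
          Real.exp_le_exp.2 (by linarith)
        calc _ ≤ w * Real.exp (-(l * s)) := mul_le_mul_of_nonneg_left h4 hw0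
          _ = _ := by rw [hl]; field_simp
    _ ≤ _ := by
        rw [lintegral_const_mul _ (by fun_prop)]
        exact mul_le_of_le_one_right' (lintegral_Ioi_mul_exp_neg_le hl0)

/-- The weight at the moving endpoint is the derivative of the cost, so the integrand is the exact
derivative of -exp(-A cost)/A. -/
theorem lintegral_pathSymbol_mul_exp_neg_runningCost_le {p A : ℝ} (hp : 0 < p) (hA : 0 < A)
    (ξ k : V) :
    ∫⁻ s in Ioi (0 : ℝ), ENNReal.ofReal
        ((2 * Real.pi * ‖ξ + s • k‖) ^ p * Real.exp (-(A * runningCost p ξ k s)))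
      ≤ ENNReal.ofReal (1 / A) := by
  have hd := hasDerivAt_runningCost hp ξ k
  have hcont : Continuous (runningCost p ξ k) :=
    continuous_iff_continuousAt.2 fun s => (hd s).continuousAt
  have hc := continuous_pathSymbol hp ξ k
  refine lintegral_Ioi_le_of_hasDerivAt
    (F := fun s => -(Real.exp (-(A * runningCost p ξ k s)) / A)) ?_ (by fun_prop)
    (fun s => by positivity) ?_
  · intro s
    have h := (((hd s).const_mul A).neg.exp.div_const A).neg
    exact h.congr_deriv (by field_simp; exact mul_comm _ _)
  · intro s _
    have h0 : runningCost p ξ k 0 = 0 := by simp [runningCost]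
    have : 0 ≤ Real.exp (-(A * runningCost p ξ k s)) / A := by positivity
    simp only [h0, mul_zero, neg_zero, Real.exp_zero]
    linarith

/-- The exponent p/(1+p) comes from scaling: with κ the weight in k, the displacement bound
s^(1+p)|k|^p is (κs)^(1+p). The constant 8 is large enough to swallow the factor 4^p · 2 of that
bound. -/
theorem lintegral_displacement_mul_exp_neg_runningCost_le {p : ℝ} (hp : 0 < p) (ξ k : V) :
    ∫⁻ s in Ioi (0 : ℝ), ENNReal.ofReal
        ((2 * Real.pi * ‖k‖) ^ (p / (1 + p)) * Real.exp (-runningCost p ξ k s))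
      ≤ ENNReal.ofReal (8 * Real.exp 1) := by
  set κ := (2 * Real.pi * ‖k‖) ^ (p / (1 + p)) with hκ
  have hκ0 : 0 ≤ κ := by positivity
  have hκp : κ ^ (1 + p) = (2 * Real.pi * ‖k‖) ^ p := by
    rw [hκ, ← Real.rpow_mul (by positivity), div_mul_cancel₀ _ (by positivity)]
  calc _ ≤ ∫⁻ s in Ioi (0 : ℝ), ENNReal.ofReal (8 * Real.exp 1) *
        ENNReal.ofReal (κ / 8 * Real.exp (-(κ / 8 * s))) := by
        refine setLIntegral_mono' measurableSet_Ioi fun s hs => ?_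
        have hs0 : (0 : ℝ) < s := hs
        rw [← ENNReal.ofReal_mul (by positivity)]
        refine ENNReal.ofReal_le_ofReal ?_
        have h1 := mul_displacement_le_runningCost hp ξ k hs0.le
        have h2 : (κ / 8 * s) ^ (1 + p) ≤ s / 2 * (2 * Real.pi * (s * ‖k‖) / 4) ^ p := by
          have e1 : (κ / 8 * s) ^ (1 + p)
              = (2 * Real.pi * ‖k‖) ^ p * s ^ p * s / (8 ^ p * 8) := by
            rw [Real.mul_rpow (by positivity) hs0.le, Real.div_rpow hκ0 (by norm_num), hκp,
              Real.rpow_add hs0, Real.rpow_add (by norm_num : (0 : ℝ) < 8), Real.rpow_one,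
              Real.rpow_one]
            ring
          have e2 : s / 2 * (2 * Real.pi * (s * ‖k‖) / 4) ^ p
              = (2 * Real.pi * ‖k‖) ^ p * s ^ p * s / (4 ^ p * 2) := by
            rw [show 2 * Real.pi * (s * ‖k‖) / 4 = 2 * Real.pi * ‖k‖ * s / 4 by ring,
              Real.div_rpow (by positivity) (by norm_num),
              Real.mul_rpow (by positivity) hs0.le]
            field_simp
          rw [e1, e2]
          have h48 : (4 : ℝ) ^ p ≤ 8 ^ p := Real.rpow_le_rpow (by norm_num) (by norm_num) hp.le
          have : (0 : ℝ) < 4 ^ p := by positivity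
          refine div_le_div_of_nonneg_left (by positivity) (by positivity) ?_
          linarith
        -- Superlinear growth is traded for linear growth; the lost 1 becomes the factor e of the
        -- final constant.
        have h3 : κ / 8 * s - 1 ≤ (κ / 8 * s) ^ (1 + p) := by
          rcases le_total (κ / 8 * s) 1 with h | h
          · have : 0 ≤ (κ / 8 * s) ^ (1 + p) := by positivity
            linarith
          · have := Real.rpow_le_rpow_of_exponent_le h (by linarith : (1 : ℝ) ≤ 1 + p)
            rw [Real.rpow_one] at this
            linarith
        have h4 : Real.exp (-runningCost p ξ k s) ≤ Real.exp 1 * Real.exp (-(κ / 8 * s)) := by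
          rw [← Real.exp_add]
          exact Real.exp_le_exp.2 (by linarith)
        calc _ ≤ κ * (Real.exp 1 * Real.exp (-(κ / 8 * s))) := mul_le_mul_of_nonneg_left h4 hκ0
          _ = _ := by ring
    _ ≤ _ := by
        rw [lintegral_const_mul _ (by fun_prop)]
        exact mul_le_of_le_one_right' (lintegral_Ioi_mul_exp_neg_le (by positivity))

theorem exp_neg_runningCost_tendsto {p A : ℝ} (hp : 0 < p) (hA : 0 < A) {ξ : V} (hξ : ξ ≠ 0)
    (k : V) :
    Tendsto (fun s => Real.exp (-(A * runningCost p ξ k s))) atTop (𝓝 0) := by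
  refine Real.tendsto_exp_neg_atTop_nhds_zero.comp ?_
  have hw : 0 < (2 * Real.pi * ‖ξ‖) ^ p := by
    have := norm_pos_iff.2 hξ
    positivity
  have h3 : (0 : ℝ) < 3 ^ (p + 1) := by positivity
  refine tendsto_atTop_mono' _ ?_
    (tendsto_id.atTop_mul_const (by positivity : 0 < A * (2 * Real.pi * ‖ξ‖) ^ p / 3 ^ (p + 1)))
  filter_upwards [eventually_ge_atTop 0] with s hs
  have h1 := mul_symbol_le_runningCost hp ξ k hs
  rw [id, mul_div_assoc', div_le_iff₀ h3]
  nlinarith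

end RunningCost

end RunningCostBounds

/-! ### Schur's test, and weak solutions along a linear flow. -/

section SchurTest

open Set Filter Topology ENNReal

section Schur

variable {Ω X : Type*} [MeasurableSpace Ω] [MeasurableSpace X]

/-- Cauchy-Schwarz for the splitting K = K^(1/2) · K^(1/2). -/
theorem sq_lintegral_mul_le (ν : Measure Ω) {K h : Ω → ℝ≥0∞} (hK : Measurable K)
    (hh : Measurable h) :
    (∫⁻ s, K s * h s ∂ν) ^ 2 ≤ (∫⁻ s, K s ∂ν) * ∫⁻ s, K s * h s ^ 2 ∂ν := by
  have hcs := ENNReal.lintegral_mul_le_Lp_mul_Lq ν Real.HolderConjugate.two_two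
    (f := fun s => K s ^ (1 / 2 : ℝ)) (g := fun s => K s ^ (1 / 2 : ℝ) * h s)
    (by fun_prop) (by fun_prop)
  have hsq : ∀ x : ℝ≥0∞, (x ^ (1 / 2 : ℝ)) ^ (2 : ℝ) = x := fun x => by
    rw [← ENNReal.rpow_mul]; norm_num
  have hmul : ∀ x : ℝ≥0∞, x ^ (1 / 2 : ℝ) * x ^ (1 / 2 : ℝ) = x := fun x => by
    rw [← sq, ← ENNReal.rpow_two, hsq]
  simp only [Pi.mul_apply, ← mul_assoc, hmul, hsq, ENNReal.mul_rpow_of_nonneg _ _ zero_le_two,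
    ENNReal.rpow_two] at hcs
  have hsq' : ∀ x : ℝ≥0∞, (x ^ (1 / 2 : ℝ)) ^ 2 = x := fun x => by
    rw [← ENNReal.rpow_two, hsq]
  calc _ ≤ _ := pow_le_pow_left' hcs 2
    _ = _ := by rw [mul_pow, hsq', hsq']

/-- Schur's test for an average over measure preserving maps. -/
theorem lintegral_sq_lintegral_comp_le {ν : Measure Ω} [SFinite ν] {μ : Measure X} [SFinite μ]
    {T : Ω → X → X} (hT : Measurable (Function.uncurry T))
    (hTp : ∀ s, MeasurePreserving (T s) μ μ) {K K' : Ω → X → ℝ≥0∞}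
    (hK : Measurable (Function.uncurry K)) (hK' : Measurable (Function.uncurry K'))
    (hKK : ∀ s z, K' s (T s z) = K s z) {C₁ C₂ : ℝ≥0∞}
    (h₁ : ∀ z, ∫⁻ s, K s z ∂ν ≤ C₁) (h₂ : ∀ z, ∫⁻ s, K' s z ∂ν ≤ C₂)
    {h : X → ℝ≥0∞} (hh : Measurable h) :
    ∫⁻ z, (∫⁻ s, K s z * h (T s z) ∂ν) ^ 2 ∂μ ≤ C₁ * C₂ * ∫⁻ z, h z ^ 2 ∂μ := by
  have hKz : ∀ z, Measurable fun s => K s z := fun z => hK.comp (measurable_id.prodMk measurable_const)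
  have hTz : ∀ z, Measurable fun s => T s z := fun z => hT.comp (measurable_id.prodMk measurable_const)
  calc _ ≤ ∫⁻ z, C₁ * ∫⁻ s, K s z * h (T s z) ^ 2 ∂ν ∂μ := by
        refine lintegral_mono fun z => ?_
        refine (sq_lintegral_mul_le ν (hKz z) (hh.comp (hTz z))).trans ?_
        exact mul_le_mul_left (h₁ z) _
    _ = C₁ * ∫⁻ z, ∫⁻ s, K s z * h (T s z) ^ 2 ∂ν ∂μ := by
        refine lintegral_const_mul _ ?_
        refine Measurable.lintegral_prod_right' (f := fun q : X × Ω => K q.2 q.1 * h (T q.2 q.1) ^ 2) ?_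
        exact (hK.comp measurable_swap).mul ((hh.comp (hT.comp measurable_swap)).pow_const 2)
    _ = C₁ * ∫⁻ s, ∫⁻ z, K s z * h (T s z) ^ 2 ∂μ ∂ν := by
        rw [lintegral_lintegral_swap]
        exact ((hK.comp measurable_swap).mul
          ((hh.comp (hT.comp measurable_swap)).pow_const 2)).aemeasurable
    _ = C₁ * ∫⁻ s, ∫⁻ z, K' s z * h z ^ 2 ∂μ ∂ν := by
        congr 1
        refine lintegral_congr fun s => ?_
        have hm : Measurable fun z => K' s z * h z ^ 2 :=
          (hK'.comp (measurable_const.prodMk measurable_id)).mul (hh.pow_const 2)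
        -- The change of variables by `T s` turns the kernel into its transpose `K'`, by `hKK`.
        rw [← (hTp s).lintegral_comp hm]
        simp only [hKK]
    _ = C₁ * ∫⁻ z, (∫⁻ s, K' s z ∂ν) * h z ^ 2 ∂μ := by
        rw [lintegral_lintegral_swap]
        · congr 1
          refine lintegral_congr fun z => ?_
          exact lintegral_mul_const _ (hK'.comp (measurable_id.prodMk measurable_const))
        · exact (hK'.mul ((hh.comp measurable_snd).pow_const 2)).aemeasurable
    _ ≤ C₁ * ∫⁻ z, C₂ * h z ^ 2 ∂μ := by
        gcongr with z
        exact h₂ z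
    _ = _ := by rw [lintegral_const_mul _ (hh.pow_const 2), mul_assoc]

end Schur

section LinearFlow

variable {E : Type*} [NormedAddCommGroup E] [NormedSpace ℝ E]

/-- The flow of the linear vector field `z ↦ N z`, for `N` of square zero. -/
def linearFlow (N : E →L[ℝ] E) (s : ℝ) (z : E) : E := z + s • N z

variable {N : E →L[ℝ] E}

theorem linearFlow_zero (z : E) : linearFlow N 0 z = z := by simp [linearFlow]

theorem linearFlow_linearFlow (hN : ∀ z, N (N z) = 0) (s t : ℝ) (z : E) :
    linearFlow N s (linearFlow N t z) = linearFlow N (s + t) z := by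
  simp only [linearFlow, map_add, map_smul, hN, smul_zero, add_zero]
  module

theorem apply_linearFlow (hN : ∀ z, N (N z) = 0) (s : ℝ) (z : E) : N (linearFlow N s z) = N z := by
  simp [linearFlow, hN]

theorem continuous_linearFlow : Continuous fun q : ℝ × E => linearFlow N q.1 q.2 := by
  unfold linearFlow; fun_prop

@[fun_prop]
theorem continuous_linearFlow_right (s : ℝ) : Continuous (linearFlow N s) := by
  unfold linearFlow; fun_prop

@[fun_prop]
theorem continuous_linearFlow_left (z : E) : Continuous fun s => linearFlow N s z := by
  unfold linearFlow; fun_prop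

/-- The flow at time `s` as a homeomorphism. -/
def linearFlowHomeomorph (hN : ∀ z, N (N z) = 0) (s : ℝ) : E ≃ₜ E where
  toFun := linearFlow N s
  invFun := linearFlow N (-s)
  left_inv z := by simp [linearFlow_linearFlow hN, linearFlow_zero]
  right_inv z := by simp [linearFlow_linearFlow hN, linearFlow_zero]
  continuous_toFun := continuous_linearFlow_right s
  continuous_invFun := continuous_linearFlow_right (-s)

/-- The map `(s, z) ↦ (s, S_s z)` for the flow `S`, as a homeomorphism. -/
def linearFlowProdHomeomorph (hN : ∀ z, N (N z) = 0) : ℝ × E ≃ₜ ℝ × E where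
  toFun q := (q.1, linearFlow N q.1 q.2)
  invFun q := (q.1, linearFlow N (-q.1) q.2)
  left_inv q := by simp [linearFlow_linearFlow hN, linearFlow_zero]
  right_inv q := by simp [linearFlow_linearFlow hN, linearFlow_zero]
  continuous_toFun := continuous_fst.prodMk continuous_linearFlow
  continuous_invFun := continuous_fst.prodMk
    (continuous_linearFlow.comp (continuous_fst.neg.prodMk continuous_snd))

variable [MeasurableSpace E] [BorelSpace E] [FiniteDimensional ℝ E] {μ : Measure E} [SFinite μ]

theorem integrableOn_comp_linearFlow (hN : ∀ z, N (N z) = 0)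
    (hμ : ∀ s, MeasurePreserving (linearFlow N s) μ μ) {G : E → ℂ} (hG : LocallyIntegrable G μ)
    {K : Set E} (hK : IsCompact K) (a b : ℝ) :
    IntegrableOn (fun q : ℝ × E => G (linearFlow N q.1 q.2)) (Icc a b ×ˢ K)
      ((volume : Measure ℝ).prod μ) := by
  set K' : Set E := (fun q : ℝ × E => linearFlow N q.1 q.2) '' (Icc a b ×ˢ K) with hK'
  have hK'c : IsCompact K' := (isCompact_Icc.prod hK).image continuous_linearFlow
  have hmp : MeasurePreserving (linearFlowProdHomeomorph hN) ((volume : Measure ℝ).prod μ)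
      ((volume : Measure ℝ).prod μ) :=
    (MeasurePreserving.id volume).skew_product (g := fun s z => linearFlow N s z)
      continuous_linearFlow.measurable (ae_of_all _ fun s => (hμ s).map_eq)
  have h1 : IntegrableOn (fun q : ℝ × E => G q.2) (Icc a b ×ˢ K')
      ((volume : Measure ℝ).prod μ) := by
    rw [IntegrableOn, ← Measure.prod_restrict]
    exact (hG.integrableOn_isCompact hK'c).comp_snd _
  have h2 := (hmp.integrableOn_comp_preimage
    (linearFlowProdHomeomorph hN).measurableEmbedding).2 h1
  refine IntegrableOn.mono_set h2 ?_
  rintro ⟨s, z⟩ ⟨hs, hz⟩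
  exact ⟨hs, ⟨(s, z), ⟨hs, hz⟩, rfl⟩⟩

/-- A weak solution of `N z · ∇ U = G` is differentiable along the flow of `N`. -/
theorem ae_eq_add_integral_comp_linearFlow (hN : ∀ z, N (N z) = 0)
    (hμ : ∀ s, MeasurePreserving (linearFlow N s) μ μ) {U G : E → ℂ}
    (hU : LocallyIntegrable U μ) (hG : LocallyIntegrable G μ)
    (h : ∀ Φ : E → ℝ, ContDiff ℝ ∞ Φ → HasCompactSupport Φ →
      ∫ z, fderiv ℝ Φ z (N z) • U z ∂μ = -∫ z, Φ z • G z ∂μ) {s : ℝ} (hs : 0 ≤ s) :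
    ∀ᵐ z ∂μ, U (linearFlow N s z) = U z + ∫ σ in (0 : ℝ)..s, G (linearFlow N σ z) := by
  have hcompU : ∀ t, LocallyIntegrable (fun z => U (linearFlow N t z)) μ := by
    intro t
    rw [locallyIntegrable_iff]
    intro K hK
    refine IntegrableOn.mono_set (((hμ t).integrableOn_comp_preimage
      (linearFlowHomeomorph hN t).measurableEmbedding).2
      (hU.integrableOn_isCompact (hK.image (continuous_linearFlow_right (N := N) t)))) ?_
    exact subset_preimage_image _ _
  have hintG : LocallyIntegrable (fun z => ∫ σ in (0 : ℝ)..s, G (linearFlow N σ z)) μ := by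
    rw [locallyIntegrable_iff]
    intro K hK
    have h1 := integrableOn_comp_linearFlow hN hμ hG hK 0 s
    rw [IntegrableOn, ← Measure.prod_restrict] at h1
    have h2 := h1.integral_prod_right
    simp only [intervalIntegral.integral_of_le hs, ← integral_Icc_eq_integral_Ioc]
    exact h2
  refine ae_eq_of_integral_contDiff_smul_eq (hcompU s) (hU.add hintG) fun Φ hΦ hΦc => ?_
  have hΦs : ∀ t, ContDiff ℝ ∞ fun z => Φ (linearFlow N t z) := fun t => by
    unfold linearFlow
    exact hΦ.comp (by fun_prop)
  have hΦcs : ∀ t, HasCompactSupport fun z => Φ (linearFlow N t z) := fun t =>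
    hΦc.comp_homeomorph (linearFlowHomeomorph hN t)
  set D : E → ℝ := fun z => fderiv ℝ Φ z (N z) with hD
  have hDcont : Continuous D :=
    (hΦ.continuous_fderiv (by simp)).clm_apply N.continuous
  have hDc : HasCompactSupport D := by
    refine (hΦc.fderiv (𝕜 := ℝ)).mono' ?_
    intro z hz
    refine subset_tsupport _ ?_
    rw [Function.mem_support] at hz ⊢
    intro h0
    exact hz (by simp [hD, h0])
  have hderiv : ∀ t z, HasDerivAt (fun t => Φ (linearFlow N (-t) z)) (-D (linearFlow N (-t) z)) t := by
    intro t z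
    have h1 : HasDerivAt (fun t : ℝ => linearFlow N (-t) z) (-(N z)) t := by
      have := ((hasDerivAt_id t).neg.smul_const (N z)).const_add z
      simpa [linearFlow] using this
    have h2 := ((hΦ.differentiable (by simp)) (linearFlow N (-t) z)).hasFDerivAt.comp_hasDerivAt t h1
    refine h2.congr_deriv ?_
    simp [hD, apply_linearFlow hN]
  have hfd : ∀ t z, fderiv ℝ (fun z => Φ (linearFlow N (-t) z)) z (N z) = D (linearFlow N (-t) z) := by
    intro t z
    have h1 : HasFDerivAt (linearFlow N (-t)) (ContinuousLinearMap.id ℝ E + (-t) • N) z :=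
      (hasFDerivAt_id z).add (N.hasFDerivAt.const_smul (-t))
    have h2 := ((hΦ.differentiable (by simp)) (linearFlow N (-t) z)).hasFDerivAt.comp z h1
    have h3 := h2.fderiv
    change fderiv ℝ (fun z => Φ (linearFlow N (-t) z)) z = _ at h3
    rw [h3]
    simp [hD, apply_linearFlow hN, hN]
  -- The flow is moved onto the test function: Φ ∘ S_(-t) is again an admissible test function, and
  -- the weak equation for it says that ∫ (Φ ∘ S_(-t)) U has derivative `J t`. Integrating in t and
  -- shifting back gives the claim tested against Φ.
  set J : ℝ → ℂ := fun t => ∫ z, Φ (linearFlow N (-t) z) • G z ∂μ with hJ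
  have hI : ∀ t, HasDerivAt (fun t => ∫ z, Φ (linearFlow N (-t) z) • U z ∂μ) (J t) t := by
    intro t
    -- One compact set carrying the t-derivatives of all transported test functions at times within
    -- 1 of t, so that one integrable function dominates them.
    set K' : Set E := (fun q : ℝ × E => linearFlow N q.1 q.2) '' (Icc (t - 1) (t + 1) ×ˢ tsupport D)
      with hK'
    have hK'c : IsCompact K' := (isCompact_Icc.prod hDc).image continuous_linearFlow
    obtain ⟨C, hC⟩ := hDcont.bounded_above_of_compact_support hDc
    have := hasDerivAt_integral_of_dominated_loc_of_deriv_le (μ := μ) (x₀ := t)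
      (s := Ioo (t - 1) (t + 1)) (Ioo_mem_nhds (by linarith) (by linarith))
      (F := fun t z => Φ (linearFlow N (-t) z) • U z)
      (F' := fun t z => (-D (linearFlow N (-t) z)) • U z)
      (bound := K'.indicator fun z => C * ‖U z‖)
      (.of_forall fun r => ?_) ?_ ?_ ?_ ?_ ?_
    · refine this.2.congr_deriv ?_
      have h4 := h _ (hΦs (-t)) (hΦcs (-t))
      simp only [hfd] at h4
      simp only [hJ, neg_smul, integral_neg, h4, neg_neg]
    · exact (hΦs (-r)).continuous.aestronglyMeasurable.smul hU.aestronglyMeasurable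
    · exact hU.integrable_smul_left_of_hasCompactSupport (hΦs (-t)).continuous (hΦcs (-t))
    · exact ((hDcont.comp (continuous_linearFlow_right (-t))).neg.aestronglyMeasurable).smul
        hU.aestronglyMeasurable
    · refine ae_of_all _ fun z r hr => ?_
      by_cases hz : z ∈ K'
      · rw [indicator_of_mem hz, norm_smul, norm_neg]
        exact mul_le_mul_of_nonneg_right (hC _) (norm_nonneg _)
      · have h0 : D (linearFlow N (-r) z) = 0 := by
          by_contra hne
          refine hz ⟨(r, linearFlow N (-r) z), ⟨Ioo_subset_Icc_self hr, subset_tsupport _ hne⟩, ?_⟩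
          simp [linearFlow_linearFlow hN, linearFlow_zero]
        rw [indicator_of_notMem hz, h0]
        simp
    · exact (integrable_indicator_iff hK'c.measurableSet).2
        ((hU.integrableOn_isCompact hK'c).norm.const_mul C)
    · exact ae_of_all _ fun z r _ => (hderiv r z).smul_const (U z)
  have hshift : ∀ (F : E → ℂ) (t : ℝ),
      ∫ z, Φ (linearFlow N (-t) z) • F z ∂μ = ∫ z, Φ z • F (linearFlow N t z) ∂μ := by
    intro F t
    rw [← (hμ t).integral_comp (linearFlowHomeomorph hN t).measurableEmbedding]
    simp [linearFlow_linearFlow hN, linearFlow_zero]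
  have hprod : Integrable (fun q : ℝ × E => Φ q.2 • G (linearFlow N q.1 q.2))
      (((volume : Measure ℝ).restrict (Icc 0 s)).prod μ) := by
    have h1 := integrableOn_comp_linearFlow hN hμ hG hΦc 0 s
    obtain ⟨C, hC⟩ := hΦ.continuous.bounded_above_of_compact_support hΦc
    have h2 : IntegrableOn (fun q : ℝ × E => Φ q.2 • G (linearFlow N q.1 q.2))
        (Icc 0 s ×ˢ tsupport Φ) ((volume : Measure ℝ).prod μ) :=
      Integrable.bdd_smul h1 C (hΦ.continuous.comp continuous_snd).aestronglyMeasurable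
        (ae_of_all _ fun q => hC q.2)
    have h3 : IntegrableOn (fun q : ℝ × E => Φ q.2 • G (linearFlow N q.1 q.2))
        (Icc 0 s ×ˢ univ) ((volume : Measure ℝ).prod μ) := by
      refine h2.of_forall_sdiff_eq_zero (measurableSet_Icc.prod MeasurableSet.univ) ?_
      rintro ⟨r, z⟩ ⟨⟨hr, _⟩, hz⟩
      have : Φ z = 0 := by
        by_contra hne
        exact hz ⟨hr, subset_tsupport _ hne⟩
      simp [this]
    rwa [IntegrableOn, ← Measure.prod_restrict, Measure.restrict_univ] at h3
  have hJint : IntervalIntegrable J volume 0 s := by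
    rw [intervalIntegrable_iff_integrableOn_Icc_of_le hs]
    have := hprod.integral_prod_left
    refine this.congr (ae_of_all _ fun t => ?_)
    simp only [hJ]
    rw [hshift]
  have hFTC := intervalIntegral.integral_eq_sub_of_hasDerivAt (fun t _ => hI t) hJint
  have hswap : ∫ t in (0 : ℝ)..s, J t = ∫ z, Φ z • (∫ σ in (0 : ℝ)..s, G (linearFlow N σ z)) ∂μ := by
    simp only [intervalIntegral.integral_of_le hs, ← integral_Icc_eq_integral_Ioc, hJ, hshift]
    rw [integral_integral_swap hprod]
    simp only [integral_smul]
  simp only [smul_add]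
  rw [integral_add (hU.integrable_smul_left_of_hasCompactSupport hΦ.continuous hΦc)
    (hintG.integrable_smul_left_of_hasCompactSupport hΦ.continuous hΦc), ← hswap, hFTC,
    hshift U s]
  simp [linearFlow_zero]

end LinearFlow

end SchurTest

/-! ### Duhamel's formula along almost every orbit, and its limit at infinite time. -/

section Duhamel

open Set Filter Topology ENNReal

/-- Variation of constants for an integral equation with integrable data. -/
theorem eq_exp_mul_add_integral_of_ae_eq {u q c : ℝ → ℂ} {u₀ : ℂ} {S : ℝ} (hS : 0 ≤ S)
    (hc : Continuous c) (hu : IntervalIntegrable u volume 0 S)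
    (hq : IntervalIntegrable q volume 0 S)
    (h : ∀ᵐ s ∂volume.restrict (Ioc 0 S), u s = u₀ + ∫ σ in (0 : ℝ)..s, (c σ * u σ - q σ))
    (hend : u S = u₀ + ∫ σ in (0 : ℝ)..S, (c σ * u σ - q σ)) :
    u₀ = Complex.exp (-∫ σ in (0 : ℝ)..S, c σ) * u S
      + ∫ σ in (0 : ℝ)..S, Complex.exp (-∫ ρ in (0 : ℝ)..σ, c ρ) * q σ := by
  set e : ℝ → ℂ := fun s => Complex.exp (-∫ ρ in (0 : ℝ)..s, c ρ) with he
  set g : ℝ → ℂ := fun σ => c σ * u σ - q σ with hg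
  have hde : ∀ s, HasDerivAt e (-(c s * e s)) s := by
    intro s
    have h1 := (hc.integral_hasStrictDerivAt 0 s).hasDerivAt.neg.cexp
    exact h1.congr_deriv (by simp [he]; ring)
  have hec : Continuous e := continuous_iff_continuousAt.2 fun s => (hde s).continuousAt
  have hdec : Continuous fun s => -(c s * e s) := (hc.mul hec).neg
  have hgi : IntervalIntegrable g volume 0 S := (hu.continuousOn_mul hc.continuousOn).sub hq
  have hgi' : Integrable g (volume.restrict (Ioc 0 S)) := hgi.1
  have hdei : Integrable (fun s => -(c s * e s)) (volume.restrict (Ioc 0 S)) :=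
    (hdec.intervalIntegrable 0 S).1
  have hint : Integrable ({x : ℝ × ℝ | x.2 ≤ x.1}.indicator
      fun x => -(c x.1 * e x.1) * g x.2)
      ((volume.restrict (Ioc 0 S)).prod (volume.restrict (Ioc 0 S))) :=
    (hdei.mul_prod hgi').indicator (measurableSet_le measurable_snd measurable_fst)
  -- The data are merely integrable and the integral equation holds only almost everywhere, so the
  -- product rule for e · u is replaced by Fubini on the triangle ρ ≤ σ.
  have hswap : ∫ σ in (0 : ℝ)..S, -(c σ * e σ) * ∫ ρ in (0 : ℝ)..σ, g ρ
      = ∫ ρ in (0 : ℝ)..S, (e S - e ρ) * g ρ := by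
    rw [intervalIntegral.integral_of_le hS, intervalIntegral.integral_of_le hS]
    have hs := integral_integral_swap (f := fun σ ρ => {x : ℝ × ℝ | x.2 ≤ x.1}.indicator
      (fun x => -(c x.1 * e x.1) * g x.2) (σ, ρ)) hint
    calc _ = ∫ σ in Ioc 0 S, ∫ ρ in Ioc 0 S, {x : ℝ × ℝ | x.2 ≤ x.1}.indicator
          (fun x => -(c x.1 * e x.1) * g x.2) (σ, ρ) := by
          refine setIntegral_congr_fun measurableSet_Ioc fun σ hσ => ?_
          have h1 : (fun ρ => {x : ℝ × ℝ | x.2 ≤ x.1}.indicator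
              (fun x => -(c x.1 * e x.1) * g x.2) (σ, ρ))
              = (Iic σ).indicator fun ρ => -(c σ * e σ) * g ρ := by
            ext ρ
            by_cases hρ : ρ ≤ σ <;> simp [indicator, hρ]
          simp only [h1]
          rw [setIntegral_indicator measurableSet_Iic, Ioc_inter_Iic, min_eq_right hσ.2,
            integral_const_mul, intervalIntegral.integral_of_le hσ.1.le]
      _ = _ := hs
      _ = _ := by
          refine setIntegral_congr_fun measurableSet_Ioc fun ρ hρ => ?_
          have h1 : (fun σ => {x : ℝ × ℝ | x.2 ≤ x.1}.indicator
              (fun x => -(c x.1 * e x.1) * g x.2) (σ, ρ))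
              = (Ici ρ).indicator fun σ => -(c σ * e σ) * g ρ := by
            ext σ
            by_cases hσ : ρ ≤ σ <;> simp [indicator, hσ]
          have h2 : Ioc 0 S ∩ Ici ρ = Icc ρ S := by
            ext x
            simp only [mem_inter_iff, mem_Ioc, mem_Ici, mem_Icc]
            exact ⟨fun hx => ⟨hx.2, hx.1.2⟩, fun hx => ⟨⟨hρ.1.trans_le hx.1, hx.2⟩, hx.1⟩⟩
          simp only [h1]
          rw [setIntegral_indicator measurableSet_Ici, h2, integral_Icc_eq_integral_Ioc,
            integral_mul_const, ← intervalIntegral.integral_of_le hρ.2,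
            intervalIntegral.integral_eq_sub_of_hasDerivAt (fun s _ => hde s)
              (hdec.intervalIntegrable _ _)]
  have he0 : e 0 = 1 := by simp [he]
  have hgprim : IntervalIntegrable (fun σ => -(c σ * e σ) * ∫ ρ in (0 : ℝ)..σ, g ρ) volume 0 S := by
    have : ContinuousOn (fun σ => ∫ ρ in (0 : ℝ)..σ, g ρ) (uIcc 0 S) :=
      intervalIntegral.continuousOn_primitive_interval (by
        rw [uIcc_of_le hS]
        exact (intervalIntegrable_iff_integrableOn_Icc_of_le hS).1 hgi)
    exact ContinuousOn.intervalIntegrable (hdec.continuousOn.mul this)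
  have h1 : ∫ σ in (0 : ℝ)..S, -(c σ * e σ) * u σ
      = u₀ * (e S - 1) + ∫ ρ in (0 : ℝ)..S, (e S - e ρ) * g ρ := by
    rw [← hswap]
    have h2 : ∫ σ in (0 : ℝ)..S, -(c σ * e σ) * u₀ = u₀ * (e S - 1) := by
      rw [intervalIntegral.integral_mul_const,
        intervalIntegral.integral_eq_sub_of_hasDerivAt (fun s _ => hde s)
          (hdec.intervalIntegrable _ _), he0, mul_comm]
    have h5 : IntervalIntegrable (fun σ => -(c σ * e σ) * u₀) volume 0 S :=
      Continuous.intervalIntegrable (hdec.mul continuous_const) _ _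
    rw [← h2, ← intervalIntegral.integral_add h5 hgprim]
    refine intervalIntegral.integral_congr_ae ?_
    rw [uIoc_of_le hS]
    have := (ae_restrict_iff' measurableSet_Ioc).1 h
    filter_upwards [this] with σ hσ hmem
    rw [hσ hmem, mul_add]
  have h3 : ∫ ρ in (0 : ℝ)..S, (e S - e ρ) * g ρ
      = e S * (∫ ρ in (0 : ℝ)..S, g ρ) - ∫ ρ in (0 : ℝ)..S, e ρ * g ρ := by
    rw [← intervalIntegral.integral_const_mul, ← intervalIntegral.integral_sub
      (hgi.const_mul _) (hgi.continuousOn_mul hec.continuousOn)]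
    simp only [sub_mul]
  have h4 : ∫ ρ in (0 : ℝ)..S, e ρ * g ρ
      = -(∫ σ in (0 : ℝ)..S, -(c σ * e σ) * u σ) - ∫ ρ in (0 : ℝ)..S, e ρ * q ρ := by
    have h5 : IntervalIntegrable (fun σ => -(-(c σ * e σ) * u σ)) volume 0 S :=
      (hu.continuousOn_mul hdec.continuousOn).neg
    rw [← intervalIntegral.integral_neg, ← intervalIntegral.integral_sub
      h5 (hq.continuousOn_mul hec.continuousOn)]
    refine intervalIntegral.integral_congr fun ρ _ => ?_
    simp only [hg]
    ring
  change u₀ = e S * u S + ∫ σ in (0 : ℝ)..S, e σ * q σ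
  rw [hend]
  linear_combination h1 + h3 - h4

theorem continuous_integral_comp_linearFlow {E : Type*} [NormedAddCommGroup E] [NormedSpace ℝ E]
    {N : E →L[ℝ] E} {a : E → ℝ} (ha : Continuous a) :
    Continuous fun x : ℝ × E => ∫ ρ in (0 : ℝ)..x.1, a (linearFlow N ρ x.2) := by
  have h1 : Continuous (Function.uncurry fun (x : ℝ × E) (ρ : ℝ) => a (linearFlow N ρ x.2)) :=
    ha.comp (continuous_linearFlow.comp (continuous_snd.prodMk (continuous_snd.comp continuous_fst)))
  exact intervalIntegral.continuous_parametric_intervalIntegral_of_continuous (a₀ := 0) h1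
    continuous_fst

section LinearFlow

variable {E : Type*} [NormedAddCommGroup E] [NormedSpace ℝ E] {N : E →L[ℝ] E}
  [MeasurableSpace E] [BorelSpace E] [FiniteDimensional ℝ E] {μ : Measure E} [SFinite μ]

/-- Fubini on a ball times a time interval, exhausting the space by countably many balls. Integer
times keep the exceptional set null. -/
theorem ae_intervalIntegrable_comp_linearFlow (hN : ∀ z, N (N z) = 0)
    (hμ : ∀ s, MeasurePreserving (linearFlow N s) μ μ) {G : E → ℂ} (hG : LocallyIntegrable G μ) :
    ∀ᵐ z ∂μ, ∀ m : ℕ, IntervalIntegrable (fun σ => G (linearFlow N σ z)) volume 0 (m : ℝ) := by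
  rw [ae_all_iff]
  intro m
  have h1 : ∀ᵐ z ∂μ, ∀ R : ℕ, z ∈ Metric.closedBall (0 : E) R →
      IntervalIntegrable (fun σ => G (linearFlow N σ z)) volume 0 (m : ℝ) := by
    rw [ae_all_iff]
    intro R
    rw [← ae_restrict_iff' measurableSet_closedBall]
    have h2 := integrableOn_comp_linearFlow hN hμ hG (isCompact_closedBall (0 : E) R) 0 m
    rw [IntegrableOn, ← Measure.prod_restrict] at h2
    filter_upwards [h2.prod_left_ae] with z hz
    exact (intervalIntegrable_iff_integrableOn_Icc_of_le m.cast_nonneg).2 hz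
  filter_upwards [h1] with z hz
  obtain ⟨R, hR⟩ := exists_nat_ge ‖z‖
  exact hz R (by simpa using hR)

/-- The null set in `h` depends on s. Joint measurability, which is why strongly measurable
representatives are assumed, allows the quantifiers to be exchanged: almost every orbit satisfies
the integral equation at almost every time. The end times, being integers, are secured separately by
a countable intersection. -/
theorem ae_eq_exp_mul_add_integral_comp_linearFlow (hN : ∀ z, N (N z) = 0)
    (hμ : ∀ s, MeasurePreserving (linearFlow N s) μ μ) {U Q c : E → ℂ}
    (hU : LocallyIntegrable U μ) (hQ : LocallyIntegrable Q μ) (hUm : StronglyMeasurable U)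
    (hQm : StronglyMeasurable Q) (hc : Continuous c)
    (h : ∀ s : ℝ, 0 ≤ s → ∀ᵐ z ∂μ, U (linearFlow N s z) = U z + ∫ σ in (0 : ℝ)..s,
      (c (linearFlow N σ z) * U (linearFlow N σ z) - Q (linearFlow N σ z))) :
    ∀ᵐ z ∂μ, ∀ m : ℕ, U z
      = Complex.exp (-∫ σ in (0 : ℝ)..m, c (linearFlow N σ z)) * U (linearFlow N m z)
        + ∫ σ in (0 : ℝ)..m, Complex.exp (-∫ ρ in (0 : ℝ)..σ, c (linearFlow N ρ z))
          * Q (linearFlow N σ z) := by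
  have hfm : Measurable fun q : ℝ × E => linearFlow N q.1 q.2 := continuous_linearFlow.measurable
  have hGm : StronglyMeasurable fun z => c z * U z - Q z :=
    (hc.stronglyMeasurable.mul hUm).sub hQm
  have hjoint : ∀ᵐ z ∂μ, ∀ᵐ s ∂volume.restrict (Ioi (0 : ℝ)),
      U (linearFlow N s z) = U z + ∫ σ, {y : ℝ | 0 < y ∧ y ≤ s}.indicator
        (fun σ => c (linearFlow N σ z) * U (linearFlow N σ z) - Q (linearFlow N σ z)) σ := by
    have hmeas : MeasurableSet {x : ℝ × E | U (linearFlow N x.1 x.2) = U x.2 + ∫ σ,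
        {y : ℝ | 0 < y ∧ y ≤ x.1}.indicator (fun σ => c (linearFlow N σ x.2)
          * U (linearFlow N σ x.2) - Q (linearFlow N σ x.2)) σ} := by
      refine measurableSet_eq_fun (hUm.measurable.comp hfm)
        ((hUm.measurable.comp measurable_snd).add ?_)
      refine StronglyMeasurable.measurable ?_
      have hset : MeasurableSet {y : (ℝ × E) × ℝ | 0 < y.2 ∧ y.2 ≤ y.1.1} :=
        (measurableSet_lt measurable_const measurable_snd).inter
          (measurableSet_le measurable_snd (measurable_fst.comp measurable_fst))
      have h2 : StronglyMeasurable fun y : (ℝ × E) × ℝ => {y : (ℝ × E) × ℝ | 0 < y.2 ∧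
          y.2 ≤ y.1.1}.indicator (fun y => c (linearFlow N y.2 y.1.2)
          * U (linearFlow N y.2 y.1.2) - Q (linearFlow N y.2 y.1.2)) y := by
        refine StronglyMeasurable.indicator ?_ hset
        exact hGm.comp_measurable (hfm.comp
          (measurable_snd.prodMk (measurable_snd.comp measurable_fst)))
      exact h2.integral_prod_right'
    refine (Measure.ae_ae_comm hmeas).1 ?_
    refine (ae_restrict_iff' measurableSet_Ioi).2 (ae_of_all _ fun s hs => ?_)
    filter_upwards [h s (le_of_lt hs)] with z hz
    rw [hz, intervalIntegral.integral_of_le (le_of_lt hs), ← integral_indicator measurableSet_Ioc]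
    rfl
  have hnat : ∀ᵐ z ∂μ, ∀ m : ℕ, U (linearFlow N m z) = U z + ∫ σ in (0 : ℝ)..m,
      (c (linearFlow N σ z) * U (linearFlow N σ z) - Q (linearFlow N σ z)) :=
    ae_all_iff.2 fun m => h m m.cast_nonneg
  filter_upwards [hjoint, hnat, ae_intervalIntegrable_comp_linearFlow hN hμ hU,
    ae_intervalIntegrable_comp_linearFlow hN hμ hQ] with z h1 h2 h3 h4 m
  refine eq_exp_mul_add_integral_of_ae_eq (u := fun σ => U (linearFlow N σ z))
    (q := fun σ => Q (linearFlow N σ z)) (c := fun σ => c (linearFlow N σ z)) m.cast_nonneg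
    (hc.comp (continuous_linearFlow_left z)) (h3 m) (h4 m) ?_ (h2 m)
  have h5 : ∀ᵐ s ∂volume.restrict (Ioc 0 (m : ℝ)), _ :=
    ae_restrict_of_ae_restrict_of_subset Ioc_subset_Ioi_self h1
  filter_upwards [h5, ae_restrict_mem measurableSet_Ioc] with s hs hmem
  rw [hs, intervalIntegral.integral_of_le hmem.1.le, ← integral_indicator measurableSet_Ioc]
  rfl

/-- A square integrable solution of `N z · ∇ U = c U - Q`, with `Re c ≥ 0` of infinite integral
along almost every backward orbit, is dominated by the Duhamel integral. -/
theorem ae_enorm_le_lintegral_comp_linearFlow (hN : ∀ z, N (N z) = 0)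
    (hμ : ∀ s, MeasurePreserving (linearFlow N s) μ μ) {U Q c : E → ℂ}
    (hU : LocallyIntegrable U μ) (hQ : LocallyIntegrable Q μ) (hUm : StronglyMeasurable U)
    (hQm : StronglyMeasurable Q) (hc : Continuous c) (hc0 : ∀ z, 0 ≤ (c z).re)
    (hU2 : ∫⁻ z, ‖U z‖ₑ ^ 2 ∂μ ≠ ⊤)
    (hdecay : ∀ᵐ z ∂μ, Tendsto
      (fun m : ℕ => Real.exp (-∫ ρ in (0 : ℝ)..m, (c (linearFlow N (-ρ) z)).re)) atTop (𝓝 0))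
    (h : ∀ s : ℝ, 0 ≤ s → ∀ᵐ z ∂μ, U (linearFlow N s z) = U z + ∫ σ in (0 : ℝ)..s,
      (c (linearFlow N σ z) * U (linearFlow N σ z) - Q (linearFlow N σ z))) :
    ∀ᵐ z ∂μ, ‖U z‖ₑ ≤ ∫⁻ σ in Ioi (0 : ℝ),
      ENNReal.ofReal (Real.exp (-∫ ρ in (0 : ℝ)..σ, (c (linearFlow N ρ z)).re))
        * ‖Q (linearFlow N σ z)‖ₑ := by
  have hre : Continuous fun z => (c z).re := Complex.continuous_re.comp hc
  have hEc : Continuous fun x : ℝ × E =>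
      Real.exp (-∫ ρ in (0 : ℝ)..x.1, (c (linearFlow N ρ x.2)).re) :=
    Real.continuous_exp.comp (continuous_integral_comp_linearFlow hre).neg
  have hnorm : ∀ s z, ‖Complex.exp (-∫ σ in (0 : ℝ)..s, c (linearFlow N σ z))‖ₑ
      = ENNReal.ofReal (Real.exp (-∫ ρ in (0 : ℝ)..s, (c (linearFlow N ρ z)).re)) := by
    intro s z
    rw [← ofReal_norm, Complex.norm_exp, Complex.neg_re]
    have := Complex.reCLM.intervalIntegral_comp_comm (μ := volume) (a := 0) (b := s)
      ((hc.comp (continuous_linearFlow_left (N := N) z)).intervalIntegrable 0 s)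
    simp only [Complex.reCLM_apply, Function.comp_apply] at this
    rw [this]
  set B : E → ℝ≥0∞ := fun z => ∫⁻ σ in Ioi (0 : ℝ),
      ENNReal.ofReal (Real.exp (-∫ ρ in (0 : ℝ)..σ, (c (linearFlow N ρ z)).re))
        * ‖Q (linearFlow N σ z)‖ₑ with hB
  have hBm : Measurable B := by
    refine Measurable.lintegral_prod_right' (f := fun x : E × ℝ =>
      ENNReal.ofReal (Real.exp (-∫ ρ in (0 : ℝ)..x.2, (c (linearFlow N ρ x.1)).re))
        * ‖Q (linearFlow N x.2 x.1)‖ₑ) ?_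
    exact ((hEc.measurable.comp measurable_swap).ennreal_ofReal).mul
      (hQm.measurable.comp (continuous_linearFlow.measurable.comp measurable_swap)).enorm
  -- Truncated subtraction gives a meaningful statement also where `B z` is infinite. The left side
  -- is independent of m; the right side is the boundary term.
  have hle : ∀ᵐ z ∂μ, ∀ m : ℕ, ‖U z‖ₑ - B z ≤
      ENNReal.ofReal (Real.exp (-∫ ρ in (0 : ℝ)..m, (c (linearFlow N ρ z)).re))
        * ‖U (linearFlow N m z)‖ₑ := by
    filter_upwards [ae_eq_exp_mul_add_integral_comp_linearFlow hN hμ hU hQ hUm hQm hc h]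
      with z hz m
    rw [tsub_le_iff_right]
    conv_lhs => rw [hz m]
    refine (enorm_add_le _ _).trans ?_
    rw [enorm_mul, hnorm]
    gcongr
    rw [intervalIntegral.integral_of_le m.cast_nonneg]
    refine (enorm_integral_le_lintegral_enorm _).trans ?_
    simp only [enorm_mul, hnorm, hB]
    exact lintegral_mono_set Ioc_subset_Ioi_self
  have hUm2 : Measurable fun z => ‖U z‖ₑ ^ 2 := hUm.measurable.enorm.pow_const 2
  -- U at time m need not be small pointwise. Undoing the flow by its invariance of the measure
  -- leaves the fixed function |U|² times a factor that decays along the backward orbit, to which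
  -- dominated convergence applies.
  have hint : ∀ m : ℕ, ∫⁻ z, (‖U z‖ₑ - B z) ^ 2 ∂μ ≤ ∫⁻ z, ENNReal.ofReal
      (Real.exp (-∫ ρ in (0 : ℝ)..m, (c (linearFlow N (-ρ) z)).re)) ^ 2 * ‖U z‖ₑ ^ 2 ∂μ := by
    intro m
    calc _ ≤ ∫⁻ z, (ENNReal.ofReal (Real.exp (-∫ ρ in (0 : ℝ)..m, (c (linearFlow N ρ z)).re))
        * ‖U (linearFlow N m z)‖ₑ) ^ 2 ∂μ := by
          refine lintegral_mono_ae ?_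
          filter_upwards [hle] with z hz
          exact pow_le_pow_left' (hz m) 2
      _ = _ := by
          have hm2 : Measurable fun z => ENNReal.ofReal
              (Real.exp (-∫ ρ in (0 : ℝ)..m, (c (linearFlow N (-ρ) z)).re)) ^ 2 * ‖U z‖ₑ ^ 2 := by
            refine Measurable.mul (Measurable.pow_const (Measurable.ennreal_ofReal ?_) 2) hUm2
            have h1 : Continuous (Function.uncurry fun (z : E) (ρ : ℝ) =>
                (c (linearFlow N (-ρ) z)).re) :=
              hre.comp (continuous_linearFlow.comp (continuous_snd.neg.prodMk continuous_fst))
            exact (Real.continuous_exp.comp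
              (intervalIntegral.continuous_parametric_intervalIntegral_of_continuous' h1
                0 (m : ℝ)).neg).measurable
          rw [← (hμ m).lintegral_comp hm2]
          refine lintegral_congr fun z => ?_
          have h2 : ∫ ρ in (0 : ℝ)..m, (c (linearFlow N (-ρ) (linearFlow N m z))).re
              = ∫ ρ in (0 : ℝ)..m, (c (linearFlow N ρ z)).re := by
            have := intervalIntegral.integral_comp_sub_left (a := 0) (b := (m : ℝ))
              (fun ρ => (c (linearFlow N ρ z)).re) (m : ℝ)
            rw [sub_self, sub_zero] at this
            rw [← this]
            refine intervalIntegral.integral_congr fun ρ _ => ?_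
            simp only [linearFlow_linearFlow hN]
            rw [neg_add_eq_sub]
          rw [h2, mul_pow]
  have hlim : Tendsto (fun m : ℕ => ∫⁻ z, ENNReal.ofReal
      (Real.exp (-∫ ρ in (0 : ℝ)..m, (c (linearFlow N (-ρ) z)).re)) ^ 2 * ‖U z‖ₑ ^ 2 ∂μ)
      atTop (𝓝 (∫⁻ _, 0 ∂μ)) := by
    refine tendsto_lintegral_of_dominated_convergence' (fun z => ‖U z‖ₑ ^ 2) ?_ ?_ hU2 ?_
    · intro m
      refine AEMeasurable.mul (Measurable.aemeasurable
        (Measurable.pow_const (Measurable.ennreal_ofReal ?_) 2)) hUm2.aemeasurable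
      have h1 : Continuous (Function.uncurry fun (z : E) (ρ : ℝ) =>
          (c (linearFlow N (-ρ) z)).re) :=
        hre.comp (continuous_linearFlow.comp (continuous_snd.neg.prodMk continuous_fst))
      exact (Real.continuous_exp.comp
        (intervalIntegral.continuous_parametric_intervalIntegral_of_continuous' h1
          0 (m : ℝ)).neg).measurable
    · intro m
      refine ae_of_all _ fun z => mul_le_of_le_one_left' ?_
      refine pow_le_one' ?_ 2
      rw [← ENNReal.ofReal_one]
      refine ENNReal.ofReal_le_ofReal (Real.exp_le_one_iff.2 (neg_nonpos.2 ?_))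
      exact intervalIntegral.integral_nonneg m.cast_nonneg fun ρ _ => hc0 _
    · have hfin : ∀ᵐ z ∂μ, ‖U z‖ₑ ^ 2 < ⊤ := ae_lt_top hUm2 hU2
      filter_upwards [hdecay, hfin] with z hz hzf
      have h1 := ENNReal.tendsto_ofReal hz
      have h2 := ((ENNReal.continuous_pow 2).tendsto _).comp h1
      have h3 := ENNReal.Tendsto.mul_const (b := ‖U z‖ₑ ^ 2) h2 (Or.inr hzf.ne)
      simpa using h3
  rw [lintegral_zero] at hlim
  have hzero : ∫⁻ z, (‖U z‖ₑ - B z) ^ 2 ∂μ = 0 :=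
    le_antisymm (ge_of_tendsto' hlim hint) zero_le
  have hzero' := (lintegral_eq_zero_iff ((hUm.measurable.enorm.sub hBm).pow_const 2)).1 hzero
  filter_upwards [hzero'] with z hz
  exact tsub_eq_zero_iff_le.1 (pow_eq_zero_iff (two_ne_zero) |>.1 hz)

end LinearFlow

end Duhamel

/-! ### The shear flow on phase space, and the pointwise bound for the frozen equation. -/

section FrozenEquation

open Set Filter Topology

namespace PhaseSpace

variable {n : ℕ}

/-- The linear map `(t, x, v) ↦ (0, 0, x)`; on the Fourier side the free transport is the
derivative along this vector field. -/
noncomputable def shear (n : ℕ) : PhaseSpace n →L[ℝ] PhaseSpace n :=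
  LinearMap.toContinuousLinearMap
    { toFun := fun z => WithLp.toLp 2 (Sum.elim (fun _ => 0)
        (Sum.elim (fun _ => 0) fun i => z (Sum.inr (Sum.inl i))))
      map_add' := fun x y => by ext (_ | _ | _) <;> simp
      map_smul' := fun c x => by ext (_ | _ | _) <;> simp }

/-- The reflection `(t, x, v) ↦ (t, x, -v)`. -/
noncomputable def reflectV (n : ℕ) : PhaseSpace n →ₗ[ℝ] PhaseSpace n where
  toFun := fun z => WithLp.toLp 2 (Sum.elim (fun i => z (Sum.inl i))
        (Sum.elim (fun i => z (Sum.inr (Sum.inl i))) fun i => -z (Sum.inr (Sum.inr i))))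
  map_add' x y := by ext (_ | _ | _) <;> simp [add_comm]
  map_smul' c x := by ext (_ | _ | _) <;> simp

theorem shear_apply (z : PhaseSpace n) : shear n z = WithLp.toLp 2 (Sum.elim (fun _ => 0)
    (Sum.elim (fun _ => 0) fun i => z (Sum.inr (Sum.inl i)))) := rfl

theorem reflectV_apply (z : PhaseSpace n) :
    reflectV n z = WithLp.toLp 2 (Sum.elim (fun i => z (Sum.inl i))
      (Sum.elim (fun i => z (Sum.inr (Sum.inl i))) fun i => -z (Sum.inr (Sum.inr i)))) := rfl

theorem shear_shear (z : PhaseSpace n) : shear n (shear n z) = 0 := by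
  ext (_ | _ | _) <;> simp [shear_apply]

theorem vPart_linearFlow (s : ℝ) (z : PhaseSpace n) :
    vPart (linearFlow (shear n) s z) = vPart z + s • xPart z := by
  ext i; simp [vPart, xPart, linearFlow, shear_apply]

theorem xPart_linearFlow (s : ℝ) (z : PhaseSpace n) :
    xPart (linearFlow (shear n) s z) = xPart z := by
  ext i; simp [xPart, linearFlow, shear_apply]

@[fun_prop]
theorem continuous_vPart : Continuous (vPart (n := n)) := by
  unfold vPart
  exact (PiLp.continuous_toLp 2 _).comp (by fun_prop)

@[fun_prop]
theorem continuous_xPart : Continuous (xPart (n := n)) := by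
  unfold xPart
  exact (PiLp.continuous_toLp 2 _).comp (by fun_prop)

theorem vPart_add (y z : PhaseSpace n) : vPart (y + z) = vPart y + vPart z := by
  ext i; simp [vPart]

theorem vPart_neg (z : PhaseSpace n) : vPart (-z) = -vPart z := by
  ext i; simp [vPart]

theorem vPart_sub (y z : PhaseSpace n) : vPart (y - z) = vPart y - vPart z := by
  ext i; simp [vPart]

theorem vPart_smul (c : ℝ) (z : PhaseSpace n) : vPart (c • z) = c • vPart z := by
  ext i; simp [vPart]

theorem norm_vPart_le (z : PhaseSpace n) : ‖vPart z‖ ≤ ‖z‖ := by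
  rw [EuclideanSpace.norm_eq, EuclideanSpace.norm_eq]
  refine Real.sqrt_le_sqrt ?_
  rw [Fintype.sum_sum_type, Fintype.sum_sum_type]
  simp only [vPart]
  have h1 : 0 ≤ ∑ i : Unit, ‖z (Sum.inl i)‖ ^ 2 := by positivity
  have h2 : 0 ≤ ∑ i : Fin n, ‖z (Sum.inr (Sum.inl i))‖ ^ 2 := by positivity
  linarith

/-- The reflection ξ ↦ -ξ conjugates the flow at time s to the flow at time -s, so both have the
same determinant. The two maps are inverse to each other, so that determinant has square 1. -/
theorem measurePreserving_linearFlow (s : ℝ) :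
    MeasurePreserving (linearFlow (shear n) s) (volume : Measure (PhaseSpace n)) volume := by
  set L : ℝ → PhaseSpace n →ₗ[ℝ] PhaseSpace n := fun t =>
    LinearMap.id + t • (shear n : PhaseSpace n →ₗ[ℝ] PhaseSpace n) with hL
  have hLf : ∀ t, (L t : PhaseSpace n → PhaseSpace n) = linearFlow (shear n) t := fun t => by
    ext1 z; simp [hL, linearFlow]
  have h1 : reflectV n ∘ₗ reflectV n = LinearMap.id := by
    ext1 z; ext (_ | _ | _) <;> simp [reflectV_apply]
  have h2 : reflectV n ∘ₗ L s = L (-s) ∘ₗ reflectV n := by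
    ext1 z; ext (_ | _ | _) <;> simp [hL, reflectV_apply, shear_apply, add_comm]
  have h3 : L s ∘ₗ L (-s) = LinearMap.id := by
    ext1 z
    simp only [LinearMap.comp_apply, hLf, linearFlow_linearFlow shear_shear, add_neg_cancel,
      linearFlow_zero, LinearMap.id_apply]
  have d1 := congrArg LinearMap.det h1
  have d2 := congrArg LinearMap.det h2
  have d3 := congrArg LinearMap.det h3
  rw [LinearMap.det_comp, LinearMap.det_id] at d1 d3
  rw [LinearMap.det_comp, LinearMap.det_comp] at d2
  have hne : LinearMap.det (reflectV n) ≠ 0 := fun h => by simp [h] at d1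
  have h4 : LinearMap.det (L s) = LinearMap.det (L (-s)) :=
    mul_left_cancel₀ hne (by rw [d2, mul_comm])
  rw [← h4] at d3
  have hne' : LinearMap.det (L s) ≠ 0 := fun h => by simp [h] at d3
  have habs : |(LinearMap.det (L s))⁻¹| = 1 := by
    rw [abs_inv, inv_eq_one]
    rcases mul_self_eq_one_iff.1 d3 with h | h <;> simp [h]
  refine ⟨(continuous_linearFlow_right s).measurable, ?_⟩
  rw [← hLf, Measure.map_linearMap_addHaar_eq_smul_addHaar _ hne', habs]
  simp

/-- A proper subspace is null; it is proper because n ≥ 1. At ξ ≠ 0 the cost tends to infinity,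
whatever k is. -/
theorem ae_vPart_ne_zero (hn : 1 ≤ n) : ∀ᵐ z : PhaseSpace n, vPart z ≠ 0 := by
  set W : Submodule ℝ (PhaseSpace n) :=
    { carrier := {z | vPart z = 0}
      add_mem' := fun {x y} hx hy => by
        change vPart _ = 0 at hx hy ⊢
        rw [vPart_add, hx, hy, add_zero]
      zero_mem' := by simpa using vPart_smul (0 : ℝ) (0 : PhaseSpace n)
      smul_mem' := fun c x hx => by
        change vPart _ = 0 at hx ⊢
        rw [vPart_smul, hx, smul_zero] } with hW
  have hne : W ≠ ⊤ := by
    intro h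
    have hmem : (EuclideanSpace.single (Sum.inr (Sum.inr ⟨0, hn⟩)) 1 : PhaseSpace n) ∈ W := by
      rw [h]; trivial
    have h0 : vPart (EuclideanSpace.single (Sum.inr (Sum.inr ⟨0, hn⟩)) 1 : PhaseSpace n) = 0 := hmem
    have := congrArg (fun y => y ⟨0, hn⟩) h0
    simp [vPart] at this
  have := Measure.addHaar_submodule (volume : Measure (PhaseSpace n)) W hne
  rw [ae_iff]
  simpa [hW] using this

end PhaseSpace

open PhaseSpace

variable {n : ℕ}

theorem continuous_symbolDv {p : ℝ} (hp : 0 < p) : Continuous (symbolDv (n := n) p) := by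
  unfold symbolDv
  exact Continuous.rpow_const (by fun_prop) fun _ => Or.inr hp.le

theorem symbolDv_nonneg (p : ℝ) (z : PhaseSpace n) : 0 ≤ symbolDv p z := by
  unfold symbolDv; positivity

theorem symbolDx_nonneg (p : ℝ) (z : PhaseSpace n) : 0 ≤ symbolDx p z := by
  unfold symbolDx; positivity

theorem symbolDv_neg (p : ℝ) (z : PhaseSpace n) : symbolDv p (-z) = symbolDv p z := by
  simp [symbolDv, vPart_neg]

theorem symbolDv_linearFlow (p s : ℝ) (z : PhaseSpace n) :
    symbolDv p (linearFlow (shear n) s z)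
      = (2 * Real.pi * ‖vPart z + s • xPart z‖) ^ p := by
  rw [symbolDv, vPart_linearFlow]

/-- The equation `(∂_t + v·∇_x + A|D_v|^p) u = (1 + r|D_v|^p) h` in the Fourier variables, for the
transforms `U` of `u` and `P` of `h`. -/
def IsFrozenSolution (p A r : ℝ) (U P : PhaseL2 n) : Prop :=
  ∀ Φ : 𝓢(PhaseSpace n, ℂ),
    ∫ z, U z * (fderiv ℝ Φ z (shear n z)
        + (2 * Real.pi * Complex.I * z (Sum.inl ()) + A * symbolDv p z) * Φ z)
      = ∫ z, (1 + r * symbolDv p z) * P z * Φ z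

theorem lintegral_enorm_sq_ne_top (U : PhaseL2 n) : ∫⁻ z, ‖U z‖ₑ ^ 2 ≠ ⊤ := by
  have := (Lp.memLp U).eLpNorm_lt_top
  rw [eLpNorm_lt_top_iff_lintegral_rpow_enorm_lt_top (by simp) (by simp)] at this
  simpa using this.ne

/-- Duhamel domination for the rate c = 2πiτ + A w. The part 2πiτ only contributes a phase, so the
modulus of the exponential is governed by the cost. -/
theorem IsFrozenSolution.ae_enorm_le {p A r : ℝ} (hn : 1 ≤ n) (hp : 0 < p) (hA : 0 < A)
    {U P : PhaseL2 n} (h : IsFrozenSolution p A r U P) :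
    ∀ᵐ z, ‖U z‖ₑ ≤ ∫⁻ σ in Ioi (0 : ℝ),
      ENNReal.ofReal (Real.exp (-(A * runningCost p (vPart z) (xPart z) σ)))
        * ‖(1 + r * symbolDv p (linearFlow (shear n) σ z) : ℂ)
          * P (linearFlow (shear n) σ z)‖ₑ := by
  have hw := continuous_symbolDv (n := n) hp
  set c : PhaseSpace n → ℂ := fun z =>
    2 * Real.pi * Complex.I * z (Sum.inl ()) + A * symbolDv p z with hc
  have hcc : Continuous c := by
    have : Continuous fun z : PhaseSpace n => z (Sum.inl ()) := by fun_prop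
    fun_prop
  have hcre : ∀ z, (c z).re = A * symbolDv p z := by
    intro z; simp [hc]
  have hqc : Continuous fun z : PhaseSpace n => (1 + r * symbolDv p z : ℂ) := by fun_prop
  have hU := (Lp.memLp U).locallyIntegrable one_le_two
  have hP := (Lp.memLp P).locallyIntegrable one_le_two
  have hQ : LocallyIntegrable (fun z => (1 + r * symbolDv p z : ℂ) * P z) := hP.continuous_mul hqc
  have hcU : LocallyIntegrable (fun z => c z * U z) := hU.continuous_mul hcc
  have htrans : ∀ s : ℝ, 0 ≤ s → ∀ᵐ z, U (linearFlow (shear n) s z) = U z + ∫ σ in (0 : ℝ)..s,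
      (c (linearFlow (shear n) σ z) * U (linearFlow (shear n) σ z)
        - (1 + r * symbolDv p (linearFlow (shear n) σ z) : ℂ)
          * P (linearFlow (shear n) σ z)) := by
    intro s hs
    refine ae_eq_add_integral_comp_linearFlow shear_shear measurePreserving_linearFlow hU
      (G := fun z => c z * U z - (1 + r * symbolDv p z : ℂ) * P z) (hcU.sub hQ)
      (fun Φ hΦ hΦc => ?_) hs
    have hΦ' : ContDiff ℝ ∞ fun z => (Φ z : ℂ) := Complex.ofRealCLM.contDiff.comp hΦ
    have hΦc' : HasCompactSupport fun z => (Φ z : ℂ) := hΦc.comp_left Complex.ofReal_zero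
    have h1 := h (hΦc'.toSchwartzMap hΦ')
    have hfd : ∀ z, fderiv ℝ (fun z => (Φ z : ℂ)) z (shear n z)
        = (fderiv ℝ Φ z (shear n z) : ℂ) := by
      intro z
      have := Complex.ofRealCLM.hasFDerivAt.comp z
        (hΦ.differentiable (by simp) z).hasFDerivAt
      have h2 := this.fderiv
      change fderiv ℝ (fun z => (Φ z : ℂ)) z = _ at h2
      rw [h2]; simp
    have hDcont : Continuous fun z => fderiv ℝ Φ z (shear n z) :=
      (hΦ.continuous_fderiv (by simp)).clm_apply (shear n).continuous
    have hDc : HasCompactSupport fun z => fderiv ℝ Φ z (shear n z) := by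
      refine (hΦc.fderiv (𝕜 := ℝ)).mono' ?_
      intro z hz
      refine subset_tsupport _ ?_
      rw [Function.mem_support] at hz ⊢
      intro h0
      exact hz (by simp [h0])
    have i1 : Integrable fun z => fderiv ℝ Φ z (shear n z) • U z :=
      hU.integrable_smul_left_of_hasCompactSupport hDcont hDc
    have i2 : Integrable fun z => Φ z • (c z * U z) :=
      hcU.integrable_smul_left_of_hasCompactSupport hΦ.continuous hΦc
    have i3 : Integrable fun z => Φ z • ((1 + r * symbolDv p z : ℂ) * P z) :=
      hQ.integrable_smul_left_of_hasCompactSupport hΦ.continuous hΦc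
    have h3 : (∫ z, fderiv ℝ Φ z (shear n z) • U z) + ∫ z, Φ z • (c z * U z)
        = ∫ z, Φ z • ((1 + r * symbolDv p z : ℂ) * P z) := by
      rw [← integral_add i1 i2]
      refine Eq.trans (integral_congr_ae (ae_of_all _ fun z => ?_))
        (h1.trans (integral_congr_ae (ae_of_all _ fun z => ?_)))
      · change _ = U z * (fderiv ℝ (fun z => (Φ z : ℂ)) z (shear n z) + c z * (Φ z : ℂ))
        simp only [hfd, Complex.real_smul]
        ring
      · simp only [HasCompactSupport.toSchwartzMap_toFun, Complex.real_smul]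
        ring
    simp only [smul_sub]
    rw [integral_sub i2 i3, ← h3]
    ring
  have hmain := ae_enorm_le_lintegral_comp_linearFlow shear_shear measurePreserving_linearFlow
    hU hQ (Lp.stronglyMeasurable U) (hqc.stronglyMeasurable.mul (Lp.stronglyMeasurable P)) hcc
    (fun z => by rw [hcre]; exact mul_nonneg hA.le (symbolDv_nonneg p z))
    (lintegral_enorm_sq_ne_top U) ?_ htrans
  · filter_upwards [hmain] with z hz
    simp only [hcre, symbolDv_linearFlow, intervalIntegral.integral_const_mul] at hz
    simpa only [symbolDv_linearFlow, runningCost] using hz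
  · filter_upwards [ae_vPart_ne_zero hn] with z hz
    -- The backward orbit from (ξ, k) is the forward path with -k.
    have h1 := (exp_neg_runningCost_tendsto hp hA hz (-xPart z)).comp
      tendsto_natCast_atTop_atTop
    simp only [hcre, symbolDv_linearFlow, intervalIntegral.integral_const_mul]
    simpa only [Function.comp_def, runningCost, smul_neg, neg_smul] using h1

end FrozenEquation

/-! ### L² estimates for the frozen equation by Schur's test. -/

section FrozenEstimates

open Set Filter Topology
open scoped ENNReal

section Kernel

variable {V : Type*} [NormedAddCommGroup V] [NormedSpace ℝ V]

theorem continuous_runningCost {p : ℝ} (hp : 0 < p) :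
    Continuous fun x : (V × V) × ℝ => runningCost p x.1.1 x.1.2 x.2 := by
  have h1 : Continuous (Function.uncurry fun (x : (V × V) × ℝ) (ρ : ℝ) =>
      (2 * Real.pi * ‖x.1.1 + ρ • x.1.2‖) ^ p) :=
    Continuous.rpow_const (by fun_prop) fun _ => Or.inr hp.le
  exact intervalIntegral.continuous_parametric_intervalIntegral_of_continuous (a₀ := 0) h1
    continuous_snd

/-- The same segment, run from its end to its start. This identifies the transposed kernels in
Schur's test. -/
theorem runningCost_reverse (p : ℝ) (ξ k : V) (s : ℝ) :
    runningCost p (ξ + s • k) (-k) s = runningCost p ξ k s := by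
  have := intervalIntegral.integral_comp_sub_left (a := 0) (b := s)
    (fun ρ => (2 * Real.pi * ‖ξ + ρ • k‖) ^ p) s
  rw [sub_self, sub_zero] at this
  rw [runningCost, runningCost, ← this]
  refine intervalIntegral.integral_congr fun ρ _ => ?_
  change (2 * Real.pi * ‖ξ + s • k + ρ • -k‖) ^ p = (2 * Real.pi * ‖ξ + (s - ρ) • k‖) ^ p
  rw [show ξ + s • k + ρ • -k = ξ + (s - ρ) • k by module]

/-- The Schur kernel of `|D_v|^p (A|D_v|^p + transport)⁻¹` plus that of its adjoint. -/
noncomputable def dampedKernel (p A : ℝ) (ξ k : V) (s : ℝ) : ℝ≥0∞ :=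
  ENNReal.ofReal ((2 * Real.pi * ‖ξ‖) ^ p * Real.exp (-(A * runningCost p ξ k s)))
    + ENNReal.ofReal ((2 * Real.pi * ‖ξ + s • k‖) ^ p * Real.exp (-(A * runningCost p ξ k s)))

theorem dampedKernel_eq (p A : ℝ) (ξ k : V) (s : ℝ) : dampedKernel p A ξ k s
    = ENNReal.ofReal ((2 * Real.pi * ‖ξ‖) ^ p * Real.exp (-(A * runningCost p ξ k s)))
      + ENNReal.ofReal ((2 * Real.pi * ‖ξ + s • k‖) ^ p
        * Real.exp (-(A * runningCost p ξ k s))) := rfl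

theorem measurable_dampedKernel [MeasurableSpace V] [BorelSpace V] [SecondCountableTopology V]
    {p : ℝ} (hp : 0 < p) (A : ℝ) :
    Measurable fun x : (V × V) × ℝ => dampedKernel p A x.1.1 x.1.2 x.2 := by
  have h := continuous_runningCost (V := V) hp
  have h1 : Continuous fun x : (V × V) × ℝ => (2 * Real.pi * ‖x.1.1‖) ^ p
      * Real.exp (-(A * runningCost p x.1.1 x.1.2 x.2)) :=
    (Continuous.rpow_const (by fun_prop) fun _ => Or.inr hp.le).mul
      (Real.continuous_exp.comp (h.const_mul A).neg)
  have h2 : Continuous fun x : (V × V) × ℝ => (2 * Real.pi * ‖x.1.1 + x.2 • x.1.2‖) ^ p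
      * Real.exp (-(A * runningCost p x.1.1 x.1.2 x.2)) :=
    (Continuous.rpow_const (by fun_prop) fun _ => Or.inr hp.le).mul
      (Real.continuous_exp.comp (h.const_mul A).neg)
  exact h1.measurable.ennreal_ofReal.add h2.measurable.ennreal_ofReal

theorem lintegral_dampedKernel_le {p A : ℝ} (hp : 0 < p) (hA : 0 < A) (ξ k : V) :
    ∫⁻ s in Ioi (0 : ℝ), dampedKernel p A ξ k s ≤ ENNReal.ofReal ((3 ^ (p + 1) + 1) / A) := by
  have hc : Continuous (runningCost p ξ k) :=
    (continuous_runningCost (V := V) hp).comp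
      (by fun_prop : Continuous fun s : ℝ => ((ξ, k), s))
  unfold dampedKernel
  rw [lintegral_add_left (by fun_prop), add_div, ENNReal.ofReal_add (by positivity) (by positivity)]
  exact add_le_add (lintegral_symbol_mul_exp_neg_runningCost_le hp hA ξ k)
    (lintegral_pathSymbol_mul_exp_neg_runningCost_le hp hA ξ k)

/-- Reversal exchanges the two summands, so the sum is its own transpose up to the sign of k and a
single integral bound serves both hypotheses of Schur's test. -/
theorem dampedKernel_reverse (p A : ℝ) (ξ k : V) (s : ℝ) :
    dampedKernel p A (ξ + s • k) (-k) s = dampedKernel p A ξ k s := by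
  have : ξ + s • k + s • (-k) = ξ := by module
  rw [dampedKernel, dampedKernel, runningCost_reverse, this, add_comm]

attribute [irreducible] dampedKernel

end Kernel

open PhaseSpace

variable {n : ℕ}

/-- Sources of the form (1 + r|D_v|^p)P are admitted because the localization produces commutators
and a term |D_v|^p(...) not known to be in L². The bound contains no r, and it is proportional to
1/A. -/
theorem IsFrozenSolution.lintegral_symbolDv_le {p A r : ℝ} (hn : 1 ≤ n) (hp : 0 < p) (hA : 0 < A)
    (hr : 0 ≤ r) {U P : PhaseL2 n} (h : IsFrozenSolution p A r U P) :
    ∫⁻ z, (ENNReal.ofReal (symbolDv p z / (1 + r * symbolDv p z)) * ‖U z‖ₑ) ^ 2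
      ≤ ENNReal.ofReal ((3 ^ (p + 1) + 1) / A) ^ 2 * ∫⁻ z, ‖P z‖ₑ ^ 2 := by
  have hflow : Measurable fun x : ℝ × PhaseSpace n => linearFlow (shear n) x.1 x.2 :=
    continuous_linearFlow.measurable
  have hK : Measurable fun x : ℝ × PhaseSpace n =>
      dampedKernel p A (vPart x.2) (xPart x.2) x.1 :=
    (measurable_dampedKernel hp A).comp (Continuous.measurable (by fun_prop) :
      Measurable fun x : ℝ × PhaseSpace n => ((vPart x.2, xPart x.2), x.1))
  have hK' : Measurable fun x : ℝ × PhaseSpace n =>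
      dampedKernel p A (vPart x.2) (-xPart x.2) x.1 :=
    (measurable_dampedKernel hp A).comp (Continuous.measurable (by fun_prop) :
      Measurable fun x : ℝ × PhaseSpace n => ((vPart x.2, -xPart x.2), x.1))
  have hschur := lintegral_sq_lintegral_comp_le (ν := volume.restrict (Ioi (0 : ℝ)))
    (μ := (volume : Measure (PhaseSpace n))) (T := linearFlow (shear n)) hflow
    measurePreserving_linearFlow (K := fun s z => dampedKernel p A (vPart z) (xPart z) s)
    (K' := fun s z => dampedKernel p A (vPart z) (-xPart z) s) hK hK'
    (fun s z => by rw [vPart_linearFlow, xPart_linearFlow, dampedKernel_reverse])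
    (fun z => lintegral_dampedKernel_le hp hA _ _) (fun z => lintegral_dampedKernel_le hp hA _ _)
    (Lp.stronglyMeasurable P).measurable.enorm
  rw [← sq] at hschur
  refine le_trans (lintegral_mono_ae ?_) hschur
  filter_upwards [h.ae_enorm_le hn hp hA] with z hz
  refine pow_le_pow_left' ?_ 2
  calc _ ≤ ENNReal.ofReal (symbolDv p z / (1 + r * symbolDv p z)) * ∫⁻ σ in Ioi (0 : ℝ),
      ENNReal.ofReal (Real.exp (-(A * runningCost p (vPart z) (xPart z) σ)))
        * ‖(1 + r * symbolDv p (linearFlow (shear n) σ z) : ℂ)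
          * P (linearFlow (shear n) σ z)‖ₑ := by gcongr
    _ = ∫⁻ σ in Ioi (0 : ℝ), ENNReal.ofReal (symbolDv p z / (1 + r * symbolDv p z))
      * (ENNReal.ofReal (Real.exp (-(A * runningCost p (vPart z) (xPart z) σ)))
        * ‖(1 + r * symbolDv p (linearFlow (shear n) σ z) : ℂ)
          * P (linearFlow (shear n) σ z)‖ₑ) := by
        rw [lintegral_const_mul' _ _ ENNReal.ofReal_ne_top]
    _ ≤ _ := by
        refine lintegral_mono fun σ => ?_
        set w := symbolDv p z with hw
        set w' := symbolDv p (linearFlow (shear n) σ z) with hw'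
        have hw0 : 0 ≤ w := symbolDv_nonneg p z
        have hw'0 : 0 ≤ w' := symbolDv_nonneg p _
        have hn1 : ‖(1 + r * w' : ℂ)‖ₑ = ENNReal.ofReal (1 + r * w') := by
          rw [← ofReal_norm]
          congr 1
          have : (1 + r * w' : ℂ) = ((1 + r * w' : ℝ) : ℂ) := by push_cast; rfl
          rw [this, Complex.norm_real, Real.norm_of_nonneg (by positivity)]
        rw [enorm_mul, hn1, ← mul_assoc, ← mul_assoc, ← ENNReal.ofReal_mul (by positivity),
          ← ENNReal.ofReal_mul (by positivity)]
        refine mul_le_mul_left ?_ _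
        rw [dampedKernel_eq, ← symbolDv_linearFlow, ← hw', ← ENNReal.ofReal_add (by positivity)
          (by positivity)]
        refine ENNReal.ofReal_le_ofReal ?_
        have he := Real.exp_pos (-(A * runningCost p (vPart z) (xPart z) σ))
        set e := Real.exp (-(A * runningCost p (vPart z) (xPart z) σ))
        have hw1 : (2 * Real.pi * ‖vPart z‖) ^ p = w := rfl
        rw [hw1, ← add_mul]
        -- The regularized weight at the start pays for the unbounded factor of the source at the
        -- end of the path. This is where r drops out.
        have hkey : w / (1 + r * w) * (1 + r * w') ≤ w + w' := by
          rw [div_mul_eq_mul_div, div_le_iff₀ (by positivity)]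
          nlinarith [mul_nonneg hr (mul_nonneg hw0 hw'0), mul_nonneg hr (mul_nonneg hw0 hw0)]
        calc _ = w / (1 + r * w) * (1 + r * w') * e := by ring
          _ ≤ _ := mul_le_mul_of_nonneg_right hkey he.le

/-- The flow conserves k, so the weight in k is constant along orbits and the transposed kernel is
the same kernel with -k. -/
theorem IsFrozenSolution.lintegral_symbolDx_le {p : ℝ} (hn : 1 ≤ n) (hp : 0 < p)
    {U P : PhaseL2 n} (h : IsFrozenSolution p 1 0 U P) :
    ∫⁻ z, (ENNReal.ofReal (symbolDx (p / (1 + p)) z) * ‖U z‖ₑ) ^ 2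
      ≤ ENNReal.ofReal (8 * Real.exp 1) ^ 2 * ∫⁻ z, ‖P z‖ₑ ^ 2 := by
  have hflow : Measurable fun x : ℝ × PhaseSpace n => linearFlow (shear n) x.1 x.2 :=
    continuous_linearFlow.measurable
  have hq : 0 < p / (1 + p) := by positivity
  have hrc := continuous_runningCost (V := EuclideanSpace ℝ (Fin n)) hp
  have hK : Continuous fun x : ℝ × PhaseSpace n => (2 * Real.pi * ‖xPart x.2‖) ^ (p / (1 + p))
      * Real.exp (-runningCost p (vPart x.2) (xPart x.2) x.1) :=
    (Continuous.rpow_const (by fun_prop) fun _ => Or.inr hq.le).mul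
      (Real.continuous_exp.comp (hrc.comp (by fun_prop :
        Continuous fun x : ℝ × PhaseSpace n => ((vPart x.2, xPart x.2), x.1))).neg)
  have hK' : Continuous fun x : ℝ × PhaseSpace n => (2 * Real.pi * ‖-xPart x.2‖) ^ (p / (1 + p))
      * Real.exp (-runningCost p (vPart x.2) (-xPart x.2) x.1) :=
    (Continuous.rpow_const (by fun_prop) fun _ => Or.inr hq.le).mul
      (Real.continuous_exp.comp (hrc.comp (by fun_prop :
        Continuous fun x : ℝ × PhaseSpace n => ((vPart x.2, -xPart x.2), x.1))).neg)
  have hschur := lintegral_sq_lintegral_comp_le (ν := volume.restrict (Ioi (0 : ℝ)))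
    (μ := (volume : Measure (PhaseSpace n))) (T := linearFlow (shear n)) hflow
    measurePreserving_linearFlow
    (K := fun s z => ENNReal.ofReal ((2 * Real.pi * ‖xPart z‖) ^ (p / (1 + p))
      * Real.exp (-runningCost p (vPart z) (xPart z) s)))
    (K' := fun s z => ENNReal.ofReal ((2 * Real.pi * ‖-xPart z‖) ^ (p / (1 + p))
      * Real.exp (-runningCost p (vPart z) (-xPart z) s)))
    hK.measurable.ennreal_ofReal hK'.measurable.ennreal_ofReal
    (fun s z => by rw [vPart_linearFlow, xPart_linearFlow, runningCost_reverse, norm_neg])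
    (fun z => lintegral_displacement_mul_exp_neg_runningCost_le hp _ _)
    (fun z => lintegral_displacement_mul_exp_neg_runningCost_le hp _ _)
    (Lp.stronglyMeasurable P).measurable.enorm
  rw [← sq] at hschur
  refine le_trans (lintegral_mono_ae ?_) hschur
  filter_upwards [h.ae_enorm_le hn hp one_pos] with z hz
  refine pow_le_pow_left' ?_ 2
  simp only [Complex.ofReal_zero, zero_mul, add_zero, one_mul] at hz
  calc _ ≤ ENNReal.ofReal (symbolDx (p / (1 + p)) z) * ∫⁻ σ in Ioi (0 : ℝ),
      ENNReal.ofReal (Real.exp (-runningCost p (vPart z) (xPart z) σ))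
        * ‖P (linearFlow (shear n) σ z)‖ₑ := by gcongr
    _ = _ := by
        rw [← lintegral_const_mul' _ _ ENNReal.ofReal_ne_top]
        refine lintegral_congr fun σ => ?_
        rw [← mul_assoc, ← ENNReal.ofReal_mul (symbolDx_nonneg _ _)]
        rfl

theorem ofReal_norm_sq_eq_lintegral (U : PhaseL2 n) :
    ENNReal.ofReal ‖U‖ ^ 2 = ∫⁻ z, ‖U z‖ₑ ^ 2 := by
  rw [ofReal_norm, Lp.enorm_def, eLpNorm_eq_lintegral_rpow_enorm_toReal (by simp) (by simp),
    ← ENNReal.rpow_two, ← ENNReal.rpow_mul]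
  simp

/-- Multiplication by a nonnegative function that is bounded in the sense of quadratic forms. -/
theorem exists_mul_of_lintegral_le {U : PhaseL2 n} {m : PhaseSpace n → ℝ} (hm : Measurable m)
    (hm0 : ∀ z, 0 ≤ m z) {C : ℝ} (hC : 0 ≤ C)
    (h : ∫⁻ z, (ENNReal.ofReal (m z) * ‖U z‖ₑ) ^ 2 ≤ ENNReal.ofReal C ^ 2) :
    ∃ V : PhaseL2 n, V =ᵐ[volume] (fun z => (m z : ℂ) * U z) ∧ ‖V‖ ≤ C := by
  have hen : ∀ z, ‖(m z : ℂ) * U z‖ₑ = ENNReal.ofReal (m z) * ‖U z‖ₑ := fun z => by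
    rw [enorm_mul]
    congr 1
    rw [← ofReal_norm, Complex.norm_real, Real.norm_of_nonneg (hm0 z)]
  have hmeas : AEStronglyMeasurable (fun z => (m z : ℂ) * U z) volume :=
    ((Complex.measurable_ofReal.comp hm).mul (Lp.stronglyMeasurable U).measurable).aestronglyMeasurable
  have hlt : MemLp (fun z => (m z : ℂ) * U z) 2 volume := by
    refine ⟨hmeas, ?_⟩
    rw [eLpNorm_lt_top_iff_lintegral_rpow_enorm_lt_top (by simp) (by simp)]
    simp only [hen, ENNReal.toReal_ofNat, ENNReal.rpow_two]
    exact h.trans_lt (ENNReal.pow_lt_top ENNReal.ofReal_lt_top)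
  refine ⟨hlt.toLp, hlt.coeFn_toLp, ?_⟩
  have h1 : ENNReal.ofReal ‖hlt.toLp‖ ^ 2 ≤ ENNReal.ofReal C ^ 2 := by
    rw [ofReal_norm_sq_eq_lintegral]
    refine le_trans (le_of_eq (lintegral_congr_ae ?_)) h
    filter_upwards [hlt.coeFn_toLp] with z hz
    rw [hz, hen]
  have h2 := (ENNReal.pow_le_pow_left_iff two_ne_zero).1 h1
  exact (ENNReal.ofReal_le_ofReal_iff hC).1 h2

theorem IsFrozenSolution.exists_symbolDv {p A r : ℝ} (hn : 1 ≤ n) (hp : 0 < p) (hA : 0 < A)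
    (hr : 0 ≤ r) {U P : PhaseL2 n} (h : IsFrozenSolution p A r U P) :
    ∃ V : PhaseL2 n, V =ᵐ[volume]
        (fun z => ((symbolDv p z / (1 + r * symbolDv p z) : ℝ) : ℂ) * U z)
      ∧ ‖V‖ ≤ (3 ^ (p + 1) + 1) / A * ‖P‖ := by
  have hw := continuous_symbolDv (n := n) hp
  refine exists_mul_of_lintegral_le
    (m := fun z => symbolDv p z / (1 + r * symbolDv p z))
    (hw.measurable.div (hw.measurable.const_mul r |>.const_add 1))
    (fun z => ?_) (by positivity) ?_
  · have := symbolDv_nonneg p z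
    positivity
  · rw [ENNReal.ofReal_mul (by positivity), mul_pow, ofReal_norm_sq_eq_lintegral]
    exact h.lintegral_symbolDv_le hn hp hA hr

theorem IsFrozenSolution.exists_symbolDx {p : ℝ} (hn : 1 ≤ n) (hp : 0 < p)
    {U P : PhaseL2 n} (h : IsFrozenSolution p 1 0 U P) :
    ∃ V : PhaseL2 n, V =ᵐ[volume] (fun z => (symbolDx (p / (1 + p)) z : ℂ) * U z)
      ∧ ‖V‖ ≤ 8 * Real.exp 1 * ‖P‖ := by
  have hq : 0 < p / (1 + p) := by positivity
  have hm : Continuous (symbolDx (n := n) (p / (1 + p))) := by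
    unfold symbolDx
    exact Continuous.rpow_const (by fun_prop) fun _ => Or.inr hq.le
  refine exists_mul_of_lintegral_le hm.measurable (symbolDx_nonneg _) (by positivity) ?_
  rw [ENNReal.ofReal_mul (by positivity), mul_pow, ofReal_norm_sq_eq_lintegral]
  exact h.lintegral_symbolDx_le hn hp

end FrozenEstimates

/-! ### Fourier duality for the multiplier and for the transport. -/

section FourierDuality

open Set Filter Topology PhaseSpace

section Duality

variable {V : Type*} [NormedAddCommGroup V] [InnerProductSpace ℝ V] [FiniteDimensional ℝ V]
  [MeasurableSpace V] [BorelSpace V]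

theorem integral_fourier_mul_schwartz (f : Lp (α := V) ℂ 2 volume) (Φ : 𝓢(V, ℂ)) :
    ∫ z, (𝓕 f : Lp (α := V) ℂ 2 volume) z * Φ z = ∫ z, f z * 𝓕 Φ z := by
  have h := congrArg (fun T : TemperedDistribution V ℂ => T Φ)
    (Lp.fourier_toTemperedDistribution_eq f)
  simp only [TemperedDistribution.fourier_apply, Lp.toTemperedDistribution_apply,
    smul_eq_mul] at h
  simp only [mul_comm _ (Φ _), mul_comm _ (𝓕 Φ _)]
  exact h.symm

/-- Both sides are continuous in h and agree on the dense set of Schwartz functions. -/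
theorem Lp_integral_fourier_mul (f h : Lp (α := V) ℂ 2 volume) :
    ∫ z, (𝓕 f : Lp (α := V) ℂ 2 volume) z * h z
      = ∫ z, f z * (𝓕 h : Lp (α := V) ℂ 2 volume) z := by
  set B := (ContinuousLinearMap.mul ℂ ℂ).lpPairing (volume : Measure V) 2 2 with hB
  have hBe : ∀ f h, B f h = ∫ z, f z * h z := fun f h =>
    ContinuousLinearMap.lpPairing_eq_integral _ f h
  rw [← hBe, ← hBe]
  refine DenseRange.induction_on (p := fun h : Lp (α := V) ℂ 2 volume => B (𝓕 f) h = B f (𝓕 h))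
    (SchwartzMap.denseRange_toLpCLM (p := 2) (μ := (volume : Measure V)) ENNReal.ofNat_ne_top) h
    ?_ fun Φ => ?_
  · exact isClosed_eq (B (𝓕 f)).continuous
      ((B f).continuous.comp (Lp.fourierTransformₗᵢ V ℂ).continuous)
  · change B (𝓕 f) (Φ.toLp 2) = B f (𝓕 (Φ.toLp 2))
    rw [SchwartzMap.toLp_fourier_eq, hBe, hBe]
    refine Eq.trans (integral_congr_ae ?_)
      ((integral_fourier_mul_schwartz f Φ).trans (integral_congr_ae ?_))
    · filter_upwards [Φ.coeFn_toLp 2 volume] with z hz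
      rw [hz]
    · filter_upwards [(𝓕 Φ).coeFn_toLp 2 volume] with z hz
      rw [hz]

/-- On `L¹ ∩ L²` the Fourier-Plancherel transform is given by the Fourier integral. -/
theorem fourier_toLp_ae_eq {h : V → ℂ} (h1 : Integrable h) (h2 : MemLp h 2 volume) :
    (𝓕 (h2.toLp h) : Lp (α := V) ℂ 2 volume) =ᵐ[volume] 𝓕 h := by
  have hcont : Continuous (𝓕 h) :=
    VectorFourier.fourierIntegral_continuous Real.continuous_fourierChar
      (L := innerₗ V) continuous_inner h1
  refine ae_eq_of_integral_contDiff_smul_eq ((Lp.memLp _).locallyIntegrable one_le_two)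
    hcont.locallyIntegrable fun Φ hΦ hΦc => ?_
  have hΦ' : ContDiff ℝ ∞ fun z => (Φ z : ℂ) := Complex.ofRealCLM.contDiff.comp hΦ
  have hΦc' : HasCompactSupport fun z => (Φ z : ℂ) := hΦc.comp_left Complex.ofReal_zero
  set Ψ : 𝓢(V, ℂ) := hΦc'.toSchwartzMap hΦ' with hΨ
  have hΨe : ∀ z, Ψ z = (Φ z : ℂ) := fun z => rfl
  have e1 := integral_fourier_mul_schwartz (h2.toLp h) Ψ
  have e2 := VectorFourier.integral_fourierIntegral_smul_eq_flip (L := innerₗ V)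
    Real.continuous_fourierChar continuous_inner (f := h) (g := (Ψ : V → ℂ)) (μ := volume)
    (ν := volume) h1 (Ψ.integrable (μ := volume))
  rw [flip_innerₗ] at e2
  calc _ = ∫ z, (𝓕 (h2.toLp h) : Lp (α := V) ℂ 2 volume) z * Ψ z := by
        refine integral_congr_ae (ae_of_all _ fun z => ?_)
        simp only [hΨe, Complex.real_smul, mul_comm]
    _ = ∫ z, h2.toLp h z * 𝓕 Ψ z := e1
    _ = ∫ z, h z • 𝓕 (Ψ : V → ℂ) z := by
        refine integral_congr_ae ?_
        filter_upwards [h2.coeFn_toLp] with z hz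
        rw [hz, smul_eq_mul, SchwartzMap.fourier_coe]
    _ = ∫ z, 𝓕 h z • Ψ z := e2.symm
    _ = _ := by
        refine integral_congr_ae (ae_of_all _ fun z => ?_)
        simp only [hΨe, Complex.real_smul, smul_eq_mul, mul_comm]

end Duality

variable {n : ℕ}

theorem rpow_le_one_add_sq {p x : ℝ} (hp : 0 < p) (hp2 : p ≤ 2) (hx : 0 ≤ x) :
    x ^ p ≤ 1 + x ^ 2 := by
  rcases le_total x 1 with h | h
  · have := Real.rpow_le_one hx h hp.le
    nlinarith
  · have := Real.rpow_le_rpow_of_exponent_le h hp2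
    rw [Real.rpow_two] at this
    linarith

theorem symbolDv_le {p : ℝ} (hp : 0 < p) (hp2 : p ≤ 2) (z : PhaseSpace n) :
    symbolDv p z ≤ 1 + (2 * Real.pi) ^ 2 * ‖z‖ ^ 2 := by
  have h1 := rpow_le_one_add_sq hp hp2 (x := 2 * Real.pi * ‖vPart z‖) (by positivity)
  have h2 : (2 * Real.pi * ‖vPart z‖) ^ 2 ≤ (2 * Real.pi) ^ 2 * ‖z‖ ^ 2 := by
    rw [mul_pow]
    gcongr
    exact norm_vPart_le z
  exact h1.trans (by linarith)

/-- The symbol need not be smooth at ξ = 0, so the product need not be a Schwartz function. Since p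
≤ 2, it is dominated by a quadratic polynomial times Φ, which is one. -/
theorem memLp_symbolDv_mul_schwartz {p : ℝ} (hp : 0 < p) (hp2 : p ≤ 2) (q : ENNReal)
    (Φ : 𝓢(PhaseSpace n, ℂ)) : MemLp (fun z => (symbolDv p z : ℂ) * Φ z) q volume := by
  have hG : Function.HasTemperateGrowth
      (fun z : PhaseSpace n => (1 + (2 * Real.pi) ^ 2 * ‖z‖ ^ 2 : ℝ)) := by fun_prop
  have hw := continuous_symbolDv (n := n) hp
  refine ((smulLeftCLM ℂ _ Φ).memLp q volume).mono
    (g := (smulLeftCLM ℂ (fun z : PhaseSpace n => (1 + (2 * Real.pi) ^ 2 * ‖z‖ ^ 2 : ℝ)) Φ)) ?_ ?_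
  · have : Continuous fun z => (symbolDv p z : ℂ) * Φ z := by
      have := Φ.continuous
      fun_prop
    exact this.aestronglyMeasurable
  · refine ae_of_all _ fun z => ?_
    rw [smulLeftCLM_apply_apply hG, norm_mul, norm_smul, Complex.norm_real,
      Real.norm_of_nonneg (symbolDv_nonneg p z), Real.norm_of_nonneg (by positivity)]
    exact mul_le_mul_of_nonneg_right (symbolDv_le hp hp2 z) (norm_nonneg _)

/-- Two Fourier transforms produce a reflection, which an even symbol does not see. Test functions
are therefore written as 𝓕 Φ from here on. -/
theorem fourierMult_fourier {m : PhaseSpace n → ℝ} (hm : ∀ z, m (-z) = m z)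
    (Φ : 𝓢(PhaseSpace n, ℂ)) :
    fourierMult m (𝓕 Φ : 𝓢(PhaseSpace n, ℂ)) = 𝓕 fun z => (m z : ℂ) * Φ z := by
  rw [fourierMult, Real.fourierInv_eq_fourier_comp_neg]
  congr 1
  ext z
  rw [hm, ← SchwartzMap.fourier_coe]
  congr 1
  rw [SchwartzMap.fourier_coe, ← Real.fourierInv_eq_fourier_neg, ← SchwartzMap.fourierInv_coe,
    FourierTransform.fourierInv_fourier_eq]

theorem fourierMult_symbolDv_ae_eq {p : ℝ} (hp : 0 < p) (hp2 : p ≤ 2) (Φ : 𝓢(PhaseSpace n, ℂ)) :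
    fourierMult (symbolDv p) (𝓕 Φ : 𝓢(PhaseSpace n, ℂ)) =ᵐ[volume]
      (𝓕 ((memLp_symbolDv_mul_schwartz hp hp2 2 Φ).toLp _) : PhaseL2 n) := by
  rw [fourierMult_fourier (symbolDv_neg p)]
  exact (fourier_toLp_ae_eq
    (memLp_one_iff_integrable.1 (memLp_symbolDv_mul_schwartz hp hp2 1 Φ)) _).symm

theorem memLp_fourierMult_symbolDv {p : ℝ} (hp : 0 < p) (hp2 : p ≤ 2) (φ : 𝓢(PhaseSpace n, ℂ)) :
    MemLp (fourierMult (symbolDv p) φ) 2 volume := by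
  have hφ : (𝓕 (𝓕⁻ φ : 𝓢(PhaseSpace n, ℂ)) : 𝓢(PhaseSpace n, ℂ)) = φ :=
    FourierTransform.fourier_fourierInv_eq φ
  rw [← hφ]
  exact (Lp.memLp _).ae_eq (fourierMult_symbolDv_ae_eq hp hp2 (𝓕⁻ φ)).symm

theorem integral_mul_fourierMult_symbolDv {p : ℝ} (hp : 0 < p) (hp2 : p ≤ 2) (f : PhaseL2 n)
    (Φ : 𝓢(PhaseSpace n, ℂ)) :
    ∫ z, f z * fourierMult (symbolDv p) (𝓕 Φ : 𝓢(PhaseSpace n, ℂ)) z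
      = ∫ z, (𝓕 f : PhaseL2 n) z * (symbolDv p z * Φ z) := by
  have h := Lp_integral_fourier_mul f ((memLp_symbolDv_mul_schwartz hp hp2 2 Φ).toLp _)
  refine Eq.trans (integral_congr_ae ?_) (h.symm.trans (integral_congr_ae ?_))
  · filter_upwards [fourierMult_symbolDv_ae_eq hp hp2 Φ] with z hz
    rw [hz]
  · filter_upwards [(memLp_symbolDv_mul_schwartz hp hp2 2 Φ).coeFn_toLp] with z hz
    rw [hz]

/-- The unit vector of the `v_i`-axis. -/
noncomputable def vDir (i : Fin n) : PhaseSpace n := EuclideanSpace.single (Sum.inr (Sum.inr i)) 1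

theorem inner_vDir (z : PhaseSpace n) (i : Fin n) : inner ℝ z (vDir i) = z (Sum.inr (Sum.inr i)) := by
  simp [vDir, EuclideanSpace.inner_single_right]

theorem inner_xDir (z : PhaseSpace n) (i : Fin n) :
    inner ℝ z (xDir i) = z (Sum.inr (Sum.inl i)) := by
  simp [xDir, EuclideanSpace.inner_single_right]

theorem inner_tDir (z : PhaseSpace n) : inner ℝ z (tDir n) = z (Sum.inl ()) := by
  simp [tDir, EuclideanSpace.inner_single_right]

theorem shear_eq_sum (z : PhaseSpace n) :
    shear n z = ∑ i, (z (Sum.inr (Sum.inl i))) • vDir (n := n) i := by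
  ext (_ | _ | j)
  · simp [shear_apply, vDir]
  · simp [shear_apply, vDir]
  · simp [shear_apply, vDir, Pi.single_apply]

open LineDeriv

/-- The Fourier conjugate `2πiτ + k·∇_ξ` of the free transport. -/
noncomputable def dualTransport (Φ : 𝓢(PhaseSpace n, ℂ)) : 𝓢(PhaseSpace n, ℂ) :=
  (2 * Real.pi * Complex.I) • smulLeftCLM ℂ (inner ℝ · (tDir n)) Φ
    + ∑ i : Fin n, smulLeftCLM ℂ (inner ℝ · (xDir i)) (∂_{vDir i} Φ)

theorem dualTransport_apply (Φ : 𝓢(PhaseSpace n, ℂ)) (z : PhaseSpace n) :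
    dualTransport Φ z
      = fderiv ℝ Φ z (shear n z) + 2 * Real.pi * Complex.I * z (Sum.inl ()) * Φ z := by
  have h1 : (inner ℝ · (tDir n)).HasTemperateGrowth := by fun_prop
  have h2 : ∀ i : Fin n, (inner ℝ · (xDir i)).HasTemperateGrowth := fun i => by fun_prop
  rw [shear_eq_sum, map_sum]
  simp only [dualTransport, add_apply, smul_apply, sum_apply, smulLeftCLM_apply_apply h1,
    smulLeftCLM_apply_apply (h2 _), lineDerivOp_apply_eq_fderiv]
  simp only [inner_tDir, inner_xDir, map_smul, smul_eq_mul, Complex.real_smul]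
  ring

theorem fourier_dualTransport (Φ : 𝓢(PhaseSpace n, ℂ)) (z : PhaseSpace n) :
    𝓕 (dualTransport Φ) z = -transport (fun w => 𝓕 Φ w) z := by
  have h1 : (inner ℝ · (tDir n)).HasTemperateGrowth := by fun_prop
  have h2 : ∀ i : Fin n, (inner ℝ · (xDir i)).HasTemperateGrowth := fun i => by fun_prop
  have h3 : ∀ i : Fin n, (inner ℝ · (vDir i)).HasTemperateGrowth := fun i => by fun_prop
  have ht : fderiv ℝ (fun w => 𝓕 Φ w) z (tDir n)
      = -𝓕 ((2 * Real.pi * Complex.I) • smulLeftCLM ℂ (inner ℝ · (tDir n)) Φ) z := by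
    have := congrArg (fun Ψ : 𝓢(PhaseSpace n, ℂ) => Ψ z) (lineDerivOp_fourier_eq Φ (tDir n))
    simp only [lineDerivOp_apply_eq_fderiv] at this
    refine this.trans ?_
    rw [neg_smul, FourierTransform.fourier_neg, neg_apply]
  have hx : ∀ i : Fin n, (vPart z i : ℂ) * fderiv ℝ (fun w => 𝓕 Φ w) z (xDir i)
      = -𝓕 (smulLeftCLM ℂ (inner ℝ · (xDir i)) (∂_{vDir i} Φ)) z := by
    intro i
    have e1 := congrArg (fun Ψ : 𝓢(PhaseSpace n, ℂ) => Ψ z) (lineDerivOp_fourier_eq Φ (xDir i))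
    simp only [lineDerivOp_apply_eq_fderiv] at e1
    have e2 := congrArg (fun Ψ : 𝓢(PhaseSpace n, ℂ) => Ψ z)
      (fourier_lineDerivOp_eq (smulLeftCLM ℂ (inner ℝ · (xDir i)) Φ) (vDir i))
    simp only [smul_apply, smulLeftCLM_apply_apply (h3 i)] at e2
    simp only [inner_vDir] at e2
    -- Multiplication by k_i commutes with the derivative in ξ_i, the two axes being orthogonal.
    -- Hence the transport is skew with no zeroth-order term.
    have e3 : ∂_{vDir i} (smulLeftCLM ℂ (inner ℝ · (xDir i)) Φ)
        = smulLeftCLM ℂ (inner ℝ · (xDir i)) (∂_{vDir i} Φ) := by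
      ext w
      rw [lineDerivOp_apply_eq_fderiv, smulLeftCLM_apply (h2 i), smulLeftCLM_apply_apply (h2 i),
        lineDerivOp_apply_eq_fderiv]
      have d1 : HasFDerivAt (fun w : PhaseSpace n => inner ℝ w (xDir i))
          (innerSL ℝ (xDir i)) w := by
        have := (innerSL ℝ (xDir i : PhaseSpace n)).hasFDerivAt (x := w)
        refine this.congr_of_eventuallyEq (.of_forall fun y => ?_)
        simp [real_inner_comm]
      have d2 := d1.smul (Φ.differentiableAt (x := w)).hasFDerivAt
      have d3 : HasFDerivAt (fun w => inner ℝ w (xDir i) • Φ w) _ w := d2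
      rw [d3.fderiv]
      have h0 : inner ℝ (xDir i : PhaseSpace n) (vDir i) = 0 := by
        rw [inner_vDir]; simp [xDir]
      simp [h0]
    rw [e3] at e2
    have e4 : fderiv ℝ (fun w => 𝓕 Φ w) z (xDir i)
        = -(2 * Real.pi * Complex.I) * 𝓕 (smulLeftCLM ℂ (inner ℝ · (xDir i)) Φ) z := by
      refine e1.trans ?_
      rw [neg_smul, FourierTransform.fourier_neg, neg_apply, FourierTransform.fourier_smul,
        smul_apply, smul_eq_mul, neg_mul]
    rw [e4, e2]
    simp only [vPart, Complex.real_smul, smul_eq_mul]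
    ring
  rw [transport, ht, Finset.sum_congr rfl fun i _ => hx i, dualTransport,
    FourierTransform.fourier_add, FourierTransform.fourier_sum, add_apply, sum_apply,
    Finset.sum_neg_distrib]
  ring

theorem integral_mul_neg_transport_fourier (f : PhaseL2 n) (Φ : 𝓢(PhaseSpace n, ℂ)) :
    ∫ z, f z * -transport (fun w => 𝓕 Φ w) z
      = ∫ z, (𝓕 f : PhaseL2 n) z
        * (fderiv ℝ Φ z (shear n z) + 2 * Real.pi * Complex.I * z (Sum.inl ()) * Φ z) := by
  simp only [← dualTransport_apply, ← fourier_dualTransport]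
  exact (integral_fourier_mul_schwartz f _).symm

end FourierDuality

/-! ### The equation with coefficient one, and products of L² functions with bounded functions. -/

section ConstantCoefficient

open Set Filter Topology PhaseSpace

variable {n : ℕ}

theorem exists_isFourierMult {m : PhaseSpace n → ℝ} {f V : PhaseL2 n}
    (hV : V =ᵐ[volume] fun ζ => (m ζ : ℂ) * (𝓕 f : PhaseL2 n) ζ) :
    ∃ h : PhaseL2 n, IsFourierMult m f h ∧ ‖h‖ = ‖V‖ := by
  have e : (𝓕 (𝓕⁻ V : PhaseL2 n) : PhaseL2 n) = V := FourierTransform.fourier_fourierInv_eq V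
  refine ⟨𝓕⁻ V, ?_, ?_⟩
  · rw [IsFourierMult, e]
    exact hV
  · rw [← Lp.norm_fourier_eq (𝓕⁻ V), e]

theorem fourier_fourierInv (φ : 𝓢(PhaseSpace n, ℂ)) :
    (𝓕 (𝓕⁻ φ : 𝓢(PhaseSpace n, ℂ)) : 𝓢(PhaseSpace n, ℂ)) = φ :=
  FourierTransform.fourier_fourierInv_eq φ

theorem integrable_mul_neg_transport (f : PhaseL2 n) (φ : 𝓢(PhaseSpace n, ℂ)) :
    Integrable fun z => f z * -transport (fun w => φ w) z := by
  rw [← fourier_fourierInv φ]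
  simp only [← fourier_dualTransport]
  exact (Lp.memLp f).integrable_mul ((𝓕 (dualTransport (𝓕⁻ φ))).memLp 2 volume)

theorem integrable_mul_fourierMult {p : ℝ} (hp : 0 < p) (hp2 : p ≤ 2) (f : PhaseL2 n)
    (φ : 𝓢(PhaseSpace n, ℂ)) : Integrable fun z => f z * fourierMult (symbolDv p) φ z :=
  (Lp.memLp f).integrable_mul (memLp_fourierMult_symbolDv hp hp2 φ)

theorem integrable_fourier_mul_dualTransport (U : PhaseL2 n) (Φ : 𝓢(PhaseSpace n, ℂ)) :
    Integrable fun z => U z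
      * (fderiv ℝ Φ z (shear n z) + 2 * Real.pi * Complex.I * z (Sum.inl ()) * Φ z) := by
  simp only [← dualTransport_apply]
  exact (Lp.memLp U).integrable_mul ((dualTransport Φ).memLp 2 volume)

theorem integrable_mul_symbolDv_mul {p : ℝ} (hp : 0 < p) (hp2 : p ≤ 2) (U : PhaseL2 n)
    (Φ : 𝓢(PhaseSpace n, ℂ)) : Integrable fun z => U z * (symbolDv p z * Φ z) :=
  (Lp.memLp U).integrable_mul (memLp_symbolDv_mul_schwartz hp hp2 2 Φ)

theorem integrable_mul_schwartz (U : PhaseL2 n) (Φ : 𝓢(PhaseSpace n, ℂ)) :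
    Integrable fun z => U z * Φ z :=
  (Lp.memLp U).integrable_mul (Φ.memLp 2 volume)

theorem integral_frozen {p : ℝ} (hp : 0 < p) (hp2 : p ≤ 2) (A : ℝ) (U : PhaseL2 n)
    (Φ : 𝓢(PhaseSpace n, ℂ)) :
    ∫ z, U z * (fderiv ℝ Φ z (shear n z)
        + (2 * Real.pi * Complex.I * z (Sum.inl ()) + A * symbolDv p z) * Φ z)
      = (∫ z, U z * (fderiv ℝ Φ z (shear n z)
          + 2 * Real.pi * Complex.I * z (Sum.inl ()) * Φ z))
        + A * ∫ z, U z * (symbolDv p z * Φ z) := by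
  rw [← integral_const_mul, ← integral_add (integrable_fourier_mul_dualTransport U Φ)
    ((integrable_mul_symbolDv_mul hp hp2 U Φ).const_mul _)]
  refine integral_congr_ae (ae_of_all _ fun z => ?_)
  ring

theorem IsKineticSolution.integral_add_integral {β : ℝ} (hβ0 : 0 < β) (hβ1 : β ≤ 1)
    {a : PhaseSpace n → ℝ} {f g : PhaseL2 n} (h : IsKineticSolution β a f g)
    {φ ψ : 𝓢(PhaseSpace n, ℂ)} (hψ : ∀ z, ψ z = a z * φ z) :
    (∫ z, f z * -transport (fun w => φ w) z) + ∫ z, f z * fourierMult (symbolDv (2 * β)) ψ z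
      = ∫ z, g z * φ z := by
  have hψ' : (fun w => (a w : ℂ) * φ w) = ψ := funext fun z => (hψ z).symm
  rw [← integral_add (integrable_mul_neg_transport f φ)
    (integrable_mul_fourierMult (by linarith) (by linarith) f ψ), ← h φ, hψ']
  refine integral_congr_ae (ae_of_all _ fun z => ?_)
  ring

/-- Testing the equation against 𝓕 Φ moves the transform onto f and g. -/
theorem IsKineticSolution.isFrozenSolution {β : ℝ} (hβ0 : 0 < β) (hβ1 : β ≤ 1)
    {f g : PhaseL2 n} (h : IsKineticSolution β (fun _ => 1) f g) :
    IsFrozenSolution (2 * β) 1 0 (𝓕 f : PhaseL2 n) (𝓕 g : PhaseL2 n) := by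
  intro Φ
  have h1 := h.integral_add_integral hβ0 hβ1 (φ := 𝓕 Φ) (ψ := 𝓕 Φ) (fun z => by simp)
  rw [integral_mul_neg_transport_fourier,
    integral_mul_fourierMult_symbolDv (by linarith) (by linarith),
    ← integral_fourier_mul_schwartz] at h1
  rw [integral_frozen (by linarith) (by linarith)]
  simp only [Complex.ofReal_one, one_mul, Complex.ofReal_zero, zero_mul, add_zero]
  exact h1

theorem IsKineticSolution.exists_fourierMult_of_one (hn : 1 ≤ n) {β : ℝ} (hβ0 : 0 < β)
    (hβ1 : β ≤ 1) {f g : PhaseL2 n} (h : IsKineticSolution β (fun _ => 1) f g) :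
    (∃ fv : PhaseL2 n, IsFourierMult (symbolDv (2 * β)) f fv
      ∧ ‖fv‖ ≤ (3 ^ (2 * β + 1) + 1) * ‖g‖) ∧
    ∃ fx : PhaseL2 n, IsFourierMult (symbolDx (2 * β / (1 + 2 * β))) f fx
      ∧ ‖fx‖ ≤ 8 * Real.exp 1 * ‖g‖ := by
  have hF := h.isFrozenSolution hβ0 hβ1
  constructor
  · obtain ⟨V, hV, hVn⟩ := hF.exists_symbolDv hn (by linarith) one_pos le_rfl
    rw [Lp.norm_fourier_eq, div_one] at hVn
    simp only [zero_mul, add_zero, div_one] at hV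
    obtain ⟨fv, h1, h2⟩ := exists_isFourierMult hV
    exact ⟨fv, h1, h2.trans_le hVn⟩
  · obtain ⟨V, hV, hVn⟩ := hF.exists_symbolDx hn (by linarith)
    rw [Lp.norm_fourier_eq] at hVn
    obtain ⟨fv, h1, h2⟩ := exists_isFourierMult hV
    exact ⟨fv, h1, h2.trans_le hVn⟩

theorem IsFourierMult.integral_mul_fourierMult {p : ℝ} (hp : 0 < p) (hp2 : p ≤ 2)
    {f fv : PhaseL2 n} (h : IsFourierMult (symbolDv p) f fv) (φ : 𝓢(PhaseSpace n, ℂ)) :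
    ∫ z, f z * fourierMult (symbolDv p) φ z = ∫ z, fv z * φ z := by
  rw [← fourier_fourierInv φ, integral_mul_fourierMult_symbolDv hp hp2,
    ← integral_fourier_mul_schwartz]
  refine integral_congr_ae ?_
  filter_upwards [h] with z hz
  rw [hz]
  ring

/-- The product of a bounded continuous function and a function in `L²` (zero if the pointwise
product is not in `L²`). -/
noncomputable def mulLp (ρ : PhaseSpace n → ℝ) (f : PhaseL2 n) : PhaseL2 n := by
  classical
  exact if h : MemLp (fun z => (ρ z : ℂ) * f z) 2 volume then h.toLp _ else 0

theorem memLp_mul_of_bounded {ρ : PhaseSpace n → ℝ} (hρ : Continuous ρ) {M : ℝ}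
    (hM : ∀ z, |ρ z| ≤ M) (f : PhaseL2 n) : MemLp (fun z => (ρ z : ℂ) * f z) 2 volume := by
  refine ((Lp.memLp f).const_mul (M : ℂ)).mono ?_ (ae_of_all _ fun z => ?_)
  · exact (Complex.continuous_ofReal.comp hρ).aestronglyMeasurable.mul
      (Lp.aestronglyMeasurable f)
  · rw [norm_mul, norm_mul, Complex.norm_real, Complex.norm_real, Real.norm_eq_abs,
      Real.norm_eq_abs]
    exact mul_le_mul_of_nonneg_right ((hM z).trans (le_abs_self M)) (norm_nonneg _)

theorem coeFn_mulLp {ρ : PhaseSpace n → ℝ} (hρ : Continuous ρ) {M : ℝ}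
    (hM : ∀ z, |ρ z| ≤ M) (f : PhaseL2 n) :
    mulLp ρ f =ᵐ[volume] fun z => (ρ z : ℂ) * f z := by
  have h := memLp_mul_of_bounded hρ hM f
  rw [mulLp, dif_pos h]
  exact h.coeFn_toLp

theorem norm_le_mul_norm_of_ae {f g : PhaseL2 n} {c : ℝ} (h : ∀ᵐ z, ‖f z‖ ≤ c * ‖g z‖) :
    ‖f‖ ≤ c * ‖g‖ :=
  Lp.norm_le_mul_norm_of_ae_le_mul h

theorem norm_mulLp_le {ρ : PhaseSpace n → ℝ} (hρ : Continuous ρ) {M : ℝ}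
    (hM : ∀ z, |ρ z| ≤ M) (f : PhaseL2 n) : ‖mulLp ρ f‖ ≤ M * ‖f‖ := by
  refine norm_le_mul_norm_of_ae ?_
  filter_upwards [coeFn_mulLp hρ hM f] with z hz
  rw [hz, norm_mul, Complex.norm_real, Real.norm_eq_abs]
  exact mul_le_mul_of_nonneg_right (hM z) (norm_nonneg _)

theorem norm_mulLp_le_mul_norm_mulLp {ρ ρ' : PhaseSpace n → ℝ} (hρ : Continuous ρ)
    (hρ' : Continuous ρ') {M : ℝ} (hM : ∀ z, |ρ' z| ≤ M) {c : ℝ} (hc : 0 ≤ c)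
    (h : ∀ z, |ρ z| ≤ c * |ρ' z|) (f : PhaseL2 n) : ‖mulLp ρ f‖ ≤ c * ‖mulLp ρ' f‖ := by
  refine norm_le_mul_norm_of_ae ?_
  have hM' : ∀ z, |ρ z| ≤ c * M := fun z =>
    (h z).trans (mul_le_mul_of_nonneg_left (hM z) hc)
  filter_upwards [coeFn_mulLp hρ hM' f, coeFn_mulLp hρ' hM f] with z hz hz'
  rw [hz, hz', norm_mul, norm_mul, Complex.norm_real, Complex.norm_real, Real.norm_eq_abs,
    Real.norm_eq_abs, ← mul_assoc]
  exact mul_le_mul_of_nonneg_right (h z) (norm_nonneg _)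

theorem integral_mulLp_mul {ρ : PhaseSpace n → ℝ} (hρ : Continuous ρ) {M : ℝ}
    (hM : ∀ z, |ρ z| ≤ M) (f : PhaseL2 n) (φ : PhaseSpace n → ℂ) :
    ∫ z, mulLp ρ f z * φ z = ∫ z, f z * (ρ z * φ z) := by
  refine integral_congr_ae ?_
  filter_upwards [coeFn_mulLp hρ hM f] with z hz
  rw [hz]
  ring

end ConstantCoefficient

/-! ### Differences of symbols, and Young's inequality. -/

section SymbolEstimates

open Set Filter Topology PhaseSpace
open scoped ENNReal

section SymbolInequality

/-- If d ≤ θy, then x lies between (1 - θ)y and (1 + θ)y, and continuity of the power at 1 yields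
the small factor ε. Otherwise y < d/θ, and both powers are bounded by a multiple of d^p. The small
factor is what allows commutators to be absorbed; for p > 1 no bound by d^p alone is possible. -/
theorem exists_abs_rpow_sub_rpow_le {p : ℝ} (hp : 0 < p) {ε : ℝ} (hε : 0 < ε) :
    ∃ C : ℝ, 0 ≤ C ∧ ∀ x y d : ℝ, 0 ≤ x → 0 ≤ y → |x - y| ≤ d →
      |x ^ p - y ^ p| ≤ ε * y ^ p + C * d ^ p := by
  have c1 : Tendsto (fun θ : ℝ => (1 + θ) ^ p) (𝓝 0) (𝓝 1) := by
    have : Continuous fun θ : ℝ => (1 + θ) ^ p :=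
      Continuous.rpow_const (by fun_prop) fun _ => Or.inr hp.le
    simpa using this.tendsto 0
  have c2 : Tendsto (fun θ : ℝ => (1 - θ) ^ p) (𝓝 0) (𝓝 1) := by
    have : Continuous fun θ : ℝ => (1 - θ) ^ p :=
      Continuous.rpow_const (by fun_prop) fun _ => Or.inr hp.le
    simpa using this.tendsto 0
  have h1 := c1.eventually_lt_const (show (1 : ℝ) < 1 + ε by linarith)
  have h2 := c2.eventually_const_lt (show (1 - ε : ℝ) < 1 by linarith)
  have h3 : ∀ᶠ θ in 𝓝 (0 : ℝ), θ < 1 := eventually_lt_nhds one_pos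
  obtain ⟨θ, ⟨⟨hθ1, hθ2⟩, hθ3⟩, hθ0⟩ :=
    ((((h1.and h2).and h3).filter_mono nhdsWithin_le_nhds).and
      (self_mem_nhdsWithin : Ioi (0 : ℝ) ∈ 𝓝[>] 0)).exists
  refine ⟨(1 + 1 / θ) ^ p, by positivity, fun x y d hx hy hd => ?_⟩
  obtain ⟨hd1, hd2⟩ := abs_le.1 hd
  have hd0 : 0 ≤ d := (abs_nonneg _).trans hd
  rcases le_or_gt d (θ * y) with h | h
  · have hC : 0 ≤ (1 + 1 / θ) ^ p * d ^ p := by positivity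
    have hyp : 0 ≤ y ^ p := by positivity
    have u1 : x ^ p ≤ (1 + θ) ^ p * y ^ p := by
      rw [← Real.mul_rpow (by linarith) hy]
      exact Real.rpow_le_rpow hx (by linarith) hp.le
    have u2 : (1 - θ) ^ p * y ^ p ≤ x ^ p := by
      rw [← Real.mul_rpow (by linarith) hy]
      exact Real.rpow_le_rpow (mul_nonneg (by linarith) hy) (by linarith) hp.le
    have u3 := mul_le_mul_of_nonneg_right hθ1.le hyp
    have u4 := mul_le_mul_of_nonneg_right hθ2.le hyp
    rw [abs_le]
    constructor <;> nlinarith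
  · have hy' : y ≤ 1 / θ * d := by
      rw [one_div, ← div_eq_inv_mul, le_div_iff₀ hθ0]
      linarith
    have u1 : x ^ p ≤ (1 + 1 / θ) ^ p * d ^ p := by
      rw [← Real.mul_rpow (by positivity) hd0]
      exact Real.rpow_le_rpow hx (by linarith) hp.le
    have u2 : y ^ p ≤ (1 + 1 / θ) ^ p * d ^ p := by
      rw [← Real.mul_rpow (by positivity) hd0]
      exact Real.rpow_le_rpow hy (by linarith) hp.le
    have hxp : 0 ≤ x ^ p := by positivity
    have hyp : 0 ≤ y ^ p := by positivity
    have := mul_nonneg hε.le hyp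
    rw [abs_le]
    constructor <;> linarith

variable {n : ℕ}

theorem exists_abs_symbolDv_sub_le {p : ℝ} (hp : 0 < p) {ε : ℝ} (hε : 0 < ε) :
    ∃ C : ℝ, 0 ≤ C ∧ ∀ y z : PhaseSpace n,
      |symbolDv p y - symbolDv p z| ≤ ε * symbolDv p z + C * symbolDv p (y - z) := by
  obtain ⟨C, hC, h⟩ := exists_abs_rpow_sub_rpow_le hp hε
  refine ⟨C, hC, fun y z => h _ _ _ (by positivity) (by positivity) ?_⟩
  rw [← mul_sub, abs_mul, abs_of_pos (by positivity : 0 < 2 * Real.pi), vPart_sub]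
  gcongr
  exact abs_norm_sub_norm_le _ _

/-- The bounded regularization `|D_v|^p / (1 + r|D_v|^p)` of the symbol `|D_v|^p`. -/
noncomputable def dampedSymbol (p r : ℝ) (z : PhaseSpace n) : ℝ :=
  symbolDv p z / (1 + r * symbolDv p z)

theorem symbolDv_sub_comm (p : ℝ) (y z : PhaseSpace n) :
    symbolDv p (y - z) = symbolDv p (z - y) := by
  rw [← symbolDv_neg, neg_sub]

/-- The constant does not depend on r. The first difference is the kernel factor of the commutator
with the regularized multiplier; the second is that of the commutator with |D_v|^p, divided by 1 +
r|D_v|^p. -/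
theorem exists_abs_dampedSymbol_sub_le {p : ℝ} (hp : 0 < p) {ε : ℝ} (hε : 0 < ε) :
    ∃ C : ℝ, 0 ≤ C ∧ ∀ r : ℝ, 0 ≤ r → ∀ y z : PhaseSpace n,
      |dampedSymbol p r y - dampedSymbol p r z|
          ≤ ε * dampedSymbol p r z + C * symbolDv p (y - z) ∧
      |(symbolDv p y - symbolDv p z) / (1 + r * symbolDv p y)|
          ≤ ε * dampedSymbol p r z + C * symbolDv p (y - z) := by
  obtain ⟨C, hC, h⟩ := exists_abs_symbolDv_sub_le (n := n) hp hε
  refine ⟨C, hC, fun r hr y z => ?_⟩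
  have h1 := h y z
  have h2 := h z y
  rw [abs_sub_comm, symbolDv_sub_comm p z y] at h2
  unfold dampedSymbol
  have hD := symbolDv_nonneg p (y - z)
  have hX := symbolDv_nonneg p y
  have hY := symbolDv_nonneg p z
  set X := symbolDv p y
  set Y := symbolDv p z
  set D := symbolDv p (y - z)
  have hrX : 1 ≤ 1 + r * X := by nlinarith
  have hrY : 1 ≤ 1 + r * Y := by nlinarith
  have hCD : 0 ≤ C * D := mul_nonneg hC hD
  have key : |X - Y| / (1 + r * Y) ≤ ε * (Y / (1 + r * Y)) + C * D := by
    rw [div_le_iff₀ (by linarith), add_mul, mul_assoc, div_mul_cancel₀ _ (by linarith)]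
    exact h1.trans (by nlinarith)
  constructor
  · have e : X / (1 + r * X) - Y / (1 + r * Y) = (X - Y) / ((1 + r * Y) * (1 + r * X)) := by
      rw [div_sub_div _ _ (by linarith) (by linarith), mul_comm (1 + r * Y)]
      ring
    rw [e, abs_div, abs_of_pos (by nlinarith : 0 < (1 + r * Y) * (1 + r * X))]
    refine le_trans ?_ key
    gcongr
    nlinarith
  · rw [abs_div, abs_of_pos (by linarith : 0 < 1 + r * X)]
    -- If Y ≤ X, the larger denominator helps. Otherwise the difference is measured against X
    -- instead of Y, and t/(1 + rt) is increasing.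
    rcases le_total Y X with hXY | hXY
    · refine le_trans ?_ key
      gcongr
    · have m : X / (1 + r * X) ≤ Y / (1 + r * Y) := by
        rw [div_le_div_iff₀ (by linarith) (by linarith)]
        nlinarith
      calc |X - Y| / (1 + r * X) ≤ ε * (X / (1 + r * X)) + C * D := by
            rw [div_le_iff₀ (by linarith), add_mul, mul_assoc, div_mul_cancel₀ _ (by linarith)]
            exact h2.trans (by nlinarith)
        _ ≤ _ := by gcongr

theorem dampedSymbol_nonneg {r : ℝ} (hr : 0 ≤ r) (p : ℝ) (z : PhaseSpace n) :
    0 ≤ dampedSymbol p r z := by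
  have := symbolDv_nonneg p z
  unfold dampedSymbol
  positivity

theorem abs_dampedSymbol_le {r : ℝ} (hr : 0 < r) (p : ℝ) (z : PhaseSpace n) :
    |dampedSymbol p r z| ≤ 1 / r := by
  have := symbolDv_nonneg p z
  rw [abs_of_nonneg (dampedSymbol_nonneg hr.le p z), dampedSymbol,
    div_le_div_iff₀ (by positivity) hr]
  linarith

theorem continuous_dampedSymbol {p r : ℝ} (hp : 0 < p) (hr : 0 ≤ r) :
    Continuous (dampedSymbol (n := n) p r) := by
  have hw := continuous_symbolDv (n := n) hp
  refine hw.div (by fun_prop) fun z => ?_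
  have := symbolDv_nonneg p z
  positivity

end SymbolInequality

section Young

variable {V : Type*} [NormedAddCommGroup V] [InnerProductSpace ℝ V] [FiniteDimensional ℝ V]
  [MeasurableSpace V] [BorelSpace V]

theorem eLpNorm_two_eq {E : Type*} [ENorm E] (g : V → E) :
    eLpNorm g 2 volume = (∫⁻ z, ‖g z‖ₑ ^ 2) ^ (1 / 2 : ℝ) := by
  rw [eLpNorm_eq_lintegral_rpow_enorm_toReal (by simp) (by simp)]
  simp

/-- Young's inequality for the convolution of `L¹` and `L²`. -/
theorem eLpNorm_lintegral_mul_le {k h : V → ℝ≥0∞} (hk : Measurable k) (hh : Measurable h) :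
    eLpNorm (fun z => ∫⁻ y, k (z - y) * h y) 2 volume
      ≤ (∫⁻ z, k z) * eLpNorm h 2 volume := by
  have e : ∀ z, ∫⁻ y, k (z - y) * h y = ∫⁻ s, k s * h (z - s) := fun z => by
    rw [← lintegral_sub_left_eq_self _ z]
    simp
  -- Schur's test for translations, with a kernel that does not depend on the base point.
  have hs := lintegral_sq_lintegral_comp_le (ν := (volume : Measure V)) (μ := (volume : Measure V))
    (T := fun s z => z - s) (measurable_snd.sub measurable_fst)
    (fun s => measurePreserving_sub_right volume s) (K := fun s _ => k s) (K' := fun s _ => k s)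
    (hk.comp measurable_fst) (hk.comp measurable_fst) (fun _ _ => rfl)
    (fun _ => le_rfl) (fun _ => le_rfl) hh
  rw [eLpNorm_two_eq, eLpNorm_two_eq]
  simp only [e, enorm_eq_self]
  refine (ENNReal.rpow_le_rpow hs (by norm_num)).trans ?_
  rw [ENNReal.mul_rpow_of_nonneg _ _ (by norm_num), ← sq, ← ENNReal.rpow_two,
    ← ENNReal.rpow_mul]
  norm_num

end Young

end SymbolEstimates

/-! ### Integral operators of commutator type. -/

section KernelOperators

open Set Filter Topology PhaseSpace
open scoped ENNReal

variable {n : ℕ}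

/-- The integral operator with kernel `S (z - y) κ(z, y)`. -/
noncomputable def kernelOp (S : 𝓢(PhaseSpace n, ℂ)) (κ : PhaseSpace n → PhaseSpace n → ℝ)
    (F : PhaseSpace n → ℂ) (z : PhaseSpace n) : ℂ :=
  ∫ y, S (z - y) * κ z y * F y

theorem stronglyMeasurable_kernel (S : 𝓢(PhaseSpace n, ℂ)) {κ : PhaseSpace n → PhaseSpace n → ℝ}
    (hκ : Continuous (Function.uncurry κ)) (F : PhaseL2 n) :
    StronglyMeasurable fun x : PhaseSpace n × PhaseSpace n =>
      S (x.1 - x.2) * κ x.1 x.2 * F x.2 := by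
  have h1 : Continuous fun x : PhaseSpace n × PhaseSpace n => S (x.1 - x.2) * (κ x.1 x.2 : ℂ) :=
    (S.continuous.comp (by fun_prop)).mul (Complex.continuous_ofReal.comp hκ)
  exact h1.stronglyMeasurable.mul ((Lp.stronglyMeasurable F).comp_measurable measurable_snd)

theorem enorm_symbolDv_mul (p : ℝ) (S : 𝓢(PhaseSpace n, ℂ)) (z : PhaseSpace n) :
    ‖(symbolDv p z : ℂ) * S z‖ₑ = ENNReal.ofReal (symbolDv p z) * ‖S z‖ₑ := by
  rw [enorm_mul, ← ofReal_norm (symbolDv p z : ℂ), Complex.norm_real,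
    Real.norm_of_nonneg (symbolDv_nonneg p z)]

/-- The bound on κ splits the operator into two convolutions, of ε|S| with |mF| and of C|wS| with
|F|; Young's inequality applies to each. This turns an inequality between symbols into an operator
estimate. -/
theorem exists_kernelOp {p : ℝ} (hp : 0 < p) (hp2 : p ≤ 2) (S : 𝓢(PhaseSpace n, ℂ))
    {κ : PhaseSpace n → PhaseSpace n → ℝ} (hκ : Continuous (Function.uncurry κ))
    {m : PhaseSpace n → ℝ} (hm : ∀ z, 0 ≤ m z) {F V : PhaseL2 n}
    (hV : V =ᵐ[volume] fun z => (m z : ℂ) * F z) {ε C : ℝ} (hε : 0 ≤ ε) (hC : 0 ≤ C)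
    (hb : ∀ z y, |κ z y| ≤ ε * m y + C * symbolDv p (z - y)) :
    ∃ Q : PhaseL2 n, Q =ᵐ[volume] kernelOp S κ F ∧
      ‖Q‖ ≤ ε * (∫ z, ‖S z‖) * ‖V‖ + C * (∫ z, ‖(symbolDv p z : ℂ) * S z‖) * ‖F‖ := by
  have hw := continuous_symbolDv (n := n) hp
  have hS := S.continuous
  set k₁ : PhaseSpace n → ℝ≥0∞ := fun z => ENNReal.ofReal ε * ‖S z‖ₑ with hk₁
  set k₂ : PhaseSpace n → ℝ≥0∞ := fun z => ENNReal.ofReal C * ‖(symbolDv p z : ℂ) * S z‖ₑ with hk₂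
  have hk₁m : Measurable k₁ := by
    have : Measurable fun z => ‖S z‖ₑ := hS.measurable.enorm
    fun_prop
  have hk₂m : Measurable k₂ := by
    have : Measurable fun z => ‖(symbolDv p z : ℂ) * S z‖ₑ :=
      ((Complex.continuous_ofReal.comp hw).mul hS).measurable.enorm
    fun_prop
  have hVm := (Lp.stronglyMeasurable V).measurable.enorm
  have hFm := (Lp.stronglyMeasurable F).measurable.enorm
  set g₁ : PhaseSpace n → ℝ≥0∞ := fun z => ∫⁻ y, k₁ (z - y) * ‖V y‖ₑ with hg₁
  set g₂ : PhaseSpace n → ℝ≥0∞ := fun z => ∫⁻ y, k₂ (z - y) * ‖F y‖ₑ with hg₂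
  have hg₁m : Measurable g₁ := by
    refine Measurable.lintegral_prod_right'
      (f := fun x : PhaseSpace n × PhaseSpace n => k₁ (x.1 - x.2) * ‖V x.2‖ₑ) ?_
    exact (hk₁m.comp (measurable_fst.sub measurable_snd)).mul (hVm.comp measurable_snd)
  have hg₂m : Measurable g₂ := by
    refine Measurable.lintegral_prod_right'
      (f := fun x : PhaseSpace n × PhaseSpace n => k₂ (x.1 - x.2) * ‖F x.2‖ₑ) ?_
    exact (hk₂m.comp (measurable_fst.sub measurable_snd)).mul (hFm.comp measurable_snd)
  have hpt : ∀ z, ‖kernelOp S κ F z‖ₑ ≤ ‖(g₁ + g₂) z‖ₑ := by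
    intro z
    rw [enorm_eq_self, Pi.add_apply, hg₁, hg₂, ← lintegral_add_left (by fun_prop)]
    refine (enorm_integral_le_lintegral_enorm _).trans (lintegral_mono_ae ?_)
    filter_upwards [hV] with y hy
    have e1 : ‖V y‖ₑ = ENNReal.ofReal (m y) * ‖F y‖ₑ := by
      rw [hy, enorm_mul, ← ofReal_norm (m y : ℂ), Complex.norm_real, Real.norm_of_nonneg (hm y)]
    have e2 : ‖(κ z y : ℂ)‖ₑ ≤ ENNReal.ofReal ε * ENNReal.ofReal (m y)
        + ENNReal.ofReal C * ENNReal.ofReal (symbolDv p (z - y)) := by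
      have := symbolDv_nonneg p (z - y)
      have := hm y
      rw [← ofReal_norm, Complex.norm_real, Real.norm_eq_abs, ← ENNReal.ofReal_mul hε,
        ← ENNReal.ofReal_mul hC, ← ENNReal.ofReal_add (by positivity) (by positivity)]
      exact ENNReal.ofReal_le_ofReal (hb z y)
    rw [enorm_mul, enorm_mul, e1, hk₁, hk₂]
    simp only [enorm_symbolDv_mul]
    calc ‖S (z - y)‖ₑ * ‖(κ z y : ℂ)‖ₑ * ‖F y‖ₑ
        ≤ ‖S (z - y)‖ₑ * (ENNReal.ofReal ε * ENNReal.ofReal (m y)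
          + ENNReal.ofReal C * ENNReal.ofReal (symbolDv p (z - y))) * ‖F y‖ₑ := by gcongr
      _ = _ := by ring
  have hSi : ∫⁻ z, ‖S z‖ₑ = ENNReal.ofReal (∫ z, ‖S z‖) :=
    (ofReal_integral_norm_eq_lintegral_enorm S.integrable).symm
  have hwS : ∫⁻ z, ‖(symbolDv p z : ℂ) * S z‖ₑ
      = ENNReal.ofReal (∫ z, ‖(symbolDv p z : ℂ) * S z‖) :=
    (ofReal_integral_norm_eq_lintegral_enorm
      (memLp_one_iff_integrable.1 (memLp_symbolDv_mul_schwartz hp hp2 1 S))).symm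
  have hnorm : ∀ U : PhaseL2 n, eLpNorm (fun y => ‖U y‖ₑ) 2 volume = ENNReal.ofReal ‖U‖ := by
    intro U
    rw [ofReal_norm, Lp.enorm_def]
    simp [eLpNorm_two_eq]
  have h0 : 0 ≤ ∫ z, ‖S z‖ := by positivity
  have h0' : 0 ≤ ∫ z, ‖(symbolDv p z : ℂ) * S z‖ := by positivity
  have hle : eLpNorm (kernelOp S κ F) 2 volume ≤ ENNReal.ofReal
      (ε * (∫ z, ‖S z‖) * ‖V‖ + C * (∫ z, ‖(symbolDv p z : ℂ) * S z‖) * ‖F‖) := by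
    refine (eLpNorm_mono_enorm hpt).trans ((eLpNorm_add_le hg₁m.aestronglyMeasurable
      hg₂m.aestronglyMeasurable one_le_two).trans ?_)
    rw [ENNReal.ofReal_add (by positivity) (by positivity)]
    refine add_le_add ?_ ?_
    · refine (eLpNorm_lintegral_mul_le hk₁m hVm).trans_eq ?_
      rw [hnorm, lintegral_const_mul' _ _ ENNReal.ofReal_ne_top, hSi,
        ENNReal.ofReal_mul (by positivity), ENNReal.ofReal_mul hε]
    · refine (eLpNorm_lintegral_mul_le hk₂m hFm).trans_eq ?_
      rw [hnorm, lintegral_const_mul' _ _ ENNReal.ofReal_ne_top, hwS,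
        ENNReal.ofReal_mul (by positivity), ENNReal.ofReal_mul hC]
  have hmem : MemLp (kernelOp S κ F) 2 volume :=
    ⟨((stronglyMeasurable_kernel S hκ F).integral_prod_right).aestronglyMeasurable,
      hle.trans_lt ENNReal.ofReal_lt_top⟩
  refine ⟨hmem.toLp _, hmem.coeFn_toLp, ?_⟩
  rw [Lp.norm_toLp]
  exact ENNReal.toReal_le_of_le_ofReal (by positivity) hle

/-- Fubini for kernels that may grow. The growth is charged to the test function through the weight
m, because F is merely in L². -/
theorem integrable_and_integral_kernelOp_mul {p : ℝ} (hp : 0 < p) (hp2 : p ≤ 2) (S : 𝓢(PhaseSpace n, ℂ))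
    {κ : PhaseSpace n → PhaseSpace n → ℝ} (hκ : Continuous (Function.uncurry κ))
    {m : PhaseSpace n → ℝ} {Φ : PhaseSpace n → ℂ}
    (hΦ : Continuous Φ) (hm : MemLp (fun z => (m z : ℂ) * Φ z) 2 volume)
    (hb : ∀ z y, |κ z y| ≤ m z * (1 + symbolDv p (z - y))) (F : PhaseL2 n) :
    Integrable (fun y => F y * ∫ z, S (z - y) * κ z y * Φ z) ∧
      ∫ z, kernelOp S κ F z * Φ z = ∫ y, F y * ∫ z, S (z - y) * κ z y * Φ z := by
  have hw := continuous_symbolDv (n := n) hp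
  have hS := S.continuous
  set k : PhaseSpace n → ℝ≥0∞ := fun z => ‖S z‖ₑ + ‖(symbolDv p z : ℂ) * S z‖ₑ with hk
  have hS1 : Measurable fun z => ‖S z‖ₑ := hS.measurable.enorm
  have hkm : Measurable k := by
    have h2 : Measurable fun z => ‖(symbolDv p z : ℂ) * S z‖ₑ :=
      ((Complex.continuous_ofReal.comp hw).mul hS).measurable.enorm
    exact hS1.add h2
  have hki : ∫⁻ z, k z ≠ ⊤ := by
    rw [hk, lintegral_add_left hS1]
    exact ENNReal.add_ne_top.2 ⟨(hasFiniteIntegral_iff_enorm.1 S.integrable.2).ne,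
      (hasFiniteIntegral_iff_enorm.1 (memLp_one_iff_integrable.1
        (memLp_symbolDv_mul_schwartz hp hp2 1 S)).2).ne⟩
  have hFm := (Lp.stronglyMeasurable F).measurable.enorm
  have hmeas : StronglyMeasurable fun x : PhaseSpace n × PhaseSpace n =>
      S (x.1 - x.2) * κ x.1 x.2 * F x.2 * Φ x.1 :=
    (stronglyMeasurable_kernel S hκ F).mul (hΦ.stronglyMeasurable.comp_measurable measurable_fst)
  have hYoung := eLpNorm_lintegral_mul_le hkm hFm
  have hfin : eLpNorm (fun z => ∫⁻ y, k (z - y) * ‖F y‖ₑ) 2 volume ≠ ⊤ := by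
    refine (hYoung.trans_lt (ENNReal.mul_lt_top hki.lt_top ?_)).ne
    have := (Lp.memLp F).eLpNorm_lt_top
    rw [eLpNorm_two_eq] at this ⊢
    simpa using this
  have hint : Integrable (fun x : PhaseSpace n × PhaseSpace n =>
      S (x.1 - x.2) * κ x.1 x.2 * F x.2 * Φ x.1) (volume.prod volume) := by
    refine ⟨hmeas.aestronglyMeasurable, ?_⟩
    rw [hasFiniteIntegral_iff_enorm, lintegral_prod _ hmeas.measurable.enorm.aemeasurable]
    calc _ ≤ ∫⁻ z, (∫⁻ y, k (z - y) * ‖F y‖ₑ) * ‖(m z : ℂ) * Φ z‖ₑ := by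
          refine lintegral_mono fun z => ?_
          rw [← lintegral_mul_const' _ _ enorm_ne_top]
          refine lintegral_mono fun y => ?_
          have hw0 := symbolDv_nonneg p (z - y)
          have hm0 : 0 ≤ m z := by
            by_contra! h
            have := (abs_nonneg _).trans (hb z y)
            nlinarith
          have e2 : ‖(κ z y : ℂ)‖ₑ ≤ ‖(m z : ℂ)‖ₑ
              * (1 + ENNReal.ofReal (symbolDv p (z - y))) := by
            rw [← ofReal_norm, ← ofReal_norm, Complex.norm_real, Complex.norm_real,
              Real.norm_eq_abs, Real.norm_of_nonneg hm0, ← ENNReal.ofReal_one,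
              ← ENNReal.ofReal_add zero_le_one hw0, ← ENNReal.ofReal_mul hm0]
            exact ENNReal.ofReal_le_ofReal (hb z y)
          simp only [enorm_mul, hk]
          have e3 : ‖(symbolDv p (z - y) : ℂ)‖ₑ = ENNReal.ofReal (symbolDv p (z - y)) := by
            rw [← ofReal_norm, Complex.norm_real, Real.norm_of_nonneg hw0]
          rw [e3]
          calc ‖S (z - y)‖ₑ * ‖(κ z y : ℂ)‖ₑ * ‖F y‖ₑ * ‖Φ z‖ₑ
              ≤ ‖S (z - y)‖ₑ * (‖(m z : ℂ)‖ₑ * (1 + ENNReal.ofReal (symbolDv p (z - y))))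
                * ‖F y‖ₑ * ‖Φ z‖ₑ := by gcongr
            _ = _ := by ring
      _ ≤ _ := ENNReal.lintegral_mul_le_Lp_mul_Lq _ Real.HolderConjugate.two_two
          (Measurable.lintegral_prod_right'
            (f := fun x : PhaseSpace n × PhaseSpace n => k (x.1 - x.2) * ‖F x.2‖ₑ)
            ((hkm.comp (measurable_fst.sub measurable_snd)).mul
              (hFm.comp measurable_snd))).aemeasurable hm.1.enorm
      _ < ⊤ := by
          have h2 := hm.2
          have h1 := hfin.lt_top
          rw [eLpNorm_two_eq] at h1 h2
          simp only [enorm_eq_self] at h1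
          simp only [ENNReal.rpow_two]
          exact ENNReal.mul_lt_top h1 h2
  have hin : ∀ y, ∫ z, S (z - y) * κ z y * F y * Φ z
      = F y * ∫ z, S (z - y) * κ z y * Φ z := fun y => by
    rw [← integral_const_mul]
    congr 1
    ext z
    ring
  refine ⟨hint.integral_prod_right.congr (ae_of_all _ hin), ?_⟩
  calc _ = ∫ z, ∫ y, S (z - y) * κ z y * F y * Φ z := by
        simp only [kernelOp, integral_mul_const]
    _ = ∫ y, ∫ z, S (z - y) * κ z y * F y * Φ z := integral_integral_swap hint
    _ = _ := by simp only [hin]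

end KernelOperators

/-! ### Multiplication by coefficients as convolution, and the regularized multiplier. -/

section Coefficients

open Set Filter Topology PhaseSpace
open scoped ENNReal

variable {n : ℕ}

/-- A smooth function that is equal to the constant `c` outside a compact set. -/
structure IsCoefficient (ρ : PhaseSpace n → ℝ) (c : ℝ) : Prop where
  contDiff : ContDiff ℝ ∞ ρ
  hasCompactSupport : HasCompactSupport fun z => ρ z - c

namespace IsCoefficient

variable {ρ ρ' : PhaseSpace n → ℝ} {c c' : ℝ}

theorem continuous (h : IsCoefficient ρ c) : Continuous ρ := h.contDiff.continuous

theorem exists_abs_le (h : IsCoefficient ρ c) : ∃ M, ∀ z, |ρ z| ≤ M := by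
  obtain ⟨M, hM⟩ := h.hasCompactSupport.exists_bound_of_continuous (by
    have := h.continuous
    fun_prop)
  refine ⟨M + |c|, fun z => ?_⟩
  have := abs_add_le (ρ z - c) c
  rw [sub_add_cancel] at this
  exact this.trans (add_le_add_left (hM z) _)

theorem comp (h : IsCoefficient ρ c) {g : ℝ → ℝ} (hg : ContDiff ℝ ∞ g) :
    IsCoefficient (fun z => g (ρ z)) (g c) := by
  refine ⟨hg.comp h.contDiff, h.hasCompactSupport.mono' ?_⟩
  intro z hz
  refine subset_tsupport _ ?_
  rw [Function.mem_support] at hz ⊢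
  intro h0
  exact hz (by rw [sub_eq_zero.1 h0, sub_self])

theorem mul (h : IsCoefficient ρ c) (h' : IsCoefficient ρ' c') :
    IsCoefficient (fun z => ρ z * ρ' z) (c * c') := by
  refine ⟨h.contDiff.mul h'.contDiff, ?_⟩
  have e : (fun z => ρ z * ρ' z - c * c') = (fun z => (ρ z - c) * ρ' z)
      + fun z => c * (ρ' z - c') := by
    ext z
    simp only [Pi.add_apply]
    ring
  rw [e]
  exact h.hasCompactSupport.mul_right.add h'.hasCompactSupport.mul_left

theorem hasTemperateGrowth (h : IsCoefficient ρ c) : ρ.HasTemperateGrowth := by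
  have h1 : (fun z => ρ z - c).HasTemperateGrowth :=
    h.hasCompactSupport.hasTemperateGrowth (h.contDiff.sub contDiff_const)
  have h2 := h1.add (Function.HasTemperateGrowth.const c)
  convert h2 using 1
  ext z
  simp

/-- The Fourier transform of the variable part of a coefficient. -/
noncomputable def kernel (h : IsCoefficient ρ c) : 𝓢(PhaseSpace n, ℂ) :=
  𝓕 (HasCompactSupport.toSchwartzMap (f := fun z => ((ρ z - c : ℝ) : ℂ))
    (h.hasCompactSupport.comp_left Complex.ofReal_zero)
    (Complex.ofRealCLM.contDiff.comp (h.contDiff.sub contDiff_const)))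

/-- The compactly supported part ρ - c acts by convolution with a Schwartz function, and the
constant c acts as itself. -/
theorem fourierInv_smul_fourier (h : IsCoefficient ρ c) (Φ : 𝓢(PhaseSpace n, ℂ))
    (y : PhaseSpace n) :
    (𝓕⁻ (smulLeftCLM ℂ ρ (𝓕 Φ)) : 𝓢(PhaseSpace n, ℂ)) y
      = c * Φ y + ∫ z, h.kernel (z - y) * Φ z := by
  set σ : 𝓢(PhaseSpace n, ℂ) := HasCompactSupport.toSchwartzMap (f := fun z => ((ρ z - c : ℝ) : ℂ))
    (h.hasCompactSupport.comp_left Complex.ofReal_zero)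
    (Complex.ofRealCLM.contDiff.comp (h.contDiff.sub contDiff_const)) with hσ
  have hσe : ∀ z, σ z = ((ρ z - c : ℝ) : ℂ) := fun z => rfl
  have hk : ∀ z, h.kernel z = (𝓕⁻ σ : 𝓢(PhaseSpace n, ℂ)) (-z) := by
    intro z
    change (𝓕 σ : 𝓢(PhaseSpace n, ℂ)) z = _
    rw [SchwartzMap.fourier_coe, SchwartzMap.fourierInv_coe, Real.fourierInv_eq_fourier_neg,
      neg_neg]
  have e1 : (smulLeftCLM ℂ ρ (𝓕 Φ) : 𝓢(PhaseSpace n, ℂ))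
      = 𝓕 ((c : ℂ) • Φ + SchwartzMap.convolution (ContinuousLinearMap.mul ℂ ℂ) (𝓕⁻ σ) Φ) := by
    rw [FourierTransform.fourier_add, FourierTransform.fourier_smul, fourier_convolution,
      fourier_fourierInv]
    ext z
    rw [smulLeftCLM_apply_apply h.hasTemperateGrowth]
    simp only [add_apply, smul_apply, pairing_apply_apply, ContinuousLinearMap.mul_apply', hσe,
      smul_eq_mul, Complex.real_smul]
    push_cast
    ring
  rw [e1, FourierTransform.fourierInv_fourier_eq, add_apply, smul_apply, smul_eq_mul,
    convolution_apply, convolution_eq_swap]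
  congr 1
  refine integral_congr_ae (ae_of_all _ fun z => ?_)
  simp only [ContinuousLinearMap.mul_apply', hk, neg_sub]

theorem integral_mulLp_mul_fourier (h : IsCoefficient ρ c) (f : PhaseL2 n)
    (Φ : 𝓢(PhaseSpace n, ℂ)) :
    ∫ z, mulLp ρ f z * (𝓕 Φ : 𝓢(PhaseSpace n, ℂ)) z
      = ∫ z, (𝓕 f : PhaseL2 n) z * (𝓕⁻ (smulLeftCLM ℂ ρ (𝓕 Φ)) : 𝓢(PhaseSpace n, ℂ)) z := by
  obtain ⟨M, hM⟩ := h.exists_abs_le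
  rw [integral_mulLp_mul h.continuous hM, integral_fourier_mul_schwartz, fourier_fourierInv]
  simp only [smulLeftCLM_apply_apply h.hasTemperateGrowth, Complex.real_smul]

theorem integrable_kernel_mul (S : 𝓢(PhaseSpace n, ℂ)) {g : PhaseSpace n → ℂ}
    (hg : MemLp g 2 volume) (z : PhaseSpace n) : Integrable fun y => S (z - y) * g y := by
  have h1 : MemLp (fun y => S (z - y)) 2 volume :=
    (S.memLp 2 volume).comp_measurePreserving (Measure.measurePreserving_sub_left volume z)
  exact h1.integrable_mul hg

theorem integrable_kernel_mul' (S : 𝓢(PhaseSpace n, ℂ)) {g : PhaseSpace n → ℂ}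
    (hg : MemLp g 2 volume) (y : PhaseSpace n) : Integrable fun z => S (z - y) * g z := by
  have h1 : MemLp (fun z => S (z - y)) 2 volume :=
    (S.memLp 2 volume).comp_measurePreserving (measurePreserving_sub_right volume y)
  exact h1.integrable_mul hg

/-- The Fourier transform takes products to convolutions. -/
theorem fourier_mulLp_ae_eq (h : IsCoefficient ρ c) (f : PhaseL2 n) :
    (𝓕 (mulLp ρ f) : PhaseL2 n) =ᵐ[volume] fun z =>
      c * (𝓕 f : PhaseL2 n) z + kernelOp h.kernel (fun _ _ => 1) (𝓕 f : PhaseL2 n) z := by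
  set F : PhaseL2 n := 𝓕 f with hF
  -- The kernel factor is 1 and C = 0, so the exponent plays no role; any admissible value would do.
  obtain ⟨Q, hQ, -⟩ := exists_kernelOp (p := 1) one_pos one_le_two h.kernel
    (κ := fun _ _ => 1) (by fun_prop) (m := fun _ => 1) (fun _ => zero_le_one) (F := F) (V := F)
    (ae_of_all _ fun z => by simp) (ε := 1) (C := 0) zero_le_one le_rfl (fun z y => by simp)
  have hQ' : (fun z => c * F z + kernelOp h.kernel (fun _ _ => 1) F z) =ᵐ[volume]
      ((c : ℂ) • F + Q : PhaseL2 n) := by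
    filter_upwards [hQ, Lp.coeFn_add ((c : ℂ) • F) Q, Lp.coeFn_smul (c : ℂ) F] with z h1 h2 h3
    rw [h2, Pi.add_apply, h3, Pi.smul_apply, h1, smul_eq_mul]
  refine EventuallyEq.trans ?_ hQ'.symm
  refine ae_eq_of_integral_contDiff_smul_eq ((Lp.memLp _).locallyIntegrable one_le_two)
    ((Lp.memLp _).locallyIntegrable one_le_two) fun Φ hΦ hΦc => ?_
  have hΦ' : ContDiff ℝ ∞ fun z => (Φ z : ℂ) := Complex.ofRealCLM.contDiff.comp hΦ
  have hΦc' : HasCompactSupport fun z => (Φ z : ℂ) := hΦc.comp_left Complex.ofReal_zero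
  set Ψ : 𝓢(PhaseSpace n, ℂ) := hΦc'.toSchwartzMap hΦ' with hΨ
  have hΨe : ∀ z, Ψ z = (Φ z : ℂ) := fun z => rfl
  obtain ⟨i1, i2⟩ := integrable_and_integral_kernelOp_mul (p := 1) one_pos one_le_two h.kernel
    (κ := fun _ _ => 1) (by fun_prop) (m := fun _ => 1) (Φ := Ψ) Ψ.continuous
    (by simpa using Ψ.memLp 2 volume)
    (fun z y => by simpa using symbolDv_nonneg 1 (z - y)) F
  have j1 : Integrable fun z => kernelOp h.kernel (fun _ _ => 1) F z * Ψ z :=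
    (integrable_mul_schwartz Q Ψ).congr (by filter_upwards [hQ] with z hz; rw [hz])
  calc _ = ∫ z, (𝓕 (mulLp ρ f) : PhaseL2 n) z * Ψ z := by
        refine integral_congr_ae (ae_of_all _ fun z => ?_)
        simp only [hΨe, Complex.real_smul, mul_comm]
    _ = ∫ z, F z * (c * Ψ z + ∫ w, h.kernel (w - z) * Ψ w) := by
        rw [integral_fourier_mul_schwartz, h.integral_mulLp_mul_fourier]
        simp only [h.fourierInv_smul_fourier, hF]
    _ = (∫ z, c * (F z * Ψ z)) + ∫ z, F z * ∫ w, h.kernel (w - z) * ((1 : ℝ) : ℂ) * Ψ w := by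
        rw [← integral_add ((integrable_mul_schwartz F Ψ).const_mul _) i1]
        refine integral_congr_ae (ae_of_all _ fun z => ?_)
        simp only [Complex.ofReal_one, mul_one]
        ring
    _ = ∫ z, (c * F z + kernelOp h.kernel (fun _ _ => 1) F z) * Ψ z := by
        rw [← i2, ← integral_add ((integrable_mul_schwartz F Ψ).const_mul _) j1]
        refine integral_congr_ae (ae_of_all _ fun z => ?_)
        simp only
        ring
    _ = _ := by
        refine integral_congr_ae ?_
        filter_upwards [hQ'] with z hz
        rw [← hz]
        simp only [hΨe, Complex.real_smul, mul_comm]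

end IsCoefficient

/-- The regularization `|D_v|^p (1 + r|D_v|^p)⁻¹ f` of `|D_v|^p f`. -/
noncomputable def dampedMult (p r : ℝ) (f : PhaseL2 n) : PhaseL2 n :=
  𝓕⁻ (mulLp (dampedSymbol p r) (𝓕 f : PhaseL2 n))

theorem fourier_dampedMult (p r : ℝ) (f : PhaseL2 n) :
    (𝓕 (dampedMult p r f) : PhaseL2 n) = mulLp (dampedSymbol p r) (𝓕 f : PhaseL2 n) :=
  FourierTransform.fourier_fourierInv_eq _

theorem norm_dampedMult (p r : ℝ) (f : PhaseL2 n) :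
    ‖dampedMult p r f‖ = ‖mulLp (dampedSymbol p r) (𝓕 f : PhaseL2 n)‖ := by
  rw [← Lp.norm_fourier_eq, fourier_dampedMult]

/-- On the Fourier side the commutator has the kernel S(z - y)(m_r(z) - m_r(y)), with S the
transform of ρ - c and m_r the regularized symbol. The constant c commutes with the multiplier and
cancels. -/
theorem IsCoefficient.exists_norm_commutator_le {ρ : PhaseSpace n → ℝ} {c : ℝ}
    (h : IsCoefficient ρ c) {p : ℝ} (hp : 0 < p) (hp2 : p ≤ 2) {ε : ℝ} (hε : 0 < ε) :
    ∃ K : ℝ, 0 ≤ K ∧ ∀ (r : ℝ) (f : PhaseL2 n), 0 < r →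
      ‖dampedMult p r (mulLp ρ f) - mulLp ρ (dampedMult p r f)‖
        ≤ ε * ‖dampedMult p r f‖ + K * ‖f‖ := by
  have hS0 : 0 ≤ ∫ z, ‖h.kernel z‖ := by positivity
  set s := ∫ z, ‖h.kernel z‖ with hs
  obtain ⟨C, hC, hb⟩ := exists_abs_dampedSymbol_sub_le (n := n) hp
    -- The operator bound multiplies this by the L¹ norm s of the kernel, which may be zero; the
    -- added 1 avoids dividing by it.
    (ε := ε / (s + 1)) (by positivity)
  refine ⟨C * ∫ z, ‖(symbolDv p z : ℂ) * h.kernel z‖, by positivity, fun r f hr => ?_⟩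
  have hdc := continuous_dampedSymbol (n := n) hp hr.le
  have hV := coeFn_mulLp hdc (abs_dampedSymbol_le hr p) (𝓕 f : PhaseL2 n)
  obtain ⟨Q, hQ, hQn⟩ := exists_kernelOp hp hp2 h.kernel
    (κ := fun z y => dampedSymbol p r z - dampedSymbol p r y) (by
      exact (hdc.comp continuous_fst).sub (hdc.comp continuous_snd))
    (dampedSymbol_nonneg hr.le p) hV (ε := ε / (s + 1)) (C := C) (by positivity) hC
    (fun z y => (hb r hr.le z y).1)
  have hdiff : (𝓕 (dampedMult p r (mulLp ρ f) - mulLp ρ (dampedMult p r f)) : PhaseL2 n) = Q := by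
    have hsub : ∀ u v : PhaseL2 n, (𝓕 (u - v) : PhaseL2 n) = 𝓕 u - 𝓕 v :=
      (Lp.fourierTransformₗᵢ (PhaseSpace n) ℂ).map_sub
    rw [hsub, fourier_dampedMult]
    refine Lp.ext ?_
    refine (Lp.coeFn_sub _ _).trans ?_
    filter_upwards [coeFn_mulLp hdc (abs_dampedSymbol_le hr p) (𝓕 (mulLp ρ f) : PhaseL2 n),
      h.fourier_mulLp_ae_eq f, h.fourier_mulLp_ae_eq (dampedMult p r f), hV, hQ]
      with z h1 h2 h3 h4 h5
    rw [Pi.sub_apply, h1, h2, h3, h5, fourier_dampedMult, h4]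
    have e1 : kernelOp h.kernel (fun _ _ => 1)
        (mulLp (dampedSymbol p r) (𝓕 f : PhaseL2 n)) z
        = ∫ y, h.kernel (z - y) * (dampedSymbol p r y * (𝓕 f : PhaseL2 n) y) := by
      refine integral_congr_ae ?_
      filter_upwards [hV] with y hy
      rw [hy, Complex.ofReal_one, mul_one]
    have e2 : (dampedSymbol p r z : ℂ) * kernelOp h.kernel (fun _ _ => 1) (𝓕 f : PhaseL2 n) z
        = ∫ y, dampedSymbol p r z * (h.kernel (z - y) * (𝓕 f : PhaseL2 n) y) := by
      rw [kernelOp, ← integral_const_mul]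
      simp only [Complex.ofReal_one, mul_one]
    have e3 : kernelOp h.kernel (fun z y => dampedSymbol p r z - dampedSymbol p r y)
        (𝓕 f : PhaseL2 n) z
        = (∫ y, dampedSymbol p r z * (h.kernel (z - y) * (𝓕 f : PhaseL2 n) y))
          - ∫ y, h.kernel (z - y) * (dampedSymbol p r y * (𝓕 f : PhaseL2 n) y) := by
      rw [← integral_sub ((IsCoefficient.integrable_kernel_mul _ (Lp.memLp _) z).const_mul _)
        (IsCoefficient.integrable_kernel_mul _ (memLp_mul_of_bounded hdc
          (abs_dampedSymbol_le hr p) _) z), kernelOp]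
      refine integral_congr_ae (ae_of_all _ fun y => ?_)
      simp only
      push_cast
      ring
    rw [e1, e3, mul_add, e2]
    ring
  rw [← Lp.norm_fourier_eq, hdiff, norm_dampedMult]
  rw [Lp.norm_fourier_eq] at hQn
  refine hQn.trans (add_le_add_left (mul_le_mul_of_nonneg_right ?_ (norm_nonneg _)) _)
  rw [div_mul_eq_mul_div, div_le_iff₀ (by positivity)]
  nlinarith

end Coefficients

/-! ### Commutators with |D_v|^p and with the transport. -/

section Commutators

open Set Filter Topology PhaseSpace
open scoped ENNReal

variable {n : ℕ}

/-- The commutator of |D_v|^p with ρ, applied to f, is not known to be in L². Dividing its kernel by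
1 + r w(z) gives an L² function P that is bounded uniformly in r, and the factor is restored only
under the integral against Φ. -/
theorem IsCoefficient.exists_weak_commutator {ρ : PhaseSpace n → ℝ} {c : ℝ}
    (h : IsCoefficient ρ c) {p : ℝ} (hp : 0 < p) (hp2 : p ≤ 2) {ε : ℝ} (hε : 0 < ε) :
    ∃ K : ℝ, 0 ≤ K ∧ ∀ (r : ℝ) (f : PhaseL2 n), 0 < r → ∃ P : PhaseL2 n,
      ‖P‖ ≤ ε * ‖dampedMult p r f‖ + K * ‖f‖ ∧
      ∀ Φ : 𝓢(PhaseSpace n, ℂ),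
        (∫ z, (𝓕 (mulLp ρ f) : PhaseL2 n) z * (symbolDv p z * Φ z))
            - ∫ z, f z * fourierMult (symbolDv p) (smulLeftCLM ℂ ρ (𝓕 Φ)) z
          = ∫ z, (1 + r * symbolDv p z) * P z * Φ z := by
  have hS0 : 0 ≤ ∫ z, ‖h.kernel z‖ := by positivity
  set s := ∫ z, ‖h.kernel z‖ with hs
  obtain ⟨C, hC, hb⟩ := exists_abs_dampedSymbol_sub_le (n := n) hp
    (ε := ε / (s + 1)) (by positivity)
  -- A crude bound, used only to justify Fubini for the undivided kernel factor w z - w y.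
  obtain ⟨C₁, hC₁, hb₁⟩ := exists_abs_symbolDv_sub_le (n := n) hp one_pos
  refine ⟨C * ∫ z, ‖(symbolDv p z : ℂ) * h.kernel z‖, by positivity, fun r f hr => ?_⟩
  have hw := continuous_symbolDv (n := n) hp
  have hw0 := symbolDv_nonneg (n := n) p
  have hpos : ∀ z : PhaseSpace n, 0 < 1 + r * symbolDv p z := fun z => by
    have := hw0 z
    positivity
  set F : PhaseL2 n := 𝓕 f with hF
  set w : PhaseSpace n → ℝ := symbolDv p with hwdef
  have hV := coeFn_mulLp (continuous_dampedSymbol hp hr.le) (abs_dampedSymbol_le hr p) F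
  have hκ₀ : Continuous (Function.uncurry fun z y : PhaseSpace n => w z - w y) :=
    (hw.comp continuous_fst).sub (hw.comp continuous_snd)
  have hκ₁ : Continuous (Function.uncurry fun z y : PhaseSpace n =>
      (w z - w y) / (1 + r * w z)) := by
    refine hκ₀.div ?_ fun x => (hpos x.1).ne'
    exact continuous_const.add (continuous_const.mul (hw.comp continuous_fst))
  obtain ⟨Q, hQ, hQn⟩ := exists_kernelOp hp hp2 h.kernel hκ₁
    (dampedSymbol_nonneg hr.le p) hV (ε := ε / (s + 1)) (C := C) (by positivity) hC
    (fun z y => (hb r hr.le z y).2)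
  refine ⟨Q, ?_, fun Φ => ?_⟩
  · rw [hF, Lp.norm_fourier_eq, ← norm_dampedMult] at hQn
    refine hQn.trans (add_le_add_left (mul_le_mul_of_nonneg_right ?_ (norm_nonneg _)) _)
    rw [div_mul_eq_mul_div, div_le_iff₀ (by positivity)]
    nlinarith
  have hwΦ : MemLp (fun z => (w z : ℂ) * Φ z) 2 volume :=
    memLp_symbolDv_mul_schwartz hp hp2 2 Φ
  have hwΦc : Continuous fun z => (w z : ℂ) * Φ z :=
    (Complex.continuous_ofReal.comp hw).mul Φ.continuous
  obtain ⟨i1, i2⟩ := integrable_and_integral_kernelOp_mul hp hp2 h.kernel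
    (κ := fun _ _ => 1) (by fun_prop) (m := fun _ => 1) hwΦc
    (by simpa using hwΦ) (fun z y => by simpa using hw0 (z - y)) F
  obtain ⟨-, i4⟩ := integrable_and_integral_kernelOp_mul hp hp2 h.kernel hκ₀
    (m := fun z => (1 + C₁) * (1 + w z)) Φ.continuous (by
      have := (((Φ.memLp 2 volume).add hwΦ).const_mul ((1 + C₁ : ℝ) : ℂ))
      refine this.ae_eq (ae_of_all _ fun z => ?_)
      simp only [Pi.add_apply]
      push_cast
      ring) (fun z y => by
      have h1 := hb₁ y z
      have e : w (y - z) = w (z - y) := symbolDv_sub_comm p y z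
      rw [abs_sub_comm, e] at h1
      have h2 := hw0 z
      have h3 := hw0 (z - y)
      refine h1.trans ?_
      change _ ≤ (1 + C₁) * (1 + w z) * (1 + w (z - y))
      nlinarith [mul_nonneg h2 h3, mul_nonneg hC₁ h2, mul_nonneg hC₁ (mul_nonneg h2 h3)]) F
  set Ψ : 𝓢(PhaseSpace n, ℂ) := 𝓕⁻ (smulLeftCLM ℂ ρ (𝓕 Φ)) with hΨ
  have hΨe : smulLeftCLM ℂ ρ (𝓕 Φ) = 𝓕 Ψ := (fourier_fourierInv _).symm
  have iΨ := integrable_mul_symbolDv_mul hp hp2 F Ψ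
  have iΦ := integrable_mul_symbolDv_mul hp hp2 F Φ
  have a1 : ∫ z, (𝓕 (mulLp ρ f) : PhaseL2 n) z * (w z * Φ z)
      = c * (∫ z, F z * (w z * Φ z))
        + ∫ z, kernelOp h.kernel (fun _ _ => 1) F z * (w z * Φ z) := by
    have hae := h.fourier_mulLp_ae_eq f
    have j : Integrable fun z => kernelOp h.kernel (fun _ _ => 1) F z * (w z * Φ z) := by
      refine ((integrable_mul_symbolDv_mul hp hp2 (𝓕 (mulLp ρ f) : PhaseL2 n) Φ).sub
        (iΦ.const_mul (c : ℂ))).congr ?_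
      filter_upwards [hae] with z hz
      rw [Pi.sub_apply, hz]
      ring
    rw [← integral_const_mul, ← integral_add (iΦ.const_mul _) j]
    refine integral_congr_ae ?_
    filter_upwards [hae] with z hz
    rw [hz]
    ring
  rw [a1, i2, hΨe, integral_mul_fourierMult_symbolDv hp hp2]
  -- The half of the kernel with w y recombines, by the convolution formula, into Ψ, the inverse
  -- transform of ρ · 𝓕 Φ; the terms with c then cancel.
  have a2 : ∀ y, (∫ z, h.kernel (z - y) * ((w z - w y : ℝ) : ℂ) * Φ z)
      = (∫ z, h.kernel (z - y) * ((1 : ℝ) : ℂ) * (w z * Φ z)) - w y * (Ψ y - c * Φ y) := by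
    intro y
    rw [hΨ, h.fourierInv_smul_fourier, add_sub_cancel_left, ← integral_const_mul, ← integral_sub]
    · refine integral_congr_ae (ae_of_all _ fun z => ?_)
      simp only
      push_cast
      ring
    · simpa using IsCoefficient.integrable_kernel_mul' h.kernel hwΦ y
    · exact (IsCoefficient.integrable_kernel_mul' h.kernel (Φ.memLp 2 volume) y).const_mul _
  have a3 : ∫ z, (1 + r * w z) * Q z * Φ z
      = ∫ z, kernelOp h.kernel (fun z y => w z - w y) F z * Φ z := by
    refine integral_congr_ae ?_
    filter_upwards [hQ] with z hz
    rw [hz, kernelOp, kernelOp, ← integral_const_mul]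
    congr 1
    refine integral_congr_ae (ae_of_all _ fun y => ?_)
    have := (hpos z).ne'
    have e : ((w z - w y : ℝ) : ℂ) = (1 + r * w z) * (((w z - w y) / (1 + r * w z) : ℝ) : ℂ) := by
      rw [← Complex.ofReal_one, ← Complex.ofReal_mul, ← Complex.ofReal_add, ← Complex.ofReal_mul,
        mul_div_cancel₀ _ this]
    simp only [e]
    ring
  have j2 : Integrable fun y => c * (F y * (w y * Φ y))
      + F y * ∫ z, h.kernel (z - y) * ((1 : ℝ) : ℂ) * (w z * Φ z) := (iΦ.const_mul _).add i1
  rw [a3, i4, ← integral_const_mul, ← integral_add (iΦ.const_mul _) i1, ← hF,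
    ← integral_sub j2 iΨ]
  refine integral_congr_ae (ae_of_all _ fun y => ?_)
  change c * (F y * (w y * Φ y)) + F y * (∫ z, h.kernel (z - y) * ((1 : ℝ) : ℂ) * (w z * Φ z))
    - F y * (w y * Ψ y) = F y * _
  rw [a2]
  ring

/-- The transport derivative `∂_t ρ + v · ∇_x ρ` of a real function. -/
noncomputable def realTransport (ρ : PhaseSpace n → ℝ) (z : PhaseSpace n) : ℝ :=
  fderiv ℝ ρ z (tDir n) + ∑ i : Fin n, vPart z i * fderiv ℝ ρ z (xDir i)

namespace IsCoefficient

variable {ρ : PhaseSpace n → ℝ} {c : ℝ}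

theorem continuous_realTransport (h : IsCoefficient ρ c) : Continuous (realTransport ρ) := by
  have h1 : ∀ v : PhaseSpace n, Continuous fun z => fderiv ℝ ρ z v := fun v =>
    (h.contDiff.continuous_fderiv (by simp)).clm_apply continuous_const
  refine (h1 _).add (continuous_finsetSum _ fun i _ => ?_)
  have : Continuous fun z : PhaseSpace n => vPart z i := by
    simp only [vPart]
    fun_prop
  exact this.mul (h1 _)

/-- The factor v is unbounded, but the derivatives of ρ have compact support. -/
theorem exists_abs_realTransport_le (h : IsCoefficient ρ c) :
    ∃ M, ∀ z, |realTransport ρ z| ≤ M := by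
  have hc : HasCompactSupport (realTransport ρ) := by
    refine (h.hasCompactSupport.fderiv (𝕜 := ℝ)).mono' ?_
    intro z hz
    refine subset_tsupport _ ?_
    rw [Function.mem_support] at hz ⊢
    intro h0
    rw [fderiv_sub_const] at h0
    exact hz (by simp [realTransport, h0])
  exact hc.exists_bound_of_continuous h.continuous_realTransport

theorem mul_transport (h : IsCoefficient ρ c) (φ : 𝓢(PhaseSpace n, ℂ)) (z : PhaseSpace n) :
    (ρ z : ℂ) * transport (fun w => φ w) z
      = transport (fun w => smulLeftCLM ℂ ρ φ w) z - realTransport ρ z * φ z := by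
  have hd : ∀ v, fderiv ℝ (fun w => smulLeftCLM ℂ ρ φ w) z v
      = ρ z * fderiv ℝ (fun w => φ w) z v + fderiv ℝ ρ z v * φ z := by
    intro v
    have e : (fun w => smulLeftCLM ℂ ρ φ w) = fun w => ρ w • φ w :=
      funext fun w => smulLeftCLM_apply_apply h.hasTemperateGrowth _ _
    have d : HasFDerivAt (fun w => ρ w • φ w) _ z :=
      (h.contDiff.differentiable (by simp) z).hasFDerivAt.smul
        (φ.differentiableAt (x := z)).hasFDerivAt
    rw [e, d.fderiv]
    simp [ContinuousLinearMap.smulRight_apply]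
  simp only [transport, realTransport, hd]
  push_cast
  rw [mul_add, Finset.mul_sum, add_mul, Finset.sum_mul, add_sub_add_comm, ← Finset.sum_sub_distrib]
  congr 1
  · ring
  · exact Finset.sum_congr rfl fun i _ => by ring

end IsCoefficient

end Commutators

/-! ### Freezing the coefficient on the support of a cutoff. -/

section Localization

open Set Filter Topology PhaseSpace
open scoped ENNReal

variable {n : ℕ}

theorem one_le_one_add_mul_symbolDv {r : ℝ} (hr : 0 ≤ r) (p : ℝ) (z : PhaseSpace n) :
    1 ≤ 1 + r * symbolDv p z := by
  have := mul_nonneg hr (symbolDv_nonneg p z)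
  linarith

theorem continuous_inv_one_add_symbolDv {p r : ℝ} (hp : 0 < p) (hr : 0 ≤ r) :
    Continuous fun z : PhaseSpace n => (1 + r * symbolDv p z)⁻¹ :=
  (continuous_const.add ((continuous_symbolDv hp).const_mul r)).inv₀ fun z =>
    (one_pos.trans_le (one_le_one_add_mul_symbolDv hr p z)).ne'

theorem abs_inv_one_add_symbolDv_le {r : ℝ} (hr : 0 ≤ r) (p : ℝ) (z : PhaseSpace n) :
    |(1 + r * symbolDv p z)⁻¹| ≤ 1 := by
  have := one_le_one_add_mul_symbolDv hr p z
  rw [abs_of_nonneg (by positivity)]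
  exact inv_le_one_of_one_le₀ this

theorem IsCoefficient.const_sub_mul {a χ : PhaseSpace n → ℝ} {ca cχ : ℝ} (ha : IsCoefficient a ca)
    (hχ : IsCoefficient χ cχ) (A : ℝ) :
    IsCoefficient (fun z => (A - a z) * χ z) ((A - ca) * cχ) :=
  (ha.comp (g := fun x => A - x) (by fun_prop)).mul hχ

theorem mulLp_const_sub_mul {a χ : PhaseSpace n → ℝ} {ca cχ : ℝ} (ha : IsCoefficient a ca)
    (hχ : IsCoefficient χ cχ) (A : ℝ) (f : PhaseL2 n) :
    mulLp (fun z => (A - a z) * χ z) f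
      = (A : ℂ) • mulLp χ f - mulLp (fun z => a z * χ z) f := by
  have h1 := ha.const_sub_mul hχ A
  have h2 := ha.mul hχ
  obtain ⟨M₁, hM₁⟩ := h1.exists_abs_le
  obtain ⟨M₂, hM₂⟩ := h2.exists_abs_le
  obtain ⟨M₃, hM₃⟩ := hχ.exists_abs_le
  refine Lp.ext ?_
  filter_upwards [coeFn_mulLp h1.continuous hM₁ f, coeFn_mulLp h2.continuous hM₂ f,
    coeFn_mulLp hχ.continuous hM₃ f,
    Lp.coeFn_sub ((A : ℂ) • mulLp χ f) (mulLp (fun z => a z * χ z) f),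
    Lp.coeFn_smul (A : ℂ) (mulLp χ f)] with z e1 e2 e3 e4 e5
  rw [e1, e4, Pi.sub_apply, e5, Pi.smul_apply, e2, e3, smul_eq_mul]
  push_cast
  ring

/-- Writing T for the transport, T(χf) + A|D_v|^p(χf) equals χg + (Tχ)f + |D_v|^p((A - a)χf) +
[|D_v|^p, aχ]f. The four terms are written as 1 + r|D_v|^p applied to L² functions; for the
commutator this is `hP`. -/
theorem IsKineticSolution.isFrozenSolution_mulLp {β : ℝ} (hβ0 : 0 < β) (hβ1 : β ≤ 1)
    {a χ : PhaseSpace n → ℝ} {ca cχ : ℝ} (ha : IsCoefficient a ca) (hχ : IsCoefficient χ cχ)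
    {f g : PhaseL2 n} (h : IsKineticSolution β a f g) (A : ℝ) {r : ℝ} (hr : 0 < r)
    {P : PhaseL2 n}
    (hP : ∀ Φ : 𝓢(PhaseSpace n, ℂ),
      (∫ z, (𝓕 (mulLp (fun z => a z * χ z) f) : PhaseL2 n) z * (symbolDv (2 * β) z * Φ z))
          - ∫ z, f z * fourierMult (symbolDv (2 * β))
              (smulLeftCLM ℂ (fun z => a z * χ z) (𝓕 Φ)) z
        = ∫ z, (1 + r * symbolDv (2 * β) z) * P z * Φ z) :
    IsFrozenSolution (2 * β) A r (𝓕 (mulLp χ f))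
      (mulLp (fun z => (1 + r * symbolDv (2 * β) z)⁻¹)
          (𝓕 (mulLp χ g + mulLp (realTransport χ) f))
        + mulLp (dampedSymbol (2 * β) r) (𝓕 (mulLp (fun z => (A - a z) * χ z) f)) + P) := by
  intro Φ
  have hp : 0 < 2 * β := by linarith
  have hp2 : 2 * β ≤ 2 := by linarith
  set w : PhaseSpace n → ℝ := symbolDv (2 * β) with hw
  set G : PhaseL2 n := mulLp χ g + mulLp (realTransport χ) f with hG
  set H : PhaseL2 n := mulLp (fun z => (A - a z) * χ z) f with hH
  obtain ⟨Mχ, hMχ⟩ := hχ.exists_abs_le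
  obtain ⟨MT, hMT⟩ := hχ.exists_abs_realTransport_le
  set φ : 𝓢(PhaseSpace n, ℂ) := 𝓕 Φ with hφ
  have e1 : ∫ z, (𝓕 (mulLp χ f) : PhaseL2 n) z
        * (fderiv ℝ Φ z (shear n z) + 2 * Real.pi * Complex.I * z (Sum.inl ()) * Φ z)
      = (∫ z, f z * -transport (fun w => smulLeftCLM ℂ χ φ w) z)
        + ∫ z, mulLp (realTransport χ) f z * φ z := by
    rw [← integral_mul_neg_transport_fourier, integral_mulLp_mul hχ.continuous hMχ,
      integral_mulLp_mul hχ.continuous_realTransport hMT, ← integral_add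
        (integrable_mul_neg_transport f _) (by
          refine (integrable_mul_schwartz (mulLp (realTransport χ) f) φ).congr ?_
          filter_upwards [coeFn_mulLp hχ.continuous_realTransport hMT f] with z hz
          rw [hz]
          ring)]
    refine integral_congr_ae (ae_of_all _ fun z => ?_)
    have := hχ.mul_transport φ z
    change f z * (χ z * -transport (fun w => φ w) z) = f z * -transport _ z + f z * _
    linear_combination (-f z) * this
  have e2 := h.integral_add_integral hβ0 hβ1 (φ := smulLeftCLM ℂ χ φ)
    (ψ := smulLeftCLM ℂ (fun z => a z * χ z) φ) (fun z => by
      rw [smulLeftCLM_apply_apply (ha.mul hχ).hasTemperateGrowth,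
        smulLeftCLM_apply_apply hχ.hasTemperateGrowth]
      simp only [Complex.real_smul]
      push_cast
      ring)
  have e3 : ∫ z, g z * smulLeftCLM ℂ χ φ z = ∫ z, mulLp χ g z * φ z := by
    rw [integral_mulLp_mul hχ.continuous hMχ]
    simp only [smulLeftCLM_apply_apply hχ.hasTemperateGrowth, Complex.real_smul]
  have e4 : ∫ z, (𝓕 G : PhaseL2 n) z * Φ z
      = (∫ z, mulLp χ g z * φ z) + ∫ z, mulLp (realTransport χ) f z * φ z := by
    rw [integral_fourier_mul_schwartz, ← integral_add (integrable_mul_schwartz _ _)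
      (integrable_mul_schwartz _ _)]
    refine integral_congr_ae ?_
    filter_upwards [Lp.coeFn_add (mulLp χ g) (mulLp (realTransport χ) f)] with z hz
    rw [hG, hz, Pi.add_apply]
    ring
  have e5 : ∫ z, (𝓕 H : PhaseL2 n) z * (w z * Φ z)
      = A * (∫ z, (𝓕 (mulLp χ f) : PhaseL2 n) z * (w z * Φ z))
        - ∫ z, (𝓕 (mulLp (fun z => a z * χ z) f) : PhaseL2 n) z * (w z * Φ z) := by
    have hFH : (𝓕 H : PhaseL2 n)
        = (A : ℂ) • 𝓕 (mulLp χ f) - 𝓕 (mulLp (fun z => a z * χ z) f) := by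
      rw [hH, mulLp_const_sub_mul ha hχ]
      exact ((Lp.fourierTransformₗᵢ (PhaseSpace n) ℂ).map_sub _ _).trans
        (congrArg (· - _) ((Lp.fourierTransformₗᵢ (PhaseSpace n) ℂ).map_smul _ _))
    rw [hFH, ← integral_const_mul, ← integral_sub
      ((integrable_mul_symbolDv_mul hp hp2 _ Φ).const_mul _)
      (integrable_mul_symbolDv_mul hp hp2 _ Φ)]
    refine integral_congr_ae ?_
    filter_upwards [Lp.coeFn_sub ((A : ℂ) • (𝓕 (mulLp χ f) : PhaseL2 n))
      (𝓕 (mulLp (fun z => a z * χ z) f)), Lp.coeFn_smul (A : ℂ) (𝓕 (mulLp χ f) : PhaseL2 n)]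
      with z h1 h2
    rw [h1, Pi.sub_apply, h2, Pi.smul_apply, smul_eq_mul]
    ring
  have iP : Integrable fun z => (1 + r * w z) * P z * Φ z := by
    refine ((integrable_mul_schwartz P Φ).add
      ((integrable_mul_symbolDv_mul hp hp2 P Φ).const_mul (r : ℂ))).congr
      (ae_of_all _ fun z => ?_)
    simp only [Pi.add_apply]
    ring
  have e6 : ∫ z, (1 + r * w z) * (mulLp (fun z => (1 + r * w z)⁻¹) (𝓕 G)
        + mulLp (dampedSymbol (2 * β) r) (𝓕 H) + P : PhaseL2 n) z * Φ z
      = (∫ z, (𝓕 G : PhaseL2 n) z * Φ z) + (∫ z, (𝓕 H : PhaseL2 n) z * (w z * Φ z))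
        + ∫ z, (1 + r * w z) * P z * Φ z := by
    have iG := integrable_mul_schwartz (𝓕 G : PhaseL2 n) Φ
    have iH := integrable_mul_symbolDv_mul hp hp2 (𝓕 H : PhaseL2 n) Φ
    have iGH : Integrable fun z => (𝓕 G : PhaseL2 n) z * Φ z
      + (𝓕 H : PhaseL2 n) z * (w z * Φ z) := iG.add iH
    rw [← integral_add iG iH, ← integral_add iGH iP]
    refine integral_congr_ae ?_
    filter_upwards [Lp.coeFn_add (mulLp (fun z => (1 + r * w z)⁻¹) (𝓕 G)
        + mulLp (dampedSymbol (2 * β) r) (𝓕 H)) P,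
      Lp.coeFn_add (mulLp (fun z => (1 + r * w z)⁻¹) (𝓕 G))
        (mulLp (dampedSymbol (2 * β) r) (𝓕 H)),
      coeFn_mulLp (continuous_inv_one_add_symbolDv hp hr.le)
        (abs_inv_one_add_symbolDv_le hr.le _) (𝓕 G : PhaseL2 n),
      coeFn_mulLp (continuous_dampedSymbol hp hr.le) (abs_dampedSymbol_le hr _)
        (𝓕 H : PhaseL2 n)] with z h1 h2 h3 h4
    rw [h1, Pi.add_apply, h2, Pi.add_apply, h3, h4, dampedSymbol, ← hw]
    have hne : (1 + r * w z : ℂ) ≠ 0 := by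
      have := (one_pos.trans_le (one_le_one_add_mul_symbolDv hr.le (2 * β) z)).ne'
      exact_mod_cast this
    push_cast
    field_simp
  rw [integral_frozen hp hp2, e1, e6, ← hP, e4, e5, ← e3, ← e2]
  ring

/-- With v the regularized multiplier applied to f, commuting that multiplier past (A - a)χ leaves
δ‖χv‖, which `hδA` absorbs into the left side. This is legitimate because v is in L² for r > 0. -/
theorem IsCoefficient.exists_norm_mulLp_dampedMult_le (hn : 1 ≤ n) {β : ℝ} (hβ0 : 0 < β)
    (hβ1 : β ≤ 1) {a χ : PhaseSpace n → ℝ} {ca cχ : ℝ} (ha : IsCoefficient a ca)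
    (hχ : IsCoefficient χ cχ) {A δ : ℝ} (hA : 0 < A) (hδ : 0 ≤ δ)
    (hδχ : ∀ z, |(A - a z) * χ z| ≤ δ * |χ z|)
    (hδA : (3 ^ (2 * β + 1) + 1) / A * δ ≤ 1 / 2) {ε : ℝ} (hε : 0 < ε) :
    ∃ K : ℝ, 0 ≤ K ∧ ∀ (r : ℝ) (f g : PhaseL2 n), 0 < r → IsKineticSolution β a f g →
      ‖mulLp χ (dampedMult (2 * β) r f)‖
        ≤ ε * ‖dampedMult (2 * β) r f‖ + K * (‖f‖ + ‖g‖) := by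
  have hp : 0 < 2 * β := by linarith
  have hp2 : 2 * β ≤ 2 := by linarith
  have hD : 0 ≤ (3 ^ (2 * β + 1) + 1) / A := by positivity
  set D := (3 ^ (2 * β + 1) + 1) / A with hDdef
  have hρ := ha.const_sub_mul hχ A
  obtain ⟨Mχ, hMχ⟩ := hχ.exists_abs_le
  obtain ⟨MT, hMT⟩ := hχ.exists_abs_realTransport_le
  have hMχ0 : 0 ≤ Mχ := (abs_nonneg _).trans (hMχ 0)
  have hMT0 : 0 ≤ MT := (abs_nonneg _).trans (hMT 0)
  obtain ⟨K₁, hK₁, c₁⟩ := hχ.exists_norm_commutator_le hp hp2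
    (ε := ε / (2 * (1 + 2 * D))) (by positivity)
  obtain ⟨K₂, hK₂, c₂⟩ := hρ.exists_norm_commutator_le hp hp2
    (ε := ε / (2 * (1 + 2 * D))) (by positivity)
  obtain ⟨K₃, hK₃, c₃⟩ := (ha.mul hχ).exists_weak_commutator hp hp2
    (ε := ε / (2 * (1 + 2 * D))) (by positivity)
  set η := ε / (2 * (1 + 2 * D)) with hη
  -- Three commutators each cost η‖v‖: one outside the frozen estimate and two inside it, hence
  -- multiplied by D. The absorption doubles the total.
  have hηe : 2 * ((1 + 2 * D) * η) = ε := by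
    rw [hη]
    field_simp
  refine ⟨2 * (D * (Mχ + MT + K₂ + K₃) + K₁), by positivity, fun r f g hr h => ?_⟩
  obtain ⟨P, hPn, hP⟩ := c₃ r f hr
  have hF := h.isFrozenSolution_mulLp hβ0 hβ1 ha hχ A hr hP
  obtain ⟨V, hV, hVn⟩ := hF.exists_symbolDv hn hp hA hr.le
  have hVe : ‖dampedMult (2 * β) r (mulLp χ f)‖ = ‖V‖ := by
    rw [norm_dampedMult]
    congr 1
    exact Lp.ext ((coeFn_mulLp (continuous_dampedSymbol hp hr.le)
      (abs_dampedSymbol_le hr _) _).trans hV.symm)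
  set v := dampedMult (2 * β) r f with hv
  have n1 : ‖mulLp χ v‖ ≤ ‖V‖ + (η * ‖v‖ + K₁ * ‖f‖) := by
    rw [← hVe]
    have := norm_le_norm_add_norm_sub (dampedMult (2 * β) r (mulLp χ f)) (mulLp χ v)
    linarith [c₁ r f hr]
  have n2 : ‖dampedMult (2 * β) r (mulLp (fun z => (A - a z) * χ z) f)‖
      ≤ δ * ‖mulLp χ v‖ + (η * ‖v‖ + K₂ * ‖f‖) := by
    have t1 := norm_le_norm_add_norm_sub (mulLp (fun z => (A - a z) * χ z) v)
      (dampedMult (2 * β) r (mulLp (fun z => (A - a z) * χ z) f))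
    rw [norm_sub_rev] at t1
    have t2 := norm_mulLp_le_mul_norm_mulLp hρ.continuous hχ.continuous hMχ hδ hδχ v
    linarith [c₂ r f hr]
  rw [norm_dampedMult] at n2
  have n3 : ‖mulLp (fun z => (1 + r * symbolDv (2 * β) z)⁻¹)
      (𝓕 (mulLp χ g + mulLp (realTransport χ) f))‖ ≤ Mχ * ‖g‖ + MT * ‖f‖ := by
    refine (norm_mulLp_le (continuous_inv_one_add_symbolDv hp hr.le)
      (abs_inv_one_add_symbolDv_le hr.le _) _).trans ?_
    rw [one_mul, Lp.norm_fourier_eq]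
    exact (norm_add_le _ _).trans (add_le_add (norm_mulLp_le hχ.continuous hMχ g)
      (norm_mulLp_le hχ.continuous_realTransport hMT f))
  have n4 : ‖V‖ ≤ D * ((Mχ * ‖g‖ + MT * ‖f‖) + (δ * ‖mulLp χ v‖ + (η * ‖v‖ + K₂ * ‖f‖))
      + (η * ‖v‖ + K₃ * ‖f‖)) := by
    refine hVn.trans (mul_le_mul_of_nonneg_left ?_ hD)
    exact (norm_add₃_le).trans (add_le_add (add_le_add n3 n2) hPn)
  have hX := norm_nonneg (mulLp χ v)
  have hf := norm_nonneg f
  have hg := norm_nonneg g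
  have n5 : D * (δ * ‖mulLp χ v‖) ≤ 1 / 2 * ‖mulLp χ v‖ := by
    rw [← mul_assoc]
    exact mul_le_mul_of_nonneg_right hδA hX
  have n6 : D * (Mχ * ‖g‖ + MT * ‖f‖ + K₂ * ‖f‖ + K₃ * ‖f‖)
      ≤ D * ((Mχ + MT + K₂ + K₃) * (‖f‖ + ‖g‖)) := by
    refine mul_le_mul_of_nonneg_left ?_ hD
    nlinarith [mul_nonneg hMχ0 hf, mul_nonneg hMT0 hg, mul_nonneg hK₂ hg, mul_nonneg hK₃ hg]
  have n7 : K₁ * ‖f‖ ≤ K₁ * (‖f‖ + ‖g‖) := mul_le_mul_of_nonneg_left (by linarith) hK₁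
  rw [← hηe]
  linarith

end Localization

/-! ### Summation over the levels of the coefficient, and removal of the regularization. -/

section VariableCoefficient

open Set Filter Topology PhaseSpace
open scoped ENNReal

variable {n : ℕ}

theorem norm_le_sum_norm_mulLp {ι : Type*} (s : Finset ι) {χ : ι → PhaseSpace n → ℝ}
    (hχ : ∀ j, Continuous (χ j)) {M : ι → ℝ} (hM : ∀ j z, |χ j z| ≤ M j)
    (h0 : ∀ j z, 0 ≤ χ j z) (h1 : ∀ z, ∃ j ∈ s, 1 ≤ χ j z) (v : PhaseL2 n) :
    ‖v‖ ≤ ∑ j ∈ s, ‖mulLp (χ j) v‖ := by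
  have hae : ∀ᵐ z, ∀ j ∈ s, mulLp (χ j) v z = (χ j z : ℂ) * v z :=
    (Finset.eventually_all s).2 fun j _ => coeFn_mulLp (hχ j) (hM j) v
  have h : ‖v‖ ≤ 1 * ‖∑ j ∈ s, mulLp (χ j) v‖ := by
    refine norm_le_mul_norm_of_ae ?_
    filter_upwards [hae, Lp.coeFn_fun_finsetSum s fun j => mulLp (χ j) v] with z hz hs
    rw [hs, Finset.sum_congr rfl hz, ← Finset.sum_mul, ← Complex.ofReal_sum, norm_mul,
      Complex.norm_real, one_mul]
    obtain ⟨j, hj, hj1⟩ := h1 z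
    have h2 : 1 ≤ ∑ j ∈ s, χ j z :=
      hj1.trans (Finset.single_le_sum (f := fun j => χ j z) (fun i _ => h0 i z) hj)
    have h3 : 1 ≤ ‖∑ j ∈ s, χ j z‖ := h2.trans (le_abs_self _)
    exact le_mul_of_one_le_left (norm_nonneg _) h3
  rw [one_mul] at h
  exact h.trans (norm_sum_le _ _)

/-- The cutoffs are functions of the value of a rather than of the position. They are therefore
smooth and constant outside a compact set, and since a is bounded, finitely many cover the whole
space. -/
theorem IsCoefficient.exists_norm_dampedMult_le (hn : 1 ≤ n) {β : ℝ} (hβ0 : 0 < β)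
    (hβ1 : β ≤ 1) {a : PhaseSpace n → ℝ} {ca aMinus : ℝ} (ha : IsCoefficient a ca)
    (ha0 : 0 < aMinus) (haz : ∀ z, aMinus ≤ a z) :
    ∃ K : ℝ, 0 ≤ K ∧ ∀ (r : ℝ) (f g : PhaseL2 n), 0 < r → IsKineticSolution β a f g →
      ‖dampedMult (2 * β) r f‖ ≤ K * (‖f‖ + ‖g‖) := by
  obtain ⟨M, hM⟩ := ha.exists_abs_le
  have hC : 0 < (3 : ℝ) ^ (2 * β + 1) + 1 := by positivity
  set C := (3 : ℝ) ^ (2 * β + 1) + 1 with hCdef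
  -- On the support of a cutoff |a - A j| ≤ 2h, and the absorption condition C / A j · 2h ≤ 1/2 must
  -- hold for every A j ≥ aMinus.
  set h := aMinus / (4 * C) with hh
  have hh0 : 0 < h := by positivity
  -- The plateau has half-width h, equal to the spacing of the levels A j, so every value of a lies
  -- on a plateau.
  let κ : ContDiffBump (0 : ℝ) := ⟨h, 2 * h, hh0, by linarith⟩
  set A : ℕ → ℝ := fun j => aMinus + j * h with hA
  have hAm : ∀ j, aMinus ≤ A j := fun j => by
    have : 0 ≤ (j : ℝ) * h := by positivity
    simp only [hA]
    linarith
  have hχ : ∀ j, IsCoefficient (fun z => κ (a z - A j)) (κ (ca - A j)) := fun j =>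
    ha.comp (g := fun x => κ (x - A j)) (κ.contDiff.comp (contDiff_id.sub contDiff_const))
  have hκ1 : ∀ j z, |κ (a z - A j)| ≤ 1 := fun j z => by
    rw [abs_of_nonneg κ.nonneg]
    exact κ.le_one
  set N := ⌊(M - aMinus) / h⌋₊ + 1 with hN
  have hloc : ∀ j, ∃ K : ℝ, 0 ≤ K ∧ ∀ (r : ℝ) (f g : PhaseL2 n), 0 < r →
      IsKineticSolution β a f g → ‖mulLp (fun z => κ (a z - A j)) (dampedMult (2 * β) r f)‖
        -- Summed over the N levels, the first terms make up half of the norm being estimated.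
        ≤ 1 / (2 * N) * ‖dampedMult (2 * β) r f‖ + K * (‖f‖ + ‖g‖) := by
    intro j
    have hN0 : 0 < (N : ℝ) := by rw [hN]; positivity
    refine ha.exists_norm_mulLp_dampedMult_le hn hβ0 hβ1 (hχ j) (A := A j) (δ := 2 * h)
      (ha0.trans_le (hAm j)) (by positivity) (fun z => ?_) ?_ (by positivity)
    · rw [abs_mul]
      rcases le_or_gt |A j - a z| (2 * h) with hz | hz
      · exact mul_le_mul_of_nonneg_right hz (abs_nonneg _)
      · have : κ (a z - A j) = 0 := κ.zero_of_le_dist (by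
          rw [Real.dist_eq, sub_zero, abs_sub_comm]
          exact hz.le)
        rw [this, abs_zero, mul_zero, mul_zero]
    · calc C / A j * (2 * h) ≤ C / aMinus * (2 * h) := by
            gcongr
            exact hAm j
        _ = 1 / 2 := by
            rw [hh]
            field_simp
            norm_num
  choose K hK0 hK using hloc
  refine ⟨2 * ∑ j ∈ Finset.range N, K j,
    mul_nonneg zero_le_two (Finset.sum_nonneg fun j _ => hK0 j), fun r f g hr hfg => ?_⟩
  set v := dampedMult (2 * β) r f with hv
  have hN0 : 0 < (N : ℝ) := by rw [hN]; positivity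
  have hcover : ∀ z, ∃ j ∈ Finset.range N, 1 ≤ κ (a z - A j) := by
    intro z
    have h0 : 0 ≤ (a z - aMinus) / h := div_nonneg (by linarith [haz z]) hh0.le
    refine ⟨⌊(a z - aMinus) / h⌋₊, ?_, ?_⟩
    · rw [Finset.mem_range, hN, Nat.lt_add_one_iff]
      refine Nat.floor_le_floor ?_
      have := (le_abs_self _).trans (hM z)
      gcongr
    · refine (κ.one_of_mem_closedBall ?_).ge
      have l1 := Nat.floor_le h0
      have l2 := Nat.lt_floor_add_one ((a z - aMinus) / h)
      rw [le_div_iff₀ hh0] at l1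
      rw [div_lt_iff₀ hh0] at l2
      rw [Metric.mem_closedBall, Real.dist_eq, sub_zero, abs_le]
      change -h ≤ a z - (aMinus + _ * h) ∧ a z - (aMinus + _ * h) ≤ h
      constructor <;> linarith
  have hsum : ‖v‖ ≤ ∑ j ∈ Finset.range N, (1 / (2 * N) * ‖v‖ + K j * (‖f‖ + ‖g‖)) :=
    (norm_le_sum_norm_mulLp (Finset.range N) (fun j => (hχ j).continuous) hκ1
      (fun j z => κ.nonneg) hcover v).trans (Finset.sum_le_sum fun j _ => hK j r f g hr hfg)
  rw [Finset.sum_add_distrib, Finset.sum_const, Finset.card_range, ← Finset.sum_mul,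
    nsmul_eq_mul] at hsum
  have e : (N : ℝ) * (1 / (2 * N) * ‖v‖) = ‖v‖ / 2 := by
    field_simp
  rw [e] at hsum
  linarith

/-- The regularized symbols converge pointwise to the full one as r → 0, so Fatou's lemma carries
the uniform bound over and shows that |D_v|^p f is in L². -/
theorem exists_isFourierMult_of_dampedMult_le {p : ℝ} (hp : 0 < p) {f : PhaseL2 n} {C : ℝ}
    (hC : 0 ≤ C) (h : ∀ r : ℝ, 0 < r → ‖dampedMult p r f‖ ≤ C) :
    ∃ fv : PhaseL2 n, IsFourierMult (symbolDv p) f fv ∧ ‖fv‖ ≤ C := by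
  set F : PhaseL2 n := 𝓕 f with hF
  have hw := continuous_symbolDv (n := n) hp
  have hFm := (Lp.stronglyMeasurable F).measurable.enorm
  set r : ℕ → ℝ := fun k => 1 / ((k : ℝ) + 1) with hr
  have hr0 : ∀ k, 0 < r k := fun k => by positivity
  have hle : ∀ k, ∫⁻ z, (ENNReal.ofReal (dampedSymbol p (r k) z) * ‖F z‖ₑ) ^ 2
      ≤ ENNReal.ofReal C ^ 2 := by
    intro k
    have h1 := h (r k) (hr0 k)
    rw [norm_dampedMult] at h1
    refine le_trans (le_of_eq ?_) (pow_le_pow_left' (ENNReal.ofReal_le_ofReal h1) 2)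
    rw [ofReal_norm_sq_eq_lintegral]
    refine lintegral_congr_ae ?_
    filter_upwards [coeFn_mulLp (continuous_dampedSymbol hp (hr0 k).le)
      (abs_dampedSymbol_le (hr0 k) p) F] with z hz
    rw [hz, enorm_mul, ← ofReal_norm (dampedSymbol p (r k) z : ℂ), Complex.norm_real,
      Real.norm_of_nonneg (dampedSymbol_nonneg (hr0 k).le p z)]
  have hlim : ∀ z, Tendsto (fun k => (ENNReal.ofReal (dampedSymbol p (r k) z) * ‖F z‖ₑ) ^ 2)
      atTop (𝓝 ((ENNReal.ofReal (symbolDv p z) * ‖F z‖ₑ) ^ 2)) := by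
    intro z
    have t0 : Tendsto r atTop (𝓝 0) := tendsto_one_div_add_atTop_nhds_zero_nat
    have t1 : Tendsto (fun k => dampedSymbol p (r k) z) atTop (𝓝 (symbolDv p z)) := by
      have := (tendsto_const_nhds (x := symbolDv p z)).div
        ((t0.mul_const (symbolDv p z)).const_add 1) (by simp)
      rw [zero_mul, add_zero, div_one] at this
      exact this
    exact (ENNReal.continuous_pow 2).continuousAt.tendsto.comp
      (ENNReal.Tendsto.mul_const ((ENNReal.continuous_ofReal.tendsto _).comp t1)
        (Or.inr enorm_ne_top))
  have hbound : ∫⁻ z, (ENNReal.ofReal (symbolDv p z) * ‖F z‖ₑ) ^ 2 ≤ ENNReal.ofReal C ^ 2 := by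
    calc _ = ∫⁻ z, liminf (fun k => (ENNReal.ofReal (dampedSymbol p (r k) z) * ‖F z‖ₑ) ^ 2)
          atTop := lintegral_congr fun z => (hlim z).liminf_eq.symm
      _ ≤ _ := lintegral_liminf_le fun k => by
          have := (continuous_dampedSymbol (n := n) hp (hr0 k).le).measurable
          exact (this.ennreal_ofReal.mul hFm).pow_const 2
      _ ≤ _ := liminf_le_of_frequently_le' (Frequently.of_forall hle)
  obtain ⟨V, hV, hVn⟩ := exists_mul_of_lintegral_le hw.measurable (symbolDv_nonneg p) hC hbound
  obtain ⟨fv, h1, h2⟩ := exists_isFourierMult hV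
  exact ⟨fv, h1, h2.trans_le hVn⟩

/-- With `|D_v|^{2β} f ∈ L²`, the coefficient of the diffusion can be changed to one. -/
theorem IsKineticSolution.one_of_isFourierMult {β : ℝ} (hβ0 : 0 < β) (hβ1 : β ≤ 1)
    {a : PhaseSpace n → ℝ} {ca : ℝ} (ha : IsCoefficient a ca) {f g fv : PhaseL2 n}
    (h : IsKineticSolution β a f g) (hfv : IsFourierMult (symbolDv (2 * β)) f fv) :
    IsKineticSolution β (fun _ => 1) f (g + mulLp (fun z => 1 - a z) fv) := by
  have hp : 0 < 2 * β := by linarith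
  have hp2 : 2 * β ≤ 2 := by linarith
  have ha' := ha.comp (g := fun x => 1 - x) (by fun_prop)
  obtain ⟨M, hM⟩ := ha'.exists_abs_le
  intro φ
  have hae : ∀ z, smulLeftCLM ℂ a φ z = a z * φ z := fun z => by
    rw [smulLeftCLM_apply_apply ha.hasTemperateGrowth, Complex.real_smul]
  have e1 := h.integral_add_integral hβ0 hβ1 hae
  rw [hfv.integral_mul_fourierMult hp hp2] at e1
  have e2 : ∫ z, f z * (-transport (fun w => φ w) z
        + fourierMult (symbolDv (2 * β)) (fun w => ((1 : ℝ) : ℂ) * φ w) z)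
      = (∫ z, f z * -transport (fun w => φ w) z) + ∫ z, fv z * φ z := by
    simp only [Complex.ofReal_one, one_mul]
    rw [← hfv.integral_mul_fourierMult hp hp2, ← integral_add (integrable_mul_neg_transport f φ)
      (integrable_mul_fourierMult hp hp2 f φ)]
    simp only [mul_add]
  have e3 : ∫ z, (g + mulLp (fun z => 1 - a z) fv : PhaseL2 n) z * φ z
      = (∫ z, g z * φ z)
        + ((∫ z, fv z * φ z) - ∫ z, fv z * smulLeftCLM ℂ a φ z) := by
    have i : Integrable fun z => fv z * φ z - fv z * smulLeftCLM ℂ a φ z :=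
      (integrable_mul_schwartz _ _).sub (integrable_mul_schwartz _ _)
    rw [← integral_sub (integrable_mul_schwartz _ _) (integrable_mul_schwartz _ _),
      ← integral_add (integrable_mul_schwartz _ _) i]
    refine integral_congr_ae ?_
    filter_upwards [Lp.coeFn_add g (mulLp (fun z => 1 - a z) fv),
      coeFn_mulLp ha'.continuous hM fv] with z h1 h2
    rw [h1, Pi.add_apply, h2, hae]
    push_cast
    ring
  rw [e2, e3, ← e1]
  ring

end VariableCoefficient

theorem theorem1p2 (n : ℕ) (hn : 1 ≤ n) (β : ℝ) (hβ0 : 0 < β) (hβ1 : β ≤ 1) :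
    (∃ C : ℝ, ∀ f g : PhaseL2 n,
      IsKineticSolution β (fun _ => 1) f g →
      ∃ fv fx : PhaseL2 n,
        IsFourierMult (symbolDv (2 * β)) f fv ∧
        IsFourierMult (symbolDx (2 * β / (1 + 2 * β))) f fx ∧
        ‖fv‖ + ‖fx‖ ≤ C * ‖g‖) ∧
    (∀ (b χ : PhaseSpace n → ℝ) (aMinus : ℝ),
      ContDiff ℝ ∞ b → (∀ z, 0 ≤ b z) →
      ContDiff ℝ ∞ χ → HasCompactSupport χ → (∀ z, 0 ≤ χ z) →
      0 < aMinus →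
      ∃ C : ℝ, ∀ f g : PhaseL2 n,
        IsKineticSolution β (fun z => b z ^ 2 * χ z + aMinus) f g →
        ∃ fv fx : PhaseL2 n,
          IsFourierMult (symbolDv (2 * β)) f fv ∧
          IsFourierMult (symbolDx (2 * β / (1 + 2 * β))) f fx ∧
          ‖fv‖ + ‖fx‖ ≤ C * (‖g‖ + ‖f‖)) := by
  constructor
  · refine ⟨(3 ^ (2 * β + 1) + 1) + 8 * Real.exp 1, fun f g h => ?_⟩
    obtain ⟨⟨fv, hv, hvn⟩, fx, hx, hxn⟩ := h.exists_fourierMult_of_one hn hβ0 hβ1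
    exact ⟨fv, fx, hv, hx, by linarith⟩
  · intro b χ aMinus hb _ hχ hχc hχ0 ha0
    have ha : IsCoefficient (fun z => b z ^ 2 * χ z + aMinus) aMinus := by
      refine ⟨((hb.pow 2).mul hχ).add contDiff_const, ?_⟩
      simp only [add_sub_cancel_right]
      exact hχc.mul_left
    obtain ⟨K, hK0, hK⟩ := ha.exists_norm_dampedMult_le hn hβ0 hβ1 ha0 fun z =>
      le_add_of_nonneg_left (mul_nonneg (sq_nonneg _) (hχ0 z))
    have ha' := ha.comp (g := fun x => 1 - x) (by fun_prop)
    obtain ⟨M, hM⟩ := ha'.exists_abs_le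
    -- K bounds the v-part. The x-part is that of the equation with coefficient one and source g +
    -- (1 - a)|D_v|^{2β} f, where |1 - a| ≤ M.
    refine ⟨K + 8 * Real.exp 1 * (1 + M * K), fun f g h => ?_⟩
    obtain ⟨fv, hv, hvn⟩ := exists_isFourierMult_of_dampedMult_le (by linarith)
      (by positivity) fun r hr => hK r f g hr h
    obtain ⟨-, fx, hx, hxn⟩ :=
      (h.one_of_isFourierMult hβ0 hβ1 ha hv).exists_fourierMult_of_one hn hβ0 hβ1
    refine ⟨fv, fx, hv, hx, ?_⟩
    have hM0 : 0 ≤ M := (abs_nonneg _).trans (hM 0)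
    have h1 : ‖g + mulLp (fun z => 1 - (b z ^ 2 * χ z + aMinus)) fv‖
        ≤ ‖g‖ + M * (K * (‖f‖ + ‖g‖)) :=
      (norm_add_le _ _).trans (add_le_add_right ((norm_mulLp_le ha'.continuous hM fv).trans
        (mul_le_mul_of_nonneg_left hvn hM0)) _)
    have h2 : ‖g‖ + M * (K * (‖f‖ + ‖g‖)) ≤ (1 + M * K) * (‖g‖ + ‖f‖) := by
      nlinarith [norm_nonneg f]
    have h3 := hxn.trans (mul_le_mul_of_nonneg_left (h1.trans h2) (by positivity))
    linarith
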